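/- Let $k$ be a commutative ring and let $F=\bigoplus_{i\ge 0}F_i$ be an $\mathbb N$-graded (purely even) associative unital $k$-algebra, free as a $k$-module with a finite basis $B$. Assume that $F$ is graded symmetric of top degree $\delta$: there is a linear form $\operatorname{tr}\colon F\to k$ with $\operatorname{tr}(fg)=\operatorname{tr}(gf)$ for all $f,g$, vanishing on $F_i$ for $i\neq\delta$, and such that $f\mapsto(g\mapsto\operatorname{tr}(gf))$ is an isomorphism $F\to\operatorname{Hom}_k(F,k)$. Let $\{b^\vee\}_{b\in B}$ be the dual basis, $\operatorname{tr}(b^\vee c)=\delta_{b,c}$ for $b,c\in B$. (The trivial grading $F=F_0$, $\delta=0$ is allowed.) Let $n\ge1$. For $f\in F$ let $f_i\in F^{\otimes n}$ be $f$ placed in the $i$-th tensor factor. The affine wreath product algebra (affinized symmetric algebra) $\mathcal A_n(F)$ is the free product of $k$-algebras $k[x_1,\dots,x_n]\star F^{\otimes n}\star kS_n$ modulo the relations $$\mathbf f x_i=x_i\mathbf f,\qquad \pi\mathbf f=({}^{\pi}\mathbf f)\,\pi,\qquad s_ix_j=x_js_i\ (j\ne i,i+1),\qquad s_ix_i=x_{i+1}s_i-\sum_{b\in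 B}b_i\,b^\vee_{i+1},$$ for $\mathbf f\in F^{\otimes n}$, $\pi\in S_n$, where $S_n$ acts on $F^{\otimes n}$ by permuting tensor factors and $s_i=(i,i+1)$. It is graded by $\deg x_i=\delta$, $\deg\pi=0$ and the given degrees on $F^{\otimes n}$. Let $d\ge0$ and let $C=(c_1,\dots,c_d)$ be elements of $F^{\otimes n}$ of degree $\delta$ that lie in the image of $Z(F)^{\otimes n}$ and are invariant under all permutations fixing the index $1$ (for instance, under all of $S_n$). Let $\mathcal A_n^C(F)$ be the quotient of $\mathcal A_n(F)$ by the two-sided ideal generated by $\prod_{j=1}^d(x_1-c_j)$, with the induced grading. Then $\mathcal A_n^C(F)$ is a graded symmetric algebra over $k$. Precisely: it is a graded algebra (the direct sum of its homogeneous components), free of finite rank as a $k$-module, and there is a linear form $\operatorname{tr}_C\colon\mathcal A_n^C(F)\to k$ with $$\operatorname{tr}_C(x_1^{\alpha_1}\cdots x_n^{\alpha_n}\,\mathbf f\,\pi)=\begin{cases}\operatorname{tr}^{\otimes n}(\mathbf f)&\text{if }\alpha_1=\dots=\alpha_n=d-1\text{ and }\pi=1,\\0&\text{otherwise,}\end{cases}$$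 for all $0\le\alpha_1,\dots,\alpha_n<d$, $\mathbf f\in F^{\otimes n}$, $\pi\in S_n$, such that $\operatorname{tr}_C(ab)=\operatorname{tr}_C(ba)$ for all $a,b$, the form $\operatorname{tr}_C$ vanishes on every homogeneous component of degree other than $nd\delta$, and $a\mapsto(b\mapsto\operatorname{tr}_C(ba))$ is an isomorphism $\mathcal A_n^C(F)\to\operatorname{Hom}_k(\mathcal A_n^C(F),k)$. -/

import Mathlib

noncomputable section

namespace AffWr

universe u v w

/-- `τ` is a symmetrizing form of degree `-e` on the graded algebra `A = ⨁ 𝒜 i`: it is a symmetric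
linear form, vanishes outside degree `e`, and `a ↦ (b ↦ τ (b * a))` is an isomorphism from `A`
onto its linear dual. -/
structure IsGradedSymmetrizingForm {k : Type u} {A : Type v} [CommRing k] [Ring A] [Algebra k A]
    (𝒜 : ℕ → Submodule k A) (e : ℕ) (τ : A →ₗ[k] k) : Prop where
  symm : ∀ a b : A, τ (a * b) = τ (b * a)
  bijective : Function.Bijective (fun a : A => τ ∘ₗ LinearMap.mulRight k a)
  degree : ∀ i : ℕ, i ≠ e → ∀ a ∈ 𝒜 i, τ a = 0

section Frobenius

variable {k : Type u} {F : Type v} [CommRing k] [Ring F] [Algebra k F]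

/-- The basis `b ↦ b^∨` dual to `B` with respect to a symmetrizing form `tr`,
characterized by `tr (b^∨ * c) = δ_{b,c}` for `b, c ∈ B`. -/
def dualBasis {𝒜 : ℕ → Submodule k F} {e : ℕ} {tr : F →ₗ[k] k}
    (htr : IsGradedSymmetrizingForm 𝒜 e tr) {κ : Type w} (B : Module.Basis κ k F) (i : κ) : F :=
  Function.surjInv htr.bijective.2 (B.coord i)

theorem tr_dualBasis_mul {𝒜 : ℕ → Submodule k F} {e : ℕ} {tr : F →ₗ[k] k}
    (htr : IsGradedSymmetrizingForm 𝒜 e tr) {κ : Type w} [DecidableEq κ]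
    (B : Module.Basis κ k F) (i j : κ) :
    tr (dualBasis htr B i * B j) = if i = j then 1 else 0 := by
  have h := Function.surjInv_eq htr.bijective.2 (B.coord i)
  have h2 := LinearMap.congr_fun h (B j)
  rw [htr.symm]
  simpa [dualBasis, Finsupp.single_apply, eq_comm] using h2

end Frobenius

section TensorPower

variable (k : Type u) (F : Type v) [CommRing k] [Ring F] [Algebra k F] (n : ℕ)

/-- The algebra `F^{⊗ n}`. -/
abbrev TensorPow : Type _ := PiTensorProduct k (fun _ : Fin n => F)

variable {k F n}

/-- The action of `S_n` on `F^{⊗ n}` by permutation of the tensor factors: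
the `i`-th factor is moved to position `π i`. -/
def permAct (π : Equiv.Perm (Fin n)) (f : TensorPow k F n) : TensorPow k F n :=
  PiTensorProduct.reindex k (fun _ : Fin n => F) π f

/-- `tr^{⊗ n} : F^{⊗ n} → k`, `f₁ ⊗ ⋯ ⊗ f_n ↦ tr f₁ ⋯ tr f_n`. -/
def trTensor (n : ℕ) (tr : F →ₗ[k] k) : TensorPow k F n →ₗ[k] k :=
  PiTensorProduct.lift ((MultilinearMap.mkPiAlgebra k (Fin n) k).compLinearMap (fun _ => tr))

/-- The grading of `F^{⊗ n}` induced by a grading of `F`. -/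
def tensorGrading (𝒜 : ℕ → Submodule k F) (n m : ℕ) : Submodule k (TensorPow k F n) :=
  Submodule.span k {z | ∃ (d : Fin n → ℕ) (f : Fin n → F),
    (∑ i, d i = m) ∧ (∀ i, f i ∈ 𝒜 (d i)) ∧ z = PiTensorProduct.tprod k f}

variable (k F n) in
/-- `Z(F)^{⊗ n}`, viewed inside `F^{⊗ n}`. -/
def centerTensor : Submodule k (TensorPow k F n) :=
  Submodule.span k {z | ∃ f : Fin n → F,
    (∀ i, f i ∈ Subalgebra.center k F) ∧ z = PiTensorProduct.tprod k f}

/-- The elements `c` which may be used in the factors `x₁ - c` defining a cyclotomic quotient: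
those elements of `Z(F)^{⊗ n}` that are homogeneous of degree `δ` and fixed by all
permutations that fix the first index. -/
structure IsCycParam (𝒜 : ℕ → Submodule k F) (δ : ℕ) [NeZero n] (c : TensorPow k F n) :
    Prop where
  mem_center : c ∈ centerTensor k F n
  invariant : ∀ π : Equiv.Perm (Fin n), π 0 = 0 → permAct π c = c
  mem_degree : c ∈ tensorGrading 𝒜 n δ

/-- `t_{i,j} = ∑_b b_i b^∨_j`, where `f_i` is `f` placed in the `i`-th tensor factor. -/
def tElem {κ : Type w} [Fintype κ] (b b' : κ → F) (i j : Fin n) : TensorPow k F n :=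
  ∑ a, PiTensorProduct.singleAlgHom i (b a) * PiTensorProduct.singleAlgHom j (b' a)

end TensorPower

/-! ### The affine wreath product algebra of a symmetric algebra in even parity -/

/-- The generators: `x_1, …, x_n`, the elements of `F^{⊗ n}`, and the elements of `S_n`. -/
inductive Gen (k : Type u) (F : Type v) [CommRing k] [Ring F] [Algebra k F] (n : ℕ) : Type (max u v)
  | x : Fin n → Gen k F n
  | f : TensorPow k F n → Gen k F n
  | s : Equiv.Perm (Fin n) → Gen k F n

section Algebra

variable {k : Type u} {F : Type v} [CommRing k] [Ring F] [Algebra k F] {n : ℕ}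

open FreeAlgebra in
/-- The defining relations. The first seven present the free product
`k[x_1, …, x_n] ⋆ F^{⊗ n} ⋆ k S_n`; the last four relate the three factors. -/
inductive Rel {κ : Type w} [Fintype κ] (b b' : κ → F) :
    FreeAlgebra k (Gen k F n) → FreeAlgebra k (Gen k F n) → Prop
  | x_comm (i j : Fin n) : Rel b b' (ι k (.x i) * ι k (.x j)) (ι k (.x j) * ι k (.x i))
  | f_add (f g : TensorPow k F n) : Rel b b' (ι k (.f (f + g))) (ι k (.f f) + ι k (.f g))
  | f_smul (r : k) (f : TensorPow k F n) : Rel b b' (ι k (.f (r • f))) (r • ι k (.f f))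
  | f_mul (f g : TensorPow k F n) : Rel b b' (ι k (.f (f * g))) (ι k (.f f) * ι k (.f g))
  | f_one : Rel b b' (ι k (.f 1)) 1
  | s_mul (π σ : Equiv.Perm (Fin n)) : Rel b b' (ι k (.s (π * σ))) (ι k (.s π) * ι k (.s σ))
  | s_one : Rel b b' (ι k (.s 1)) 1
  | f_x (f : TensorPow k F n) (i : Fin n) :
      Rel b b' (ι k (.f f) * ι k (.x i)) (ι k (.x i) * ι k (.f f))
  | s_x_of_ne (i : ℕ) (hi : i + 1 < n) (j : Fin n) (hj : (j : ℕ) ≠ i) (hj' : (j : ℕ) ≠ i + 1) :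
      Rel b b'
        (ι k (.s (Equiv.swap ⟨i, Nat.lt_of_succ_lt hi⟩ ⟨i + 1, hi⟩)) * ι k (.x j))
        (ι k (.x j) * ι k (.s (Equiv.swap ⟨i, Nat.lt_of_succ_lt hi⟩ ⟨i + 1, hi⟩)))
  | s_x (i : ℕ) (hi : i + 1 < n) :
      Rel b b'
        (ι k (.s (Equiv.swap ⟨i, Nat.lt_of_succ_lt hi⟩ ⟨i + 1, hi⟩)) *
          ι k (.x ⟨i, Nat.lt_of_succ_lt hi⟩))
        (ι k (.x ⟨i + 1, hi⟩) *
            ι k (.s (Equiv.swap ⟨i, Nat.lt_of_succ_lt hi⟩ ⟨i + 1, hi⟩)) -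
          ι k (.f (tElem b b' ⟨i, Nat.lt_of_succ_lt hi⟩ ⟨i + 1, hi⟩)))
  | s_f (π : Equiv.Perm (Fin n)) (f : TensorPow k F n) :
      Rel b b' (ι k (.s π) * ι k (.f f)) (ι k (.f (permAct π f)) * ι k (.s π))

variable (k n) in
/-- The affine wreath product algebra `𝒜_n(F)` (affinized symmetric algebra), for `F` symmetric
and purely even, with respect to the basis `b` and its dual basis `b'`. -/
abbrev AffineWreath {κ : Type w} [Fintype κ] (b b' : κ → F) : Type _ :=
  RingQuot (Rel (k := k) (n := n) b b')

namespace AffineWreath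

variable {κ : Type w} [Fintype κ] (b b' : κ → F)

/-- The generator of `𝒜_n(F)` given by `g`. -/
def gen (g : Gen k F n) : AffineWreath k n b b' :=
  RingQuot.mkAlgHom k (Rel b b') (FreeAlgebra.ι k g)

variable (k) in
/-- The element `x_i` of `𝒜_n(F)`. -/
def X (i : Fin n) : AffineWreath k n b b' := gen b b' (.x i)

/-- The image in `𝒜_n(F)` of an element of `F^{⊗ n}`. -/
def ofTensor (f : TensorPow k F n) : AffineWreath k n b b' := gen b b' (.f f)

variable (k) in
/-- The image in `𝒜_n(F)` of a permutation. -/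
def ofPerm (π : Equiv.Perm (Fin n)) : AffineWreath k n b b' := gen b b' (.s π)

variable (k) in
/-- `x^α = x_1^{α_1} ⋯ x_n^{α_n}`. -/
def xPow (α : Fin n → ℕ) : AffineWreath k n b b' :=
  (List.ofFn (fun i => X k b b' i ^ α i)).prod

/-- `IsWord 𝒜 δ b b' m a`: `a` is a product of generators of total degree `m`, where
`|x_i| = δ`, permutations have degree `0`, and `F^{⊗ n}` carries its own grading. -/
inductive IsWord (𝒜 : ℕ → Submodule k F) (δ : ℕ) : ℕ → AffineWreath k n b b' → Prop
  | one : IsWord 𝒜 δ 0 1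
  | x_mul (i : Fin n) (m : ℕ) (a : AffineWreath k n b b') :
      IsWord 𝒜 δ m a → IsWord 𝒜 δ (δ + m) (X k b b' i * a)
  | f_mul (p : ℕ) (f : TensorPow k F n) (m : ℕ) (a : AffineWreath k n b b') :
      f ∈ tensorGrading 𝒜 n p → IsWord 𝒜 δ m a → IsWord 𝒜 δ (p + m) (ofTensor b b' f * a)
  | s_mul (π : Equiv.Perm (Fin n)) (m : ℕ) (a : AffineWreath k n b b') :
      IsWord 𝒜 δ m a → IsWord 𝒜 δ m (ofPerm k b b' π * a)

variable (n) in
/-- The component of degree `m` of `𝒜_n(F)`. -/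
def grading (𝒜 : ℕ → Submodule k F) (δ m : ℕ) : Submodule k (AffineWreath k n b b') :=
  Submodule.span k {a | IsWord b b' 𝒜 δ m a}

/-- `χ_C = ∏_j (x_1 - c_j)`. -/
def chi [NeZero n] {d : ℕ} (c : Fin d → TensorPow k F n) : AffineWreath k n b b' :=
  (List.ofFn (fun j => X k b b' 0 - ofTensor b b' (c j))).prod

/-- The two-sided ideal `J_C` generated by `χ_C`. -/
def cycIdeal [NeZero n] {d : ℕ} (c : Fin d → TensorPow k F n) :
    TwoSidedIdeal (AffineWreath k n b b') :=
  TwoSidedIdeal.span {chi b b' c}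

end AffineWreath

open AffineWreath

variable {κ : Type w} [Fintype κ] (b b' : κ → F)

/-- The cyclotomic quotient `𝒜_n^C(F) = 𝒜_n(F) / J_C`. -/
abbrev Cyclotomic [NeZero n] {d : ℕ} (c : Fin d → TensorPow k F n) : Type _ :=
  (cycIdeal b b' c).ringCon.Quotient

namespace Cyclotomic

/-- The canonical projection `𝒜_n(F) → 𝒜_n^C(F)`. -/
def proj [NeZero n] {d : ℕ} (c : Fin d → TensorPow k F n) :
    AffineWreath k n b b' →ₗ[k] Cyclotomic b b' c where
  toFun a := (a : (cycIdeal b b' c).ringCon.Quotient)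
  map_add' _ _ := rfl
  map_smul' _ _ := rfl

/-- The induced grading on the cyclotomic quotient. -/
def grading [NeZero n] (𝒜 : ℕ → Submodule k F) (δ : ℕ) {d : ℕ} (c : Fin d → TensorPow k F n)
    (m : ℕ) : Submodule k (Cyclotomic b b' c) :=
  (AffineWreath.grading n b b' 𝒜 δ m).map (proj b b' c)

end Cyclotomic

end Algebra

end AffWr

end

noncomputable section

namespace AffWr

open PiTensorProduct

/-! ### Permutations of tensor factors -/

section PermAct

variable {k F : Type*} [CommRing k] [Ring F] [Algebra k F] {n : ℕ}

/-! Everything rests on the filtration of the affine wreath product algebra by degree in the x_i.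
Its degree-zero part is the image of F^{⊗n} ⋊ S_n, and commuting a permutation past x_j produces
only terms of lower degree. Most bijectivity claims reduce to one principle,
`bijective_of_unitriangular`: a linear endomorphism that is the identity up to lower degree is
bijective. The monomials x^α f π span by straightening. They are independent because the algebra
acts on k[x] ⊗ (F^{⊗n} ⋊ S_n) by operators of Demazure type. That the adjacent transpositions
generate an action of S_n there is not checked through braid relations: `permGraph_unique` shows
that an operator given by a word depends only on the underlying permutation, by induction on
polynomials. In the quotient, let χ_i be the conjugates of χ_C by the transpositions (1, i). Each
χ_i has leading term x_i^d, and left multiplication moves past the χ_i without raising degree. So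
the two-sided ideal is the right ideal Σ χ_i A. The S-polynomials of the χ_i reduce to lower degree,
as in a Gröbner basis argument, so replacing a factor x_i^d by χ_i carries the span of monomials
with some exponent ≥ d onto the ideal. Hence the x^α f π with all α_i < d give a basis of the
quotient (`exists_truncated_coord`). The form reads the coefficient of (x_1⋯x_n)^{d-1} at π = 1 and
applies tr^{⊗n}. It kills everything of degree below n(d-1). Since (x_1⋯x_n)^{d-1} is central,
symmetry can be tested on generators, where it reduces to symmetry of the form f π ↦ δ_{π,1}
tr^{⊗n}(f) on F^{⊗n} ⋊ S_n (`form_comm`). Pairing monomials of exponent β with those of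
complementary exponent d-1-α is triangular in degree, with the perfect pairing of F^{⊗n} on the
diagonal, so the form is nondegenerate (`form_bijective`). The grading is detected by a homomorphism
to A[X] that records degree as the exponent of X. It exists because the relations, including t_{i,j}
of degree δ and χ_C of degree dδ, are homogeneous. -/

theorem permAct_tprod (π : Equiv.Perm (Fin n)) (f : Fin n → F) :
    permAct π (tprod k f) = tprod k (fun i => f (π⁻¹ i)) :=
  reindex_tprod π f

/-- `permAct π` as a linear map. -/
def permLin (π : Equiv.Perm (Fin n)) : TensorPow k F n →ₗ[k] TensorPow k F n :=
  (reindex k (fun _ : Fin n => F) π).toLinearMap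

theorem permLin_apply (π : Equiv.Perm (Fin n)) (f : TensorPow k F n) :
    permLin π f = permAct π f := rfl

theorem permAct_add (π : Equiv.Perm (Fin n)) (f g : TensorPow k F n) :
    permAct π (f + g) = permAct π f + permAct π g := map_add (permLin π) f g

theorem permAct_smul (π : Equiv.Perm (Fin n)) (r : k) (f : TensorPow k F n) :
    permAct π (r • f) = r • permAct π f := map_smul (permLin π) r f

theorem permAct_zero (π : Equiv.Perm (Fin n)) : permAct π (0 : TensorPow k F n) = 0 :=
  map_zero (permLin π)

/-- Induction principle for `F^{⊗ n}`: it is spanned by pure tensors. -/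
theorem tensorPow_induction {p : TensorPow k F n → Prop} (f : TensorPow k F n)
    (tp : ∀ g : Fin n → F, p (tprod k g)) (add : ∀ f g, p f → p g → p (f + g))
    (smul : ∀ (r : k) f, p f → p (r • f)) : p f := by
  induction f using PiTensorProduct.induction_on with
  | smul_tprod r g => exact smul r _ (tp g)
  | add f g hf hg => exact add f g hf hg

theorem permAct_mul (π : Equiv.Perm (Fin n)) (f g : TensorPow k F n) :
    permAct π (f * g) = permAct π f * permAct π g := by
  induction f using tensorPow_induction with
  | tp f =>
    induction g using tensorPow_induction with
    | tp g => simp only [tprod_mul_tprod, permAct_tprod]; rfl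
    | add a b ha hb => simp only [mul_add, permAct_add, ha, hb]
    | smul r a ha => simp only [mul_smul_comm, permAct_smul, ha]
  | add a b ha hb => simp only [add_mul, permAct_add, ha, hb]
  | smul r a ha => simp only [smul_mul_assoc, permAct_smul, ha]

theorem permAct_one (π : Equiv.Perm (Fin n)) : permAct π (1 : TensorPow k F n) = 1 := by
  rw [one_def, permAct_tprod]; rfl

theorem permAct_permAct (π σ : Equiv.Perm (Fin n)) (f : TensorPow k F n) :
    permAct π (permAct σ f) = permAct (π * σ) f := by
  induction f using tensorPow_induction with
  | tp f => simp only [permAct_tprod, mul_inv_rev, Equiv.Perm.mul_apply]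
  | add a b ha hb => simp only [permAct_add, ha, hb]
  | smul r a ha => simp only [permAct_smul, ha]

theorem one_permAct (f : TensorPow k F n) : permAct 1 f = f := by
  induction f using tensorPow_induction with
  | tp f => simp only [permAct_tprod, inv_one, Equiv.Perm.one_apply]
  | add a b ha hb => simp only [permAct_add, ha, hb]
  | smul r a ha => simp only [permAct_smul, ha]

theorem permAct_single (π : Equiv.Perm (Fin n)) (i : Fin n) (a : F) :
    permAct π (singleAlgHom (R := k) (A := fun _ => F) i a) = singleAlgHom (π i) a := by
  rw [singleAlgHom_apply, singleAlgHom_apply, permAct_tprod]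
  congr 1
  funext j
  simp only [MonoidHom.mulSingle_apply, Pi.mulSingle_apply, Equiv.Perm.inv_eq_iff_eq]

theorem permAct_tElem {κ : Type*} [Fintype κ] (b b' : κ → F) (π : Equiv.Perm (Fin n))
    (i j : Fin n) :
    permAct π (tElem (k := k) b b' i j) = tElem b b' (π i) (π j) := by
  unfold tElem
  rw [← permLin_apply, map_sum]
  simp only [permLin_apply, permAct_mul, permAct_single]

theorem commute_single {i j : Fin n} (h : i ≠ j) (a b : F) :
    Commute (singleAlgHom (R := k) (A := fun _ => F) i a) (singleAlgHom j b) := by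
  rw [singleAlgHom_apply, singleAlgHom_apply]
  exact Commute.tprod (Pi.mulSingle_commute (f := fun _ => F) h a b)

theorem tprod_mem_closure_single (f : Fin n → F) :
    tprod k f ∈ Submonoid.closure
      {z | ∃ i a, z = singleAlgHom (R := k) (A := fun _ : Fin n => F) i a} := by
  classical
  have h := tprod_noncommProd (R := k) (A := fun _ : Fin n => F) Finset.univ
    (fun i => Pi.mulSingle i (f i)) (fun i _ j _ _ => Pi.mulSingle_apply_commute f i j)
  rw [Finset.noncommProd_mulSingle f] at h
  rw [h]
  exact Submonoid.noncommProd_mem _ _ _ _ fun i _ => Submonoid.subset_closure ⟨i, f i, rfl⟩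

/-- Induction principle for `F^{⊗ n}`: it is generated as an algebra by its tensor factors. -/
theorem tensorPow_alg_induction {p : TensorPow k F n → Prop} (f : TensorPow k F n)
    (one : p 1) (single : ∀ i a, p (singleAlgHom i a)) (mul : ∀ f g, p f → p g → p (f * g))
    (add : ∀ f g, p f → p g → p (f + g)) (smul : ∀ (r : k) f, p f → p (r • f)) : p f := by
  induction f using tensorPow_induction with
  | tp g =>
    have hg := tprod_mem_closure_single (k := k) g
    revert hg
    generalize tprod k g = z
    intro hg
    induction hg using Submonoid.closure_induction with
    | mem x hx => obtain ⟨i, a, rfl⟩ := hx; exact single i a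
    | one => exact one
    | mul x y _ _ hx hy => exact mul x y hx hy
  | add f g hf hg => exact add f g hf hg
  | smul r f hf => exact smul r f hf

theorem commute_of_mem_centerTensor {c : TensorPow k F n} (hc : c ∈ centerTensor k F n)
    (f : TensorPow k F n) : Commute c f := by
  induction hc using Submodule.span_induction with
  | mem x hx =>
    obtain ⟨z, hz, rfl⟩ := hx
    induction f using tensorPow_induction with
    | tp f =>
      refine Commute.tprod (Pi.commute_iff.2 fun i => ?_)
      exact (Subalgebra.mem_center_iff.1 (hz i) (f i)).symm
    | add a b ha hb => exact ha.add_right hb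
    | smul r a ha => exact ha.smul_right r
  | zero => exact Commute.zero_left _
  | add x y _ _ hx hy => exact hx.add_left hy
  | smul r x _ hx => exact hx.smul_left r

end PermAct

/-! ### Dual bases and the elements `t_{i,j}` -/

section Dual

variable {k F : Type*} [CommRing k] [Ring F] [Algebra k F] {n : ℕ}
  {𝒜 : ℕ → Submodule k F} {δ : ℕ} {tr : F →ₗ[k] k} (htr : IsGradedSymmetrizingForm 𝒜 δ tr)
  {κ : Type*} (B : Module.Basis κ k F)

theorem tr_mul_dualBasis [DecidableEq κ] (i j : κ) :
    tr (B j * dualBasis htr B i) = if i = j then 1 else 0 := by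
  rw [htr.symm, tr_dualBasis_mul]

theorem repr_eq_tr (f : F) (i : κ) : B.repr f i = tr (dualBasis htr B i * f) := by
  classical
  have : B.coord i = tr ∘ₗ LinearMap.mulLeft k (dualBasis htr B i) := by
    refine B.ext fun j => ?_
    simp [tr_dualBasis_mul, Finsupp.single_apply, eq_comm]
  exact LinearMap.congr_fun this f

variable [Fintype κ]

theorem sum_tr_dualBasis (f : F) : ∑ a, tr (dualBasis htr B a * f) • B a = f := by
  simp only [← repr_eq_tr]
  exact B.sum_repr f

theorem sum_tr_basis (f : F) : ∑ a, tr (f * B a) • dualBasis htr B a = f := by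
  classical
  apply htr.bijective.1
  refine B.ext fun c => ?_
  simp [Finset.mul_sum, tr_mul_dualBasis, htr.symm f]

variable {P : Type*} [AddCommGroup P] [Module k P] (β : F →ₗ[k] F →ₗ[k] P)

/-- An identity for the Casimir element Σ b ⊗ b^∨, tested against an arbitrary bilinear map.
Expanding one leg in the basis and the other in the dual basis turns both sides into the same double
sum, by cyclicity of tr. The next two results follow the same pattern. -/
theorem sum_basis_mul_dualBasis (f : F) :
    ∑ a, β (B a * f) (dualBasis htr B a) = ∑ a, β (B a) (f * dualBasis htr B a) := by
  have h : ∀ a, β (B a * f) (dualBasis htr B a) =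
      ∑ c, tr (dualBasis htr B c * (B a * f)) • β (B c) (dualBasis htr B a) := fun a => by
    conv_lhs => rw [← sum_tr_dualBasis htr B (B a * f)]
    simp
  have h' : ∀ a, β (B a) (f * dualBasis htr B a) =
      ∑ c, tr (f * dualBasis htr B a * B c) • β (B a) (dualBasis htr B c) := fun a => by
    conv_lhs => rw [← sum_tr_basis htr B (f * dualBasis htr B a)]
    simp
  simp only [h, h']
  rw [Finset.sum_comm]
  refine Finset.sum_congr rfl fun a _ => Finset.sum_congr rfl fun c _ => ?_
  rw [← mul_assoc, htr.symm (dualBasis htr B a * B c) f, mul_assoc]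

theorem sum_mul_basis_dualBasis (f : F) :
    ∑ a, β (f * B a) (dualBasis htr B a) = ∑ a, β (B a) (dualBasis htr B a * f) := by
  have h : ∀ a, β (f * B a) (dualBasis htr B a) =
      ∑ c, tr (dualBasis htr B c * (f * B a)) • β (B c) (dualBasis htr B a) := fun a => by
    conv_lhs => rw [← sum_tr_dualBasis htr B (f * B a)]
    simp
  have h' : ∀ a, β (B a) (dualBasis htr B a * f) =
      ∑ c, tr (dualBasis htr B a * f * B c) • β (B a) (dualBasis htr B c) := fun a => by
    conv_lhs => rw [← sum_tr_basis htr B (dualBasis htr B a * f)]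
    simp
  simp only [h, h']
  rw [Finset.sum_comm]
  simp only [mul_assoc]

/-- The matrix tr(b^∨ c^∨) is symmetric, so the Casimir element is invariant under the flip. -/
theorem sum_basis_dualBasis_comm :
    ∑ a, β (B a) (dualBasis htr B a) = ∑ a, β (dualBasis htr B a) (B a) := by
  have h : ∀ a, β (B a) (dualBasis htr B a) =
      ∑ c, tr (dualBasis htr B c * dualBasis htr B a) • β (B a) (B c) := fun a => by
    conv_lhs => rw [← sum_tr_dualBasis htr B (dualBasis htr B a)]
    simp
  have h' : ∀ a, β (dualBasis htr B a) (B a) =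
      ∑ c, tr (dualBasis htr B c * dualBasis htr B a) • β (B c) (B a) := fun a => by
    conv_lhs => rw [← sum_tr_dualBasis htr B (dualBasis htr B a)]
    simp
  simp only [h, h']
  rw [Finset.sum_comm]
  simp only [htr.symm]

/-- The bilinear map `(f, g) ↦ f_i g_j`. -/
def pairLin (i j : Fin n) : F →ₗ[k] F →ₗ[k] TensorPow k F n :=
  (LinearMap.mul k (TensorPow k F n)).compl₁₂
    (singleAlgHom (A := fun _ => F) i).toLinearMap (singleAlgHom (A := fun _ => F) j).toLinearMap

theorem pairLin_apply (i j : Fin n) (f g : F) :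
    pairLin (k := k) i j f g = singleAlgHom i f * singleAlgHom j g := rfl

theorem tElem_eq_sum_pairLin (i j : Fin n) :
    tElem (k := k) B (dualBasis htr B) i j = ∑ a, pairLin i j (B a) (dualBasis htr B a) := rfl

theorem tElem_comm {i j : Fin n} (h : i ≠ j) :
    tElem (k := k) B (dualBasis htr B) i j = tElem B (dualBasis htr B) j i := by
  rw [tElem_eq_sum_pairLin, sum_basis_dualBasis_comm, tElem_eq_sum_pairLin]
  exact Finset.sum_congr rfl fun a _ => (commute_single h _ _).eq

/-- The property is stable under products, so only f = a_l matters: the cases l = i and l = j are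
the two Casimir identities, and for any other l everything commutes. -/
theorem tElem_mul {i j : Fin n} (h : i ≠ j) (f : TensorPow k F n) :
    tElem B (dualBasis htr B) i j * f =
      permAct (Equiv.swap i j) f * tElem B (dualBasis htr B) i j := by
  induction f using tensorPow_alg_induction with
  | one => rw [permAct_one, mul_one, one_mul]
  | mul f g hf hg => rw [permAct_mul, ← mul_assoc, hf, mul_assoc, hg, mul_assoc]
  | add f g hf hg => rw [permAct_add, mul_add, add_mul, hf, hg]
  | smul r f hf => rw [permAct_smul, mul_smul_comm, smul_mul_assoc, hf]
  | single l a =>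
    rw [permAct_single, tElem_eq_sum_pairLin, Finset.sum_mul, Finset.mul_sum]
    by_cases hi : l = i
    · subst hi
      rw [Equiv.swap_apply_left]
      refine Eq.trans (Finset.sum_congr rfl fun c _ => ?_)
        ((sum_basis_mul_dualBasis htr B (pairLin (k := k) l j) a).trans
          (Finset.sum_congr rfl fun c _ => ?_))
      · rw [pairLin_apply, pairLin_apply, map_mul, mul_assoc, mul_assoc,
          (commute_single h.symm _ a).eq]
      · rw [pairLin_apply, pairLin_apply, map_mul, ← mul_assoc, ← mul_assoc,
          (commute_single h _ a).eq]
    by_cases hj : l = j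
    · subst hj
      rw [Equiv.swap_apply_right]
      refine Eq.trans (Finset.sum_congr rfl fun c _ => ?_)
        ((sum_mul_basis_dualBasis htr B (pairLin (k := k) i l) a).symm.trans
          (Finset.sum_congr rfl fun c _ => ?_))
      · rw [pairLin_apply, pairLin_apply, map_mul, mul_assoc]
      · rw [pairLin_apply, pairLin_apply, map_mul, mul_assoc]
    · rw [Equiv.swap_apply_of_ne_of_ne hi hj]
      refine Finset.sum_congr rfl fun c _ => ?_
      exact ((commute_single (Ne.symm hi) _ a).mul_left (commute_single (Ne.symm hj) _ a)).eq

end Dual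

/-! ### The trace form on `F^{⊗ n}` -/

section Trace

variable {k F : Type*} [CommRing k] [Ring F] [Algebra k F] {n : ℕ}
  {𝒜 : ℕ → Submodule k F} {δ : ℕ} {tr : F →ₗ[k] k}

theorem trTensor_tprod (f : Fin n → F) : trTensor n tr (tprod k f) = ∏ i, tr (f i) := by
  simp [trTensor]

theorem trTensor_permAct (π : Equiv.Perm (Fin n)) (f : TensorPow k F n) :
    trTensor n tr (permAct π f) = trTensor n tr f := by
  induction f using tensorPow_induction with
  | tp f =>
    rw [permAct_tprod, trTensor_tprod, trTensor_tprod]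
    exact Equiv.prod_comp π⁻¹ (fun i => tr (f i))
  | add a b ha hb => simp only [permAct_add, map_add, ha, hb]
  | smul r a ha => simp only [permAct_smul, map_smul, ha]

variable (htr : IsGradedSymmetrizingForm 𝒜 δ tr)
include htr

theorem trTensor_comm (f g : TensorPow k F n) :
    trTensor n tr (f * g) = trTensor n tr (g * f) := by
  induction f using tensorPow_induction with
  | tp f =>
    induction g using tensorPow_induction with
    | tp g =>
      simp only [tprod_mul_tprod, trTensor_tprod, Pi.mul_apply]
      exact Finset.prod_congr rfl fun i _ => htr.symm _ _
    | add a b ha hb => simp only [mul_add, add_mul, map_add, ha, hb]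
    | smul r a ha => simp only [mul_smul_comm, smul_mul_assoc, map_smul, ha]
  | add a b ha hb => simp only [mul_add, add_mul, map_add, ha, hb]
  | smul r a ha => simp only [mul_smul_comm, smul_mul_assoc, map_smul, ha]

/-- Tensor products of the b^∨ are dual to the tensor product basis, and pairing with them computes
coordinates. -/
theorem trTensor_bijective {κ : Type*} [Fintype κ] (B : Module.Basis κ k F) :
    Function.Bijective (fun f : TensorPow k F n => trTensor n tr ∘ₗ LinearMap.mulRight k f) := by
  classical
  let Bn := Basis.piTensorProduct (fun _ : Fin n => B)
  let e : (Fin n → κ) → TensorPow k F n := fun p => tprod k fun i => dualBasis htr B (p i)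
  have hpair : ∀ p q, trTensor n tr (e p * Bn q) = if p = q then 1 else 0 := by
    intro p q
    simp only [e, Bn, Basis.piTensorProduct_apply, tprod_mul_tprod, trTensor_tprod,
      Pi.mul_apply, tr_dualBasis_mul, Fintype.prod_ite_zero, ← funext_iff, Finset.prod_const_one]
  have hrepr : ∀ f p, Bn.repr f p = trTensor n tr (e p * f) := by
    intro f p
    have : Bn.coord p = trTensor n tr ∘ₗ LinearMap.mulLeft k (e p) := by
      refine Bn.ext fun q => ?_
      simp only [Module.Basis.coord_apply, Module.Basis.repr_self, Finsupp.single_apply,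
        LinearMap.comp_apply, LinearMap.mulLeft_apply, hpair, eq_comm]
    exact LinearMap.congr_fun this f
  constructor
  · intro f g hfg
    refine Bn.ext_elem fun p => ?_
    rw [hrepr, hrepr]
    exact LinearMap.congr_fun hfg (e p)
  · intro φ
    refine ⟨∑ p, φ (Bn p) • e p, Bn.ext fun q => ?_⟩
    simp [Finset.mul_sum, trTensor_comm htr (Bn q), hpair]

end Trace

end AffWr

namespace AffWr

open PiTensorProduct MvPolynomial
open scoped TensorProduct

/-! ### Adjacent transpositions and inversions -/

section Adjacent

variable {n : ℕ}

/-- The adjacent transposition `(i, i + 1)`. -/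
abbrev adjSwap (i : ℕ) (hi : i + 1 < n) : Equiv.Perm (Fin n) :=
  Equiv.swap ⟨i, Nat.lt_of_succ_lt hi⟩ ⟨i + 1, hi⟩

theorem closure_adjSwap :
    Submonoid.closure {π : Equiv.Perm (Fin n) | ∃ i hi, π = adjSwap i hi} = ⊤ := by
  cases n with
  | zero =>
    refine top_unique fun π _ => ?_
    rw [Subsingleton.elim π 1]
    exact one_mem _
  | succ n =>
    rw [← Equiv.Perm.mclosure_swap_castSucc_succ]
    congr 1
    ext π
    constructor
    · rintro ⟨i, hi, rfl⟩
      exact ⟨⟨i, Nat.lt_of_succ_lt_succ hi⟩, rfl⟩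
    · rintro ⟨i, rfl⟩
      exact ⟨i, Nat.succ_lt_succ i.2, rfl⟩

theorem perm_induction {p : Equiv.Perm (Fin n) → Prop} (π : Equiv.Perm (Fin n)) (one : p 1)
    (mul : ∀ i hi σ, p σ → p (adjSwap i hi * σ)) : p π := by
  have h : π ∈ Submonoid.closure {π : Equiv.Perm (Fin n) | ∃ i hi, π = adjSwap i hi} := by
    rw [closure_adjSwap]; trivial
  induction h using Submonoid.closure_induction_left with
  | one => exact one
  | mul_left x hx y _ hy => obtain ⟨i, hi, rfl⟩ := hx; exact mul i hi y hy

/-- `1`, `-1` or `0` according to whether the pair `(m, j)` with `m < j`, resp. `(j, m)` with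
`j < m`, is an inversion of `π` or not. -/
def crossSign (π : Equiv.Perm (Fin n)) (j m : Fin n) : ℤ :=
  (if m < j then 1 else 0) - (if π m < π j then 1 else 0)

theorem crossSign_one (j m : Fin n) : crossSign 1 j m = 0 := sub_self _

/-- The sign is the order indicator before the permutation minus the one after it, so it telescopes.
-/
theorem crossSign_mul (π σ : Equiv.Perm (Fin n)) (j m : Fin n) :
    crossSign (π * σ) j m = crossSign σ j m + crossSign π (σ j) (σ m) := by
  exact (sub_add_sub_cancel _ _ _).symm

/-- An adjacent transposition reverses the order of a single pair. That pair is excluded through a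
product in S_n, the form in which it arises when correction terms are matched. -/
theorem crossSign_adjSwap_of_ne (i : ℕ) (hi : i + 1 < n) (j m : Fin n)
    (h : adjSwap i hi * Equiv.swap m j ≠ 1) : crossSign (adjSwap i hi) j m = 0 := by
  have hs : ∀ l : Fin n, (adjSwap i hi l : ℕ) =
      if (l : ℕ) = i then i + 1 else if (l : ℕ) = i + 1 then i else l := fun l => by
    rw [adjSwap, Equiv.swap_apply_def]
    simp only [Fin.ext_iff]
    split_ifs <;> rfl
  have h' : ¬ ((m : ℕ) = i ∧ (j : ℕ) = i + 1) := fun ⟨h1, h2⟩ => h <| by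
    obtain rfl : m = ⟨i, Nat.lt_of_succ_lt hi⟩ := Fin.ext h1
    obtain rfl : j = ⟨i + 1, hi⟩ := Fin.ext h2
    exact Equiv.swap_mul_self _ _
  have h'' : ¬ ((m : ℕ) = i + 1 ∧ (j : ℕ) = i) := fun ⟨h1, h2⟩ => h <| by
    obtain rfl : j = ⟨i, Nat.lt_of_succ_lt hi⟩ := Fin.ext h2
    obtain rfl : m = ⟨i + 1, hi⟩ := Fin.ext h1
    rw [Equiv.swap_comm (⟨i + 1, hi⟩ : Fin n) ⟨i, _⟩]
    exact Equiv.swap_mul_self _ _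
  simp only [crossSign, Fin.lt_def, hs]
  split_ifs <;> omega

theorem crossSign_adjSwap_left (i : ℕ) (hi : i + 1 < n) :
    crossSign (adjSwap i hi) ⟨i, Nat.lt_of_succ_lt hi⟩ ⟨i + 1, hi⟩ = -1 := by
  simp [crossSign]

theorem crossSign_adjSwap_right (i : ℕ) (hi : i + 1 < n) :
    crossSign (adjSwap i hi) ⟨i + 1, hi⟩ ⟨i, Nat.lt_of_succ_lt hi⟩ = 1 := by
  simp [crossSign]

end Adjacent

/-! ### The elements t_{i,j} and the corrections in commuting a permutation past x_j -/

section Teleporter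

variable {k F : Type*} [CommRing k] [Ring F] [Algebra k F] {n : ℕ}

/-- The properties of the family `t_{i,j}` on which the structure of `𝒜_n(F)` rests. -/
structure IsTeleporter (t : Fin n → Fin n → TensorPow k F n) : Prop where
  perm : ∀ π i j, permAct π (t i j) = t (π i) (π j)
  symm : ∀ i j, i ≠ j → t i j = t j i
  mul : ∀ i j, i ≠ j → ∀ f, t i j * f = permAct (Equiv.swap i j) f * t i j

theorem isTeleporter_tElem {𝒜 : ℕ → Submodule k F} {δ : ℕ} {tr : F →ₗ[k] k}
    (htr : IsGradedSymmetrizingForm 𝒜 δ tr) {κ : Type*} [Fintype κ] (B : Module.Basis κ k F) :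
    IsTeleporter (n := n) (k := k) (tElem B (dualBasis htr B)) where
  perm π i j := permAct_tElem _ _ π i j
  symm _ _ h := tElem_comm htr B h
  mul _ _ h f := tElem_mul htr B h f

/-- The coefficient of `π * (m, j)` in `π x_j - x_{π j} π`. -/
def crossElem (t : Fin n → Fin n → TensorPow k F n) (π : Equiv.Perm (Fin n)) (j m : Fin n) :
    TensorPow k F n := crossSign π j m • t (π m) (π j)

variable {t : Fin n → Fin n → TensorPow k F n}

theorem crossElem_one (j m : Fin n) : crossElem t 1 j m = 0 := by
  rw [crossElem, crossSign_one, zero_smul]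

/-- This cocycle identity makes the formula for π x_j compatible with multiplication in S_n. -/
theorem crossElem_mul (ht : IsTeleporter t) (π σ : Equiv.Perm (Fin n)) (j m : Fin n) :
    crossElem t (π * σ) j m = permAct π (crossElem t σ j m) + crossElem t π (σ j) (σ m) := by
  rw [crossElem, crossElem, crossElem, crossSign_mul, add_smul, ← permLin_apply, map_zsmul,
    permLin_apply, ht.perm]
  rfl

/-- The sum of the terms `crossElem` for an adjacent transposition. -/
def adjElem (t : Fin n → Fin n → TensorPow k F n) (i : ℕ) (hi : i + 1 < n) (j : Fin n) :
    TensorPow k F n := ∑ m, crossElem t (adjSwap i hi) j m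

theorem crossElem_adjSwap_of_ne {i : ℕ} {hi : i + 1 < n} {j m : Fin n}
    (h : adjSwap i hi * Equiv.swap m j ≠ 1) : crossElem t (adjSwap i hi) j m = 0 := by
  rw [crossElem, crossSign_adjSwap_of_ne i hi j m h, zero_smul]

theorem adjSwap_mul_swap_eq_one {i : ℕ} {hi : i + 1 < n} {j m : Fin n}
    (h : adjSwap i hi * Equiv.swap m j = 1) : adjSwap i hi = Equiv.swap m j := by
  rw [mul_eq_one_iff_eq_inv, Equiv.swap_inv] at h
  exact h

theorem adjElem_left (i : ℕ) (hi : i + 1 < n) :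
    adjElem t i hi ⟨i, Nat.lt_of_succ_lt hi⟩ = - t ⟨i, Nat.lt_of_succ_lt hi⟩ ⟨i + 1, hi⟩ := by
  rw [adjElem, Finset.sum_eq_single ⟨i + 1, hi⟩, crossElem, crossSign_adjSwap_left]
  · simp
  · intro m _ hm
    apply crossElem_adjSwap_of_ne
    intro h
    have := congrArg (· ⟨i, Nat.lt_of_succ_lt hi⟩) (adjSwap_mul_swap_eq_one h)
    simp only [Equiv.swap_apply_left, Equiv.swap_apply_right] at this
    exact hm this.symm
  · simp

theorem adjElem_right (ht : IsTeleporter t) (i : ℕ) (hi : i + 1 < n) :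
    adjElem t i hi ⟨i + 1, hi⟩ = t ⟨i, Nat.lt_of_succ_lt hi⟩ ⟨i + 1, hi⟩ := by
  rw [adjElem, Finset.sum_eq_single ⟨i, Nat.lt_of_succ_lt hi⟩, crossElem, crossSign_adjSwap_right]
  · simp only [Equiv.swap_apply_left, Equiv.swap_apply_right, one_smul]
    exact ht.symm _ _ (by simp)
  · intro m _ hm
    apply crossElem_adjSwap_of_ne
    intro h
    have := congrArg (· ⟨i + 1, hi⟩) (adjSwap_mul_swap_eq_one h)
    simp only [Equiv.swap_apply_right] at this
    exact hm this.symm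
  · simp

theorem adjElem_of_ne (i : ℕ) (hi : i + 1 < n) (j : Fin n) (hj : (j : ℕ) ≠ i)
    (hj' : (j : ℕ) ≠ i + 1) : adjElem t i hi j = 0 := by
  refine Finset.sum_eq_zero fun m _ => crossElem_adjSwap_of_ne fun h => ?_
  -- The transposition fixes j but would also send it to m. So m = j, and the transposition would be
  -- trivial.
  have h1 := congrArg (· j) (adjSwap_mul_swap_eq_one h)
  simp only [Equiv.swap_apply_right] at h1
  rw [Equiv.swap_apply_of_ne_of_ne (fun h => hj (by rw [h])) (fun h => hj' (by rw [h]))] at h1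
  have h2 := congrArg (· j) h
  subst h1
  have h3 := congrArg (· ⟨i, Nat.lt_of_succ_lt hi⟩) h
  simp at h3

end Teleporter

/-! ### Divided differences -/

section DividedDifference

variable (k : Type*) [CommRing k] {n : ℕ} (i j : Fin n)

/-- The homomorphism `p ↦ s_{i,j} p + ω ∂_{i,j} p`, where `ω² = (x_i - x_j) ω`. -/
def dividedHom : MvPolynomial (Fin n) k →ₐ[k]
    QuadraticAlgebra (MvPolynomial (Fin n) k) 0 (X i - X j) :=
  aeval fun l => ⟨X (Equiv.swap i j l), if l = i then 1 else if l = j then -1 else 0⟩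

/-- The divided difference `∂_{i,j} p = (p - s_{i,j} p) / (x_i - x_j)`. -/
def divided : MvPolynomial (Fin n) k →ₗ[k] MvPolynomial (Fin n) k where
  toFun p := (dividedHom k i j p).im
  map_add' p q := by rw [map_add]; rfl
  map_smul' r p := by rw [map_smul]; rfl

/-- This is the specialization ω = 0. -/
theorem dividedHom_re (p : MvPolynomial (Fin n) k) :
    (dividedHom k i j p).re = rename (Equiv.swap i j) p := by
  induction p using MvPolynomial.induction_on with
  | C a => rw [dividedHom, algHom_C, algHom_C]; rfl
  | add p q hp hq => rw [map_add, map_add, ← hp, ← hq]; rfl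
  | mul_X p l hp =>
    rw [map_mul, map_mul, ← hp, QuadraticAlgebra.re_mul, rename_X]
    simp [dividedHom]

-- The other root ω = x_i - x_j sends the image of every variable back to that variable, so this
-- specialization recovers p.
variable {i j} in
theorem dividedHom_im (hij : i ≠ j) (p : MvPolynomial (Fin n) k) :
    (X i - X j) * (dividedHom k i j p).im = p - (dividedHom k i j p).re := by
  induction p using MvPolynomial.induction_on with
  | C a =>
    rw [dividedHom, algHom_C]
    change (X i - X j) * (0 : MvPolynomial (Fin n) k) = C a - C a
    simp
  | add p q hp hq =>
    rw [map_add, QuadraticAlgebra.im_add, QuadraticAlgebra.re_add, mul_add, hp, hq]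
    ring
  | mul_X p l hp =>
    have hl : dividedHom k i j (X l) =
      ⟨X (Equiv.swap i j l), if l = i then 1 else if l = j then -1 else 0⟩ := by simp [dividedHom]
    have hre : (dividedHom k i j p).re = p - (X i - X j) * (dividedHom k i j p).im := by
      rw [hp]; ring
    rw [map_mul, hl, QuadraticAlgebra.im_mul, QuadraticAlgebra.re_mul, hre]
    rw [Equiv.swap_apply_def]
    dsimp only
    split_ifs with h1 h2
    · subst h1; ring
    · subst h2; ring
    · ring

theorem divided_C (a : k) : divided k i j (C a) = 0 := by
  change (dividedHom k i j (C a)).im = 0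
  rw [dividedHom, algHom_C]; rfl

-- The twisted Leibniz rule, read off from the product in the quadratic algebra. The terms s_{i,j} p
-- and (x_i - x_j) ∂p recombine to p.
variable {i j} in
theorem divided_X_mul (hij : i ≠ j) (l : Fin n) (p : MvPolynomial (Fin n) k) :
    divided k i j (X l * p) = X (Equiv.swap i j l) * divided k i j p +
      (if l = i then 1 else if l = j then -1 else 0) * p := by
  have hl : dividedHom k i j (X l) =
      ⟨X (Equiv.swap i j l), if l = i then 1 else if l = j then -1 else 0⟩ := by simp [dividedHom]
  have h := dividedHom_im k hij p
  rw [dividedHom_re] at h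
  change (dividedHom k i j (X l * p)).im = _ * (dividedHom k i j p).im + _
  rw [map_mul, hl, QuadraticAlgebra.im_mul, dividedHom_re]
  dsimp only
  linear_combination (if l = i then 1 else if l = j then -1 else 0) * h

end DividedDifference

end AffWr

namespace AffWr

open PiTensorProduct MvPolynomial
open scoped TensorProduct

/-! ### The regular representation on `k[x_1, …, x_n] ⊗ (F^{⊗ n} ⋊ S_n)` -/

section Wreath

variable {k F : Type*} [CommRing k] [Ring F] [Algebra k F] {n : ℕ}

variable (k F n) in
/-- The underlying module of `F^{⊗ n} ⋊ S_n`; the function `w` stands for `∑ π, w π • π`. -/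
abbrev WreathMod : Type _ := Equiv.Perm (Fin n) → TensorPow k F n

/-- Left multiplication by elements of `F^{⊗ n}`. -/
def wreathF : TensorPow k F n →ₐ[k] Module.End k (WreathMod k F n) where
  toFun f := (LinearMap.mulLeft k f).compLeft (Equiv.Perm (Fin n))
  map_one' := LinearMap.ext fun w => funext fun π => one_mul _
  map_mul' f g := LinearMap.ext fun w => funext fun π => mul_assoc _ _ _
  map_zero' := LinearMap.ext fun w => funext fun π => zero_mul (w π)
  map_add' f g := LinearMap.ext fun w => funext fun π => add_mul _ _ _
  commutes' r := by
    refine LinearMap.ext fun w => funext fun π => ?_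
    exact (Algebra.smul_def r (w π)).symm

theorem wreathF_apply (f : TensorPow k F n) (w : WreathMod k F n) (π : Equiv.Perm (Fin n)) :
    wreathF f w π = f * w π := rfl

/-- Left multiplication by permutations. -/
def wreathS : Equiv.Perm (Fin n) →* Module.End k (WreathMod k F n) where
  toFun σ :=
    { toFun := fun w π => permAct σ (w (σ⁻¹ * π))
      map_add' := fun v w => by funext π; exact permAct_add _ _ _
      map_smul' := fun r w => by funext π; exact permAct_smul _ _ _ }
  map_one' := by
    refine LinearMap.ext fun w => funext fun π => ?_
    change permAct 1 (w (1⁻¹ * π)) = w π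
    rw [one_permAct, inv_one, one_mul]
  map_mul' σ τ := by
    refine LinearMap.ext fun w => funext fun π => ?_
    change permAct (σ * τ) (w ((σ * τ)⁻¹ * π)) = permAct σ (permAct τ (w (τ⁻¹ * (σ⁻¹ * π))))
    rw [permAct_permAct, mul_inv_rev, mul_assoc]

theorem wreathS_apply (σ : Equiv.Perm (Fin n)) (w : WreathMod k F n) (π : Equiv.Perm (Fin n)) :
    wreathS σ w π = permAct σ (w (σ⁻¹ * π)) := rfl

theorem wreathS_wreathF (σ : Equiv.Perm (Fin n)) (f : TensorPow k F n) (w : WreathMod k F n) :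
    wreathS σ (wreathF f w) = wreathF (permAct σ f) (wreathS σ w) := by
  funext π
  simp only [wreathS_apply, wreathF_apply, permAct_mul]

theorem wreathF_single (f g : TensorPow k F n) (π : Equiv.Perm (Fin n)) :
    wreathF f (Pi.single π g) = Pi.single π (f * g) := by
  funext σ
  rw [wreathF_apply]
  by_cases h : σ = π
  · subst h; simp
  · simp [h]

theorem wreathS_single (σ : Equiv.Perm (Fin n)) (g : TensorPow k F n) (π : Equiv.Perm (Fin n)) :
    wreathS σ (Pi.single π g) = Pi.single (σ * π) (permAct σ g) := by
  funext ρ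
  rw [wreathS_apply]
  by_cases h : ρ = σ * π
  · subst h; simp
  · have h' : σ⁻¹ * ρ ≠ π := fun h' => h (by rw [← h', mul_inv_cancel_left])
    simp [h, h', permAct_zero]

variable (k F n) in
/-- The module underlying the regular representation of `𝒜_n(F)`. -/
abbrev PolyMod : Type _ := MvPolynomial (Fin n) k ⊗[k] WreathMod k F n

/-- Multiplication by polynomials. -/
def polyMul : MvPolynomial (Fin n) k →ₐ[k] Module.End k (PolyMod k F n) where
  toFun p := (LinearMap.mulLeft k p).rTensor _
  map_one' := TensorProduct.ext' fun q w => by simp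
  map_mul' p q := TensorProduct.ext' fun r w => by simp
  map_zero' := TensorProduct.ext' fun r w => by simp
  map_add' p q := TensorProduct.ext' fun r w => by simp [add_mul, TensorProduct.add_tmul]
  commutes' a := TensorProduct.ext' fun r w => by
    simp [TensorProduct.smul_tmul', Algebra.smul_def]

theorem polyMul_tmul (p q : MvPolynomial (Fin n) k) (w : WreathMod k F n) :
    polyMul p (q ⊗ₜ[k] w) = (p * q) ⊗ₜ w := rfl

/-- The action of `F^{⊗ n}` on the regular representation. -/
def polyF : TensorPow k F n →ₐ[k] Module.End k (PolyMod k F n) where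
  toFun f := (wreathF f).lTensor _
  map_one' := TensorProduct.ext' fun q w => by simp
  map_mul' p q := TensorProduct.ext' fun r w => by simp
  map_zero' := TensorProduct.ext' fun r w => by simp
  map_add' p q := TensorProduct.ext' fun r w => by simp
  commutes' a := TensorProduct.ext' fun r w => by simp

theorem polyF_tmul (f : TensorPow k F n) (q : MvPolynomial (Fin n) k) (w : WreathMod k F n) :
    polyF f (q ⊗ₜ[k] w) = q ⊗ₜ wreathF f w := rfl

theorem polyF_mul_polyMul (f : TensorPow k F n) (p : MvPolynomial (Fin n) k) :
    polyF f * polyMul p = polyMul p * (polyF f : Module.End k (PolyMod k F n)) :=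
  TensorProduct.ext' fun _ _ => rfl

variable (t : Fin n → Fin n → TensorPow k F n)

/-- The action of the adjacent transposition `(i, i + 1)` on the regular representation. -/
def polyAdj (i : ℕ) (hi : i + 1 < n) : Module.End k (PolyMod k F n) :=
  TensorProduct.map (rename (adjSwap i hi)).toLinearMap (wreathS (adjSwap i hi)) -
    TensorProduct.map (divided k ⟨i, Nat.lt_of_succ_lt hi⟩ ⟨i + 1, hi⟩)
      (wreathF (t ⟨i, Nat.lt_of_succ_lt hi⟩ ⟨i + 1, hi⟩))

theorem polyAdj_tmul (i : ℕ) (hi : i + 1 < n) (p : MvPolynomial (Fin n) k)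
    (w : WreathMod k F n) :
    polyAdj t i hi (p ⊗ₜ w) = rename (adjSwap i hi) p ⊗ₜ wreathS (adjSwap i hi) w -
      divided k ⟨i, Nat.lt_of_succ_lt hi⟩ ⟨i + 1, hi⟩ p ⊗ₜ
        wreathF (t ⟨i, Nat.lt_of_succ_lt hi⟩ ⟨i + 1, hi⟩) w := rfl

variable {t}

theorem polyAdj_C (i : ℕ) (hi : i + 1 < n) (a : k) (w : WreathMod k F n) :
    polyAdj t i hi (C a ⊗ₜ w) = C a ⊗ₜ wreathS (adjSwap i hi) w := by
  rw [polyAdj_tmul, rename_C, divided_C, TensorProduct.zero_tmul, sub_zero]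

/-- The correction comes from the term ±p in the Leibniz rule for ∂(x_j p). -/
theorem polyAdj_mul_polyMul (ht : IsTeleporter t) (i : ℕ) (hi : i + 1 < n) (j : Fin n) :
    polyAdj t i hi * polyMul (X j) =
      polyMul (X (adjSwap i hi j)) * polyAdj t i hi + polyF (adjElem t i hi j) := by
  refine TensorProduct.ext' fun p w => ?_
  have hne : (⟨i, Nat.lt_of_succ_lt hi⟩ : Fin n) ≠ ⟨i + 1, hi⟩ := by simp
  simp only [Module.End.mul_apply, LinearMap.add_apply, polyMul_tmul, polyF_tmul, polyAdj_tmul,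
    map_sub, map_mul, rename_X, divided_X_mul k hne, TensorProduct.add_tmul]
  rw [sub_add_eq_sub_sub, sub_eq_add_neg _ ((_ * p) ⊗ₜ[k] _)]
  congr 1
  split_ifs with h1 h2
  · subst h1
    rw [adjElem_left i hi, one_mul, map_neg, LinearMap.neg_apply, TensorProduct.tmul_neg]
  · subst h2
    rw [adjElem_right ht i hi, neg_one_mul, TensorProduct.neg_tmul, neg_neg]
  · rw [adjElem_of_ne i hi j (fun h => h1 (Fin.ext h)) (fun h => h2 (Fin.ext h)), zero_mul,
      TensorProduct.zero_tmul, neg_zero, map_zero, LinearMap.zero_apply, TensorProduct.tmul_zero]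

theorem polyAdj_mul_polyF (ht : IsTeleporter t) (i : ℕ) (hi : i + 1 < n) (f : TensorPow k F n) :
    polyAdj t i hi * polyF f = polyF (permAct (adjSwap i hi) f) * polyAdj t i hi := by
  refine TensorProduct.ext' fun p w => ?_
  simp only [Module.End.mul_apply, polyF_tmul, polyAdj_tmul, map_sub]
  rw [wreathS_wreathF, ← Module.End.mul_apply (wreathF _) (wreathF f), ← map_mul,
    ht.mul _ _ (by simp), map_mul]
  rfl

variable (t) in
/-- The graph of the action of `S_n` on the regular representation. -/
def permGraph : Submonoid (Equiv.Perm (Fin n) × Module.End k (PolyMod k F n)) :=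
  Submonoid.closure {z | ∃ i hi, z = (adjSwap i hi, polyAdj t i hi)}

theorem adj_mul_mem_permGraph {i : ℕ} {hi : i + 1 < n} {π : Equiv.Perm (Fin n)}
    {T : Module.End k (PolyMod k F n)} (h : (π, T) ∈ permGraph t) :
    (adjSwap i hi * π, polyAdj t i hi * T) ∈ permGraph t :=
  (permGraph t).mul_mem (Submonoid.subset_closure ⟨i, hi, rfl⟩) h

theorem permGraph_induction
    {p : ∀ (π : Equiv.Perm (Fin n)) (T : Module.End k (PolyMod k F n)), (π, T) ∈ permGraph t → Prop}
    {π : Equiv.Perm (Fin n)} {T : Module.End k (PolyMod k F n)} (h : (π, T) ∈ permGraph t)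
    (one : p 1 1 (permGraph t).one_mem) (mul : ∀ i hi π T (h : (π, T) ∈ permGraph t), p π T h →
      p (adjSwap i hi * π) (polyAdj t i hi * T) (adj_mul_mem_permGraph h)) : p π T h := by
  have key : ∀ z (hz : z ∈ permGraph t), p z.1 z.2 hz := by
    intro z hz
    induction hz using Submonoid.closure_induction_left with
    | one => exact one
    | mul_left x hx y hy h =>
      obtain ⟨i, hi, rfl⟩ := hx
      exact mul i hi _ _ hy h
  exact key _ h

variable (t) in
theorem exists_mem_permGraph (π : Equiv.Perm (Fin n)) : ∃ T, (π, T) ∈ permGraph t := by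
  induction π using perm_induction with
  | one => exact ⟨1, one_mem _⟩
  | mul i hi σ h =>
    obtain ⟨T, hT⟩ := h
    exact ⟨_, adj_mul_mem_permGraph hT⟩

/-- Divided differences kill constants, so there a word acts through its permutation alone. This
starts the induction in `permGraph_unique`. -/
theorem permGraph_C {π : Equiv.Perm (Fin n)} {T : Module.End k (PolyMod k F n)}
    (h : (π, T) ∈ permGraph t) (a : k) (w : WreathMod k F n) :
    T (C a ⊗ₜ w) = C a ⊗ₜ wreathS π w := by
  induction h using permGraph_induction with
  | one => simp
  | mul i hi π T _ ih =>
    rw [Module.End.mul_apply, ih, polyAdj_C, map_mul, Module.End.mul_apply]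

theorem permGraph_polyF (ht : IsTeleporter t) {π : Equiv.Perm (Fin n)}
    {T : Module.End k (PolyMod k F n)}
    (h : (π, T) ∈ permGraph t) (f : TensorPow k F n) :
    T * polyF f = polyF (permAct π f) * T := by
  induction h using permGraph_induction with
  | one => rw [one_permAct, one_mul, mul_one]
  | mul i hi π T _ ih =>
    rw [mul_assoc, ih, ← mul_assoc, polyAdj_mul_polyF ht, mul_assoc, permAct_permAct]

/-- `permGraph` is the graph of a function. The proof evaluates its elements on polynomials of
increasing degree. -/
theorem permGraph_unique (ht : IsTeleporter t) {π : Equiv.Perm (Fin n)}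
    {T T' : Module.End k (PolyMod k F n)}
    (h : (π, T) ∈ permGraph t) (h' : (π, T') ∈ permGraph t) : T = T' := by
  refine TensorProduct.ext' fun p w => ?_
  induction p using MvPolynomial.induction_on generalizing π T T' w with
  | C a => rw [permGraph_C h, permGraph_C h']
  | add p q hp hq => rw [TensorProduct.add_tmul, map_add, map_add, hp h h', hq h h']
  | mul_X p j ih =>
    choose E hE using exists_mem_permGraph t
    -- Moving x_j out to the left leaves operators applied to p. Uniqueness on p is known for all
    -- permutations, so any chosen operators `E` may be used, and the right side depends on the word
    -- only through π.
    have key : ∀ {π T}, (π, T) ∈ permGraph t → T ((p * X j) ⊗ₜ w) =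
        polyMul (X (π j)) (T (p ⊗ₜ w)) +
          ∑ m, polyF (crossElem t π j m) (E (π * Equiv.swap m j) (p ⊗ₜ w)) := by
      intro π T hT
      induction hT using permGraph_induction with
      | one =>
        simp only [crossElem_one, map_zero, LinearMap.zero_apply, Finset.sum_const_zero, add_zero]
        rw [mul_comm]
        rfl
      | mul i hi π T hT ihT =>
        rw [Module.End.mul_apply, ihT, map_add, map_sum, ← Module.End.mul_apply (polyAdj t i hi),
          polyAdj_mul_polyMul ht, LinearMap.add_apply, Module.End.mul_apply, Module.End.mul_apply,
          add_assoc, Equiv.Perm.mul_apply]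
        congr 1
        simp only [crossElem_mul ht, map_add, LinearMap.add_apply, Finset.sum_add_distrib]
        rw [add_comm]
        congr 1
        · refine Finset.sum_congr rfl fun m _ => ?_
          rw [← Module.End.mul_apply (polyAdj t i hi), polyAdj_mul_polyF ht, Module.End.mul_apply,
            ← Module.End.mul_apply (polyAdj t i hi)]
          congr 1
          refine ih ?_ (hE _) w
          rw [mul_assoc]
          exact adj_mul_mem_permGraph (hE _)
        · rw [adjElem, map_sum, LinearMap.sum_apply,
            ← Equiv.sum_comp π (fun m => polyF (crossElem t (adjSwap i hi) (π j) m)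
              (T (p ⊗ₜ w)))]
          refine Finset.sum_congr rfl fun m _ => ?_
          -- Only the pair exchanged by the adjacent transposition contributes, and for it the
          -- permutation s_i π (m, j) equals π.
          by_cases hs : adjSwap i hi * Equiv.swap (π m) (π j) = 1
          · congr 1
            refine ih hT ?_ w
            have : adjSwap i hi * π * Equiv.swap m j = π := by
              rw [adjSwap_mul_swap_eq_one hs, ← Equiv.mul_swap_eq_swap_mul, mul_assoc,
                Equiv.swap_mul_self, mul_one]
            conv => arg 2; arg 1; rw [← this]
            exact hE _
          · rw [crossElem_adjSwap_of_ne hs, map_zero, LinearMap.zero_apply, LinearMap.zero_apply]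
    rw [key h, key h', ih h h']

/-- The action of `S_n` on the regular representation. -/
def polyPerm (ht : IsTeleporter t) : Equiv.Perm (Fin n) →* Module.End k (PolyMod k F n) where
  toFun π := (exists_mem_permGraph t π).choose
  map_one' := permGraph_unique ht (exists_mem_permGraph t 1).choose_spec (one_mem _)
  map_mul' π σ := permGraph_unique ht (exists_mem_permGraph t (π * σ)).choose_spec
    ((permGraph t).mul_mem (exists_mem_permGraph t π).choose_spec
      (exists_mem_permGraph t σ).choose_spec)

theorem polyPerm_mem (ht : IsTeleporter t) (π : Equiv.Perm (Fin n)) :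
    (π, polyPerm ht π) ∈ permGraph t := (exists_mem_permGraph t π).choose_spec

theorem polyPerm_adjSwap (ht : IsTeleporter t) (i : ℕ) (hi : i + 1 < n) :
    polyPerm ht (adjSwap i hi) = polyAdj t i hi :=
  permGraph_unique ht (polyPerm_mem ht _) (Submonoid.subset_closure ⟨i, hi, rfl⟩)

variable {κ : Type*} [Fintype κ] {b b' : κ → F}

/-- The action of the generators on the regular representation. -/
def genAct (ht : IsTeleporter (k := k) (n := n) (tElem b b')) :
    Gen k F n → Module.End k (PolyMod k F n)
  | .x i => polyMul (X i)
  | .f f => polyF f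
  | .s π => polyPerm ht π

/-- The regular representation of `𝒜_n(F)`. -/
def regularRep (ht : IsTeleporter (k := k) (n := n) (tElem b b')) :
    AffineWreath k n b b' →ₐ[k] Module.End k (PolyMod k F n) :=
  RingQuot.liftAlgHom k ⟨FreeAlgebra.lift k (genAct ht), by
    intro x y h
    induction h with
    | x_comm i j =>
      simp only [map_mul, FreeAlgebra.lift_ι_apply, genAct]
      rw [← map_mul, ← map_mul, mul_comm]
    | f_add f g => simp only [map_add, FreeAlgebra.lift_ι_apply, genAct]
    | f_smul r f => simp only [map_smul, FreeAlgebra.lift_ι_apply, genAct]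
    | f_mul f g => simp only [map_mul, FreeAlgebra.lift_ι_apply, genAct]
    | f_one => simp only [map_one, FreeAlgebra.lift_ι_apply, genAct]
    | s_mul π σ => simp only [map_mul, FreeAlgebra.lift_ι_apply, genAct]
    | s_one => simp only [map_one, FreeAlgebra.lift_ι_apply, genAct]
    | f_x f i =>
      simp only [map_mul, FreeAlgebra.lift_ι_apply, genAct]
      exact polyF_mul_polyMul f (X i)
    | s_x_of_ne i hi j hj hj' =>
      simp only [map_mul, FreeAlgebra.lift_ι_apply, genAct]
      rw [polyPerm_adjSwap, polyAdj_mul_polyMul ht, adjElem_of_ne i hi j hj hj', map_zero, add_zero,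
        Equiv.swap_apply_of_ne_of_ne (fun h => hj (by rw [h])) (fun h => hj' (by rw [h]))]
    | s_x i hi =>
      simp only [map_mul, map_sub, FreeAlgebra.lift_ι_apply, genAct]
      rw [polyPerm_adjSwap, polyAdj_mul_polyMul ht, adjElem_left, Equiv.swap_apply_left, map_neg,
        sub_eq_add_neg]
    | s_f π f =>
      simp only [map_mul, FreeAlgebra.lift_ι_apply, genAct]
      exact permGraph_polyF ht (polyPerm_mem ht π) f⟩

theorem regularRep_gen (ht : IsTeleporter (k := k) (n := n) (tElem b b')) (g : Gen k F n) :
    regularRep ht (AffineWreath.gen b b' g) = genAct ht g := by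
  rw [AffineWreath.gen, regularRep, RingQuot.liftAlgHom_mkAlgHom_apply, FreeAlgebra.lift_ι_apply]

/-- The coordinates of elements of `𝒜_n(F)` with respect to the products `x^α f π`. -/
def pbwCoord (ht : IsTeleporter (k := k) (n := n) (tElem b b')) :
    AffineWreath k n b b' →ₗ[k] ((Fin n → ℕ) →₀ WreathMod k F n) :=
  (Finsupp.domLCongr (Finsupp.equivFunOnFinite : (Fin n →₀ ℕ) ≃ (Fin n → ℕ))).toLinearMap ∘ₗ
    (TensorProduct.equivFinsuppOfBasisLeft (basisMonomials (Fin n) k)).toLinearMap ∘ₗ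
      LinearMap.applyₗ (1 ⊗ₜ Pi.single 1 1) ∘ₗ (regularRep ht).toLinearMap

/-- Applied to 1 ⊗ 1, the monomial x^α f π gives x^α ⊗ f π. This is the independence half of the PBW
theorem. -/
theorem pbwCoord_apply (ht : IsTeleporter (k := k) (n := n) (tElem b b')) (α : Fin n → ℕ)
    (f : TensorPow k F n) (π : Equiv.Perm (Fin n)) :
    pbwCoord ht (AffineWreath.xPow k b b' α * AffineWreath.ofTensor b b' f *
      AffineWreath.ofPerm k b b' π) = Finsupp.single α (Pi.single π f) := by
  have hx : regularRep ht (AffineWreath.xPow k b b' α) =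
      polyMul (monomial (Finsupp.equivFunOnFinite.symm α) 1) := by
    rw [AffineWreath.xPow, map_list_prod, List.map_ofFn]
    have : (⇑(regularRep ht) ∘ fun i => AffineWreath.X k b b' i ^ α i) =
        polyMul ∘ fun i => X i ^ α i := by
      funext i
      simp only [Function.comp_apply, map_pow, AffineWreath.X, regularRep_gen, genAct]
    rw [this, ← List.map_ofFn, ← map_list_prod, List.prod_ofFn, monomial_eq, C_1, one_mul,
      Finsupp.prod_fintype _ _ (fun i => pow_zero _)]
    rfl
  have h1 : polyPerm ht π ((1 : MvPolynomial (Fin n) k) ⊗ₜ[k] Pi.single 1 1) =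
      1 ⊗ₜ (Pi.single π 1 : WreathMod k F n) := by
    have := permGraph_C (polyPerm_mem ht π) 1 (Pi.single 1 1)
    rwa [C_1, wreathS_single, permAct_one, mul_one] at this
  simp only [pbwCoord, LinearMap.comp_apply, AlgHom.toLinearMap_apply, map_mul, hx,
    LinearMap.applyₗ_apply_apply, Module.End.mul_apply, AffineWreath.ofTensor,
    AffineWreath.ofPerm, regularRep_gen, genAct, LinearEquiv.coe_coe, h1, polyF_tmul, polyMul_tmul,
    wreathF_single, mul_one]
  have h2 : monomial (Finsupp.equivFunOnFinite.symm α) (1 : k) =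
      basisMonomials (Fin n) k (Finsupp.equivFunOnFinite.symm α) := by rw [coe_basisMonomials]
  rw [h2, TensorProduct.equivFinsuppOfBasisLeft_apply_tmul, Module.Basis.repr_self,
    Finsupp.mapRange_single, one_smul, Finsupp.domLCongr_single, Equiv.apply_symm_apply]

end Wreath

end AffWr

namespace AffWr

open PiTensorProduct

/-! ### The filtration of an affine wreath product algebra by degree in the `x_i` -/

/-! ### Ordered products in a monoid -/

section ListProd

variable {M : Type*} [Monoid M]

theorem commute_prod_ofFn {n : ℕ} (a : M) (b : Fin n → M) (h : ∀ i, Commute a (b i)) :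
    Commute a (List.ofFn b).prod := by
  apply Commute.list_prod_right
  intro z hz
  rw [List.mem_ofFn'] at hz
  obtain ⟨i, rfl⟩ := hz
  exact h i

theorem prod_ofFn_mul {n : ℕ} (a b : Fin n → M) (h : ∀ i j, i ≠ j → Commute (a i) (b j)) :
    (List.ofFn fun i => a i * b i).prod = (List.ofFn a).prod * (List.ofFn b).prod := by
  induction n with
  | zero => simp
  | succ n ih =>
    rw [List.ofFn_succ, List.ofFn_succ, List.ofFn_succ, List.prod_cons, List.prod_cons,
      List.prod_cons, ih _ _ fun i j hij => h _ _ fun h => hij (Fin.succ_injective _ h)]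
    apply Commute.mul_mul_mul_comm
    exact commute_prod_ofFn _ _ fun i => (h _ _ (Fin.succ_ne_zero i)).symm

theorem prod_ofFn_eq_one {n : ℕ} (f : Fin n → M) (h : ∀ j, f j = 1) :
    (List.ofFn f).prod = 1 := by
  obtain rfl : f = fun _ => 1 := funext h
  simp

theorem prod_ofFn_eq_single {n : ℕ} (f : Fin n → M) (i : Fin n) (h : ∀ j, j ≠ i → f j = 1) :
    (List.ofFn f).prod = f i := by
  induction n with
  | zero => exact i.elim0
  | succ n ih =>
    rw [List.ofFn_succ, List.prod_cons]
    induction i using Fin.cases with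
    | zero => rw [prod_ofFn_eq_one _ fun j => h _ (Fin.succ_ne_zero j), mul_one]
    | succ i =>
      rw [h 0 (Fin.succ_ne_zero i).symm, one_mul, ih _ i]
      intro j hj
      exact h _ fun h => hj (Fin.succ_injective _ h)

end ListProd

section Filtration

variable {k F : Type*} [CommRing k] [Ring F] [Algebra k F] {n : ℕ}

/-- Generators of an algebra `A` which satisfy the relations of an affine wreath product algebra. -/
structure AffineWreathData (t : Fin n → Fin n → TensorPow k F n) (A : Type*) [Ring A]
    [Algebra k A] where
  x : Fin n → A
  f : TensorPow k F n →ₐ[k] A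
  s : Equiv.Perm (Fin n) →* A
  x_comm : ∀ i j, x i * x j = x j * x i
  f_x : ∀ g i, f g * x i = x i * f g
  s_f : ∀ π g, s π * f g = f (permAct π g) * s π
  adj_x : ∀ i hi j, s (adjSwap i hi) * x j =
    x (adjSwap i hi j) * s (adjSwap i hi) + f (adjElem t i hi j)
  adjoin : Algebra.adjoin k (Set.range x ∪ Set.range f ∪ Set.range s) = ⊤

namespace AffineWreathData

variable {t : Fin n → Fin n → TensorPow k F n} {A : Type*} [Ring A] [Algebra k A]
  (D : AffineWreathData t A)

/-- Transport of the generators along a surjective homomorphism. -/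
def map {A' : Type*} [Ring A'] [Algebra k A'] (q : A →ₐ[k] A') (hq : Function.Surjective q) :
    AffineWreathData t A' where
  x i := q (D.x i)
  f := q.comp D.f
  s := (q : A →* A').comp D.s
  x_comm i j := by rw [← map_mul, D.x_comm, map_mul]
  f_x g i := by
    change q (D.f g) * q _ = q _ * q (D.f g)
    rw [← map_mul, D.f_x, map_mul]
  s_f π g := by
    change q (D.s π) * q (D.f g) = q (D.f _) * q (D.s π)
    rw [← map_mul, D.s_f, map_mul]
  adj_x i hi j := by
    change q (D.s _) * q _ = q _ * q (D.s _) + q (D.f _)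
    rw [← map_mul, D.adj_x, map_add, map_mul]
  adjoin := by
    have h := congrArg (Subalgebra.map q) D.adjoin
    rw [AlgHom.map_adjoin, Set.image_union, Set.image_union, ← Set.range_comp, ← Set.range_comp,
      ← Set.range_comp, Algebra.map_top, (AlgHom.range_eq_top q).2 hq] at h
    exact h

theorem alg_induction {p : A → Prop} (a : A) (x : ∀ i, p (D.x i)) (f : ∀ g, p (D.f g))
    (s : ∀ π, p (D.s π)) (add : ∀ a b, p a → p b → p (a + b))
    (mul : ∀ a b, p a → p b → p (a * b)) : p a := by
  have h : a ∈ Algebra.adjoin k (Set.range D.x ∪ Set.range D.f ∪ Set.range D.s) := by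
    rw [D.adjoin]; trivial
  induction h using Algebra.adjoin_induction with
  | mem a ha =>
    rcases ha with (⟨i, rfl⟩ | ⟨g, rfl⟩) | ⟨π, rfl⟩
    exacts [x i, f g, s π]
  | algebraMap r => rw [← D.f.commutes r]; exact f _
  | add a b _ _ ha hb => exact add a b ha hb
  | mul a b _ _ ha hb => exact mul a b ha hb

/-- Induction on a word in adjacent transpositions. Passing one more transposition over x_{π j} adds
a multiple of π, which is the summand with s_i π (m, j) = π; `crossElem_mul` supplies the
coefficients. -/
theorem s_x (ht : IsTeleporter t) (π : Equiv.Perm (Fin n)) (j : Fin n) :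
    D.s π * D.x j = D.x (π j) * D.s π +
      ∑ m, D.f (crossElem t π j m) * D.s (π * Equiv.swap m j) := by
  induction π using perm_induction with
  | one => simp [crossElem_one]
  | mul i hi π ih =>
    have h1 : ∑ m, D.f (crossElem t (adjSwap i hi) (π j) (π m)) *
        D.s (adjSwap i hi * π * Equiv.swap m j) = D.f (adjElem t i hi (π j)) * D.s π := by
      rw [adjElem, map_sum, Finset.sum_mul,
        ← Equiv.sum_comp π (fun m => D.f (crossElem t (adjSwap i hi) (π j) m) * D.s π)]
      refine Finset.sum_congr rfl fun m _ => ?_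
      by_cases hs : adjSwap i hi * Equiv.swap (π m) (π j) = 1
      · congr 2
        rw [adjSwap_mul_swap_eq_one hs, ← Equiv.mul_swap_eq_swap_mul, mul_assoc,
          Equiv.swap_mul_self, mul_one]
      · rw [crossElem_adjSwap_of_ne hs, map_zero, zero_mul, zero_mul]
    simp only [crossElem_mul ht, map_add, add_mul, Finset.sum_add_distrib]
    rw [h1, map_mul, mul_assoc, ih, mul_add, ← mul_assoc, D.adj_x, add_mul, mul_assoc,
      Equiv.Perm.mul_apply, add_assoc, Finset.mul_sum, add_comm (D.f _ * D.s π)]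
    congr 2
    refine Finset.sum_congr rfl fun m _ => ?_
    rw [← mul_assoc, D.s_f, mul_assoc, ← map_mul, mul_assoc]

/-- Permutations fixing the first index commute with `x_1`. -/
theorem s_x_zero [NeZero n] (ht : IsTeleporter t) (π : Equiv.Perm (Fin n)) (h : π 0 = 0) :
    D.s π * D.x 0 = D.x 0 * D.s π := by
  rw [D.s_x ht, h, Finset.sum_eq_zero, add_zero]
  intro m _
  -- The index 0 is minimal and π fixes it, so no index lies below it before or after π.
  rw [crossElem, crossSign, h, if_neg (Fin.not_lt_zero _), if_neg (Fin.not_lt_zero _), sub_zero,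
    zero_smul, map_zero, zero_mul]

/-- `x^α = x_1^{α_1} ⋯ x_n^{α_n}`. -/
def mono (α : Fin n → ℕ) : A := (List.ofFn fun i => D.x i ^ α i).prod

theorem commute_x (i j : Fin n) : Commute (D.x i) (D.x j) := D.x_comm i j

theorem mono_add (α β : Fin n → ℕ) : D.mono (α + β) = D.mono α * D.mono β := by
  simp only [mono, Pi.add_apply, pow_add]
  exact prod_ofFn_mul _ _ fun i j _ => (D.commute_x i j).pow_pow _ _

theorem mono_zero : D.mono 0 = 1 := prod_ofFn_eq_one _ fun _ => pow_zero _

theorem mono_single (i : Fin n) (m : ℕ) : D.mono (Pi.single i m) = D.x i ^ m := by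
  rw [mono, prod_ofFn_eq_single _ i fun j hj => by rw [Pi.single_eq_of_ne hj, pow_zero],
    Pi.single_eq_same]

theorem commute_mono {a : A} (h : ∀ i, Commute a (D.x i)) (α : Fin n → ℕ) :
    Commute a (D.mono α) := commute_prod_ofFn _ _ fun i => (h i).pow_right _

theorem commute_x_mono (i : Fin n) (α : Fin n → ℕ) : Commute (D.x i) (D.mono α) :=
  D.commute_mono (D.commute_x i) α

theorem commute_f_mono (g : TensorPow k F n) (α : Fin n → ℕ) : Commute (D.f g) (D.mono α) :=
  D.commute_mono (D.f_x g) α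

/-- The image of `F^{⊗ n} ⋊ S_n`. -/
def emb : WreathMod k F n →ₗ[k] A :=
  ∑ π, LinearMap.mulRight k (D.s π) ∘ₗ D.f.toLinearMap ∘ₗ LinearMap.proj π

theorem emb_apply (w : WreathMod k F n) : D.emb w = ∑ π, D.f (w π) * D.s π := by
  simp [emb]

theorem emb_single (π : Equiv.Perm (Fin n)) (g : TensorPow k F n) :
    D.emb (Pi.single π g) = D.f g * D.s π := by
  rw [emb_apply, Finset.sum_eq_single π]
  · simp
  · intro σ _ h
    simp [h]
  · simp

/-- The image of `F^{⊗ n} ⋊ S_n` as a submodule. -/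
def wreath : Submodule k A := Submodule.span k {a | ∃ g π, a = D.f g * D.s π}

/-- The span of `1` and the `x_i`. -/
def linPart : Submodule k A := Submodule.span k ({1} ∪ Set.range D.x)

/-- Elements of degree at most `m` in the `x_i`. -/
def filt (m : ℕ) : Submodule k A := D.linPart ^ m * D.wreath

/-- Elements of degree less than `m` in the `x_i`. -/
def filtLt : ℕ → Submodule k A
  | 0 => ⊥
  | m + 1 => D.filt m

theorem f_mul_s_mem (g : TensorPow k F n) (π : Equiv.Perm (Fin n)) : D.f g * D.s π ∈ D.wreath :=
  Submodule.subset_span ⟨g, π, rfl⟩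

theorem f_mem (g : TensorPow k F n) : D.f g ∈ D.wreath := by
  have := D.f_mul_s_mem g 1
  rwa [map_one, mul_one] at this

theorem s_mem (π : Equiv.Perm (Fin n)) : D.s π ∈ D.wreath := by
  have := D.f_mul_s_mem 1 π
  rwa [map_one, one_mul] at this

theorem one_mem_wreath : 1 ∈ D.wreath := by
  have := D.s_mem 1
  rwa [map_one] at this

theorem x_mem (i : Fin n) : D.x i ∈ D.linPart := Submodule.subset_span (Or.inr ⟨i, rfl⟩)

theorem one_mem_linPart : 1 ∈ D.linPart := Submodule.subset_span (Or.inl rfl)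

theorem one_le_linPart : 1 ≤ D.linPart := Submodule.one_le.2 D.one_mem_linPart

theorem wreath_mul_wreath : D.wreath * D.wreath ≤ D.wreath := by
  rw [wreath, Submodule.span_mul_span, Submodule.span_le]
  rintro _ ⟨_, ⟨g, π, rfl⟩, _, ⟨h, σ, rfl⟩, rfl⟩
  dsimp only
  rw [mul_assoc, ← mul_assoc (D.s π), D.s_f, mul_assoc, ← map_mul, ← mul_assoc, ← map_mul]
  exact D.f_mul_s_mem _ _

theorem s_mul_x_sub_mem (ht : IsTeleporter t) (π : Equiv.Perm (Fin n)) (j : Fin n) :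
    D.s π * D.x j - D.x (π j) * D.s π ∈ D.wreath := by
  rw [D.s_x ht, add_sub_cancel_left]
  exact Submodule.sum_mem _ fun m _ => D.f_mul_s_mem _ _

theorem wreath_le_linPart_mul : D.wreath ≤ D.linPart * D.wreath := fun a ha => by
  rw [← one_mul a]
  exact Submodule.mul_mem_mul D.one_mem_linPart ha

theorem wreath_le_mul_linPart : D.wreath ≤ D.wreath * D.linPart := fun a ha => by
  rw [← mul_one a]
  exact Submodule.mul_mem_mul ha D.one_mem_linPart

/-- The correction in s_π x_j - x_{π j} s_π has degree zero and is absorbed by 1 ∈ `linPart`. -/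
theorem wreath_mul_linPart (ht : IsTeleporter t) :
    D.wreath * D.linPart ≤ D.linPart * D.wreath := by
  conv_lhs => rw [wreath, linPart, Submodule.span_mul_span]
  rw [Submodule.span_le]
  rintro _ ⟨_, ⟨g, π, rfl⟩, b, rfl | ⟨j, rfl⟩, rfl⟩
  · dsimp only
    rw [mul_one]
    exact D.wreath_le_linPart_mul (D.f_mul_s_mem g π)
  · have h : D.f g * D.s π * D.x j = D.x (π j) * (D.f g * D.s π) +
        D.f g * (D.s π * D.x j - D.x (π j) * D.s π) := by
      rw [mul_sub, ← mul_assoc (D.f g) (D.x _), D.f_x, mul_assoc, mul_assoc]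
      abel
    dsimp only
    rw [h]
    exact add_mem (Submodule.mul_mem_mul (D.x_mem _) (D.f_mul_s_mem g π))
      (D.wreath_le_linPart_mul (D.wreath_mul_wreath
        (Submodule.mul_mem_mul (D.f_mem g) (D.s_mul_x_sub_mem ht π j))))

/-- With this inclusion the x_i can also be collected on the right, as the nondegeneracy argument
requires. -/
theorem linPart_mul_wreath (ht : IsTeleporter t) :
    D.linPart * D.wreath ≤ D.wreath * D.linPart := by
  conv_lhs => rw [wreath, linPart, Submodule.span_mul_span]
  rw [Submodule.span_le]
  rintro _ ⟨b, rfl | ⟨j, rfl⟩, _, ⟨g, π, rfl⟩, rfl⟩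
  · dsimp only
    rw [one_mul]
    exact D.wreath_le_mul_linPart (D.f_mul_s_mem g π)
  · have h : D.x j * (D.f g * D.s π) = (D.f g * D.s π) * D.x (π⁻¹ j) -
        D.f g * (D.s π * D.x (π⁻¹ j) - D.x (π (π⁻¹ j)) * D.s π) := by
      rw [mul_sub, ← Equiv.Perm.mul_apply, mul_inv_cancel, Equiv.Perm.one_apply,
        ← mul_assoc (D.f g) (D.x _), D.f_x, mul_assoc, mul_assoc]
      abel
    dsimp only
    rw [h]
    exact sub_mem (Submodule.mul_mem_mul (D.f_mul_s_mem g π) (D.x_mem _))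
      (D.wreath_le_mul_linPart (D.wreath_mul_wreath
        (Submodule.mul_mem_mul (D.f_mem g) (D.s_mul_x_sub_mem ht π _))))

theorem wreath_mul_linPart_pow (ht : IsTeleporter t) (m : ℕ) :
    D.wreath * D.linPart ^ m ≤ D.linPart ^ m * D.wreath := by
  induction m with
  | zero => simp
  | succ m ih =>
    rw [pow_succ, ← mul_assoc]
    refine (mul_le_mul_left ih _).trans ?_
    rw [mul_assoc, mul_assoc]
    exact mul_le_mul_right (D.wreath_mul_linPart ht) _

theorem linPart_pow_mul_wreath (ht : IsTeleporter t) (m : ℕ) :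
    D.linPart ^ m * D.wreath ≤ D.wreath * D.linPart ^ m := by
  induction m with
  | zero => simp
  | succ m ih =>
    rw [pow_succ, mul_assoc]
    refine (mul_le_mul_right (D.linPart_mul_wreath ht) _).trans ?_
    rw [← mul_assoc, ← mul_assoc]
    exact mul_le_mul_left ih _

theorem filt_mul_filt (ht : IsTeleporter t) (a b : ℕ) :
    D.filt a * D.filt b ≤ D.filt (a + b) := by
  rw [filt, filt, filt, mul_assoc, ← mul_assoc D.wreath]
  refine (mul_le_mul_right (mul_le_mul_left (D.wreath_mul_linPart_pow ht b) _) _).trans ?_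
  rw [pow_add, mul_assoc, mul_assoc]
  exact mul_le_mul_right (mul_le_mul_right D.wreath_mul_wreath _) _

theorem filt_mono {a b : ℕ} (h : a ≤ b) : D.filt a ≤ D.filt b :=
  mul_le_mul_left (pow_le_pow_right₀ D.one_le_linPart h) _

theorem filtLt_mono {a b : ℕ} (h : a ≤ b) : D.filtLt a ≤ D.filtLt b := by
  cases a with
  | zero => exact bot_le
  | succ a =>
    cases b with
    | zero => omega
    | succ b => exact D.filt_mono (Nat.le_of_succ_le_succ h)

theorem filt_le_filtLt {a b : ℕ} (h : a < b) : D.filt a ≤ D.filtLt b :=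
  D.filtLt_mono (a := a + 1) h

theorem filtLt_le_filt (a : ℕ) : D.filtLt a ≤ D.filt a := D.filtLt_mono (Nat.le_succ a)

theorem filt_zero : D.filt 0 = D.wreath := by rw [filt, pow_zero, one_mul]

theorem filt_mul_filtLt (ht : IsTeleporter t) (a b : ℕ) :
    D.filt a * D.filtLt b ≤ D.filtLt (a + b) := by
  cases b with
  | zero => rw [filtLt, Submodule.mul_bot]; exact bot_le
  | succ b => exact D.filt_mul_filt ht a b

theorem filtLt_mul_filt (ht : IsTeleporter t) (a b : ℕ) :
    D.filtLt a * D.filt b ≤ D.filtLt (a + b) := by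
  cases a with
  | zero => rw [filtLt, Submodule.bot_mul]; exact bot_le
  | succ a =>
    rw [add_right_comm]
    exact D.filt_mul_filt ht a b

theorem linPart_pow_le_filt (m : ℕ) : D.linPart ^ m ≤ D.filt m := fun a ha => by
  rw [← mul_one a]
  exact Submodule.mul_mem_mul ha D.one_mem_wreath

theorem mono_mem_linPart_pow (α : Fin n → ℕ) {m : ℕ} (h : ∑ i, α i ≤ m) :
    D.mono α ∈ D.linPart ^ m := by
  refine pow_le_pow_right₀ D.one_le_linPart h ?_
  clear h
  have key : ∀ s : Finset (Fin n), ∀ β : Fin n → ℕ, (∀ i, i ∉ s → β i = 0) →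
      D.mono β ∈ D.linPart ^ ∑ i ∈ s, β i := by
    intro s
    induction s using Finset.induction_on with
    | empty =>
      intro β hβ
      obtain rfl : β = 0 := funext fun i => hβ i (by simp)
      rw [D.mono_zero, Finset.sum_empty, pow_zero]
      exact Submodule.one_le.1 le_rfl
    | insert i s hi ih =>
      intro β hβ
      have hsplit : β = Pi.single i (β i) + Function.update β i 0 := by
        funext j
        by_cases hj : j = i
        · subst hj; simp
        · simp [hj]
      have hsum : ∑ j ∈ s, β j = ∑ j ∈ s, Function.update β i 0 j :=
        Finset.sum_congr rfl fun j hj => by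
          rw [Function.update_of_ne (by rintro rfl; exact hi hj)]
      have hmono : D.mono β = D.x i ^ β i * D.mono (Function.update β i 0) := by
        conv_lhs => rw [hsplit, D.mono_add, D.mono_single]
      rw [Finset.sum_insert hi, hsum, pow_add, hmono]
      refine Submodule.mul_mem_mul (Submodule.pow_mem_pow _ (D.x_mem i) _) (ih _ fun j hj => ?_)
      by_cases hji : j = i
      · subst hji; simp
      · rw [Function.update_of_ne hji]
        exact hβ j (by simp [hji, hj])
  exact key Finset.univ α (by simp)

theorem linPart_pow_le_span (m : ℕ) :
    D.linPart ^ m ≤ Submodule.span k {a | ∃ α : Fin n → ℕ, ∑ i, α i ≤ m ∧ a = D.mono α} := by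
  induction m with
  | zero =>
    rw [pow_zero, Submodule.one_eq_span, Submodule.span_le]
    rintro _ rfl
    exact Submodule.subset_span ⟨0, by simp, D.mono_zero.symm⟩
  | succ m ih =>
    rw [pow_succ]
    refine (mul_le_mul_left ih _).trans ?_
    rw [linPart, Submodule.span_mul_span, Submodule.span_le]
    rintro _ ⟨_, ⟨α, hα, rfl⟩, b, rfl | ⟨j, rfl⟩, rfl⟩
    · exact Submodule.subset_span ⟨α, by omega, mul_one _⟩
    · refine Submodule.subset_span ⟨α + Pi.single j 1, ?_, ?_⟩
      · simp [Finset.sum_add_distrib, hα]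
      · dsimp only
        rw [D.mono_add, D.mono_single, pow_one]

theorem filt_le_span (m : ℕ) :
    D.filt m ≤ Submodule.span k
      {a | ∃ (α : Fin n → ℕ) (g : TensorPow k F n) (π : Equiv.Perm (Fin n)),
        ∑ i, α i ≤ m ∧ a = D.mono α * D.f g * D.s π} := by
  refine (mul_le_mul_left (D.linPart_pow_le_span m) _).trans ?_
  rw [wreath, Submodule.span_mul_span, Submodule.span_le]
  rintro _ ⟨_, ⟨α, hα, rfl⟩, _, ⟨g, π, rfl⟩, rfl⟩
  exact Submodule.subset_span ⟨α, g, π, hα, (mul_assoc _ _ _).symm⟩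

theorem mono_mul_mem_filt {α : Fin n → ℕ} {m : ℕ} (h : ∑ i, α i ≤ m) {a : A}
    (ha : a ∈ D.wreath) : D.mono α * a ∈ D.filt m :=
  Submodule.mul_mem_mul (D.mono_mem_linPart_pow α h) ha

theorem exists_mem_filt (ht : IsTeleporter t) (a : A) : ∃ m, a ∈ D.filt m := by
  induction a using D.alg_induction with
  | x i => exact ⟨1, D.linPart_pow_le_filt 1 (by rw [pow_one]; exact D.x_mem i)⟩
  | f g => exact ⟨0, by rw [filt_zero]; exact D.f_mem g⟩
  | s π => exact ⟨0, by rw [filt_zero]; exact D.s_mem π⟩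
  | add a b ha hb =>
    obtain ⟨m, ha⟩ := ha
    obtain ⟨l, hb⟩ := hb
    exact ⟨max m l, add_mem (D.filt_mono (le_max_left _ _) ha) (D.filt_mono (le_max_right _ _) hb)⟩
  | mul a b ha hb =>
    obtain ⟨m, ha⟩ := ha
    obtain ⟨l, hb⟩ := hb
    exact ⟨m + l, D.filt_mul_filt ht m l (Submodule.mul_mem_mul ha hb)⟩

theorem exists_mem_filtLt (ht : IsTeleporter t) (a : A) : ∃ m, a ∈ D.filtLt m := by
  obtain ⟨m, h⟩ := D.exists_mem_filt ht a
  exact ⟨m + 1, h⟩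

theorem s_mul_s_inv (π : Equiv.Perm (Fin n)) : D.s π * D.s π⁻¹ = 1 := by
  rw [← map_mul, mul_inv_cancel, map_one]

theorem s_inv_mul_s (π : Equiv.Perm (Fin n)) : D.s π⁻¹ * D.s π = 1 := by
  rw [← map_mul, inv_mul_cancel, map_one]

theorem conj_x_sub_mem (ht : IsTeleporter t) (π : Equiv.Perm (Fin n)) (j : Fin n) :
    D.s π * D.x j * D.s π⁻¹ - D.x (π j) ∈ D.wreath := by
  have h := D.wreath_mul_wreath (Submodule.mul_mem_mul (D.s_mul_x_sub_mem ht π j) (D.s_mem π⁻¹))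
  rwa [sub_mul, mul_assoc (D.x _), s_mul_s_inv, mul_one] at h

theorem f_mem_filt (g : TensorPow k F n) : D.f g ∈ D.filt 0 := by
  rw [filt_zero]; exact D.f_mem g

theorem s_mem_filt (π : Equiv.Perm (Fin n)) : D.s π ∈ D.filt 0 := by
  rw [filt_zero]; exact D.s_mem π

theorem x_pow_mem_filt (i : Fin n) (m : ℕ) : D.x i ^ m ∈ D.filt m :=
  D.linPart_pow_le_filt m (Submodule.pow_mem_pow _ (D.x_mem i) m)

theorem x_mem_filt (i : Fin n) : D.x i ∈ D.filt 1 := by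
  have := D.x_pow_mem_filt i 1
  rwa [pow_one] at this

theorem mul_mem_filt (ht : IsTeleporter t) {p q r : ℕ} {a b : A} (ha : a ∈ D.filt p)
    (hb : b ∈ D.filt q) (h : p + q = r) : a * b ∈ D.filt r :=
  h ▸ D.filt_mul_filt ht p q (Submodule.mul_mem_mul ha hb)

theorem mul_mem_filtLt_right (ht : IsTeleporter t) {p q r : ℕ} {a b : A} (ha : a ∈ D.filt p)
    (hb : b ∈ D.filtLt q) (h : p + q = r) : a * b ∈ D.filtLt r :=
  h ▸ D.filt_mul_filtLt ht p q (Submodule.mul_mem_mul ha hb)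

theorem mul_mem_filtLt_left (ht : IsTeleporter t) {p q r : ℕ} {a b : A} (ha : a ∈ D.filtLt p)
    (hb : b ∈ D.filt q) (h : p + q = r) : a * b ∈ D.filtLt r :=
  h ▸ D.filtLt_mul_filt ht p q (Submodule.mul_mem_mul ha hb)

/-- Conjugation of a power of `x_j`, up to terms of lower degree. -/
theorem conj_x_pow_sub_mem (ht : IsTeleporter t) (π : Equiv.Perm (Fin n)) (j : Fin n) (m : ℕ) :
    D.s π * D.x j ^ m * D.s π⁻¹ - D.x (π j) ^ m ∈ D.filtLt m := by
  induction m with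
  | zero =>
    rw [pow_zero, pow_zero, mul_one, s_mul_s_inv, sub_self]
    exact zero_mem _
  | succ m ih =>
    have h : D.s π * D.x j ^ (m + 1) * D.s π⁻¹ - D.x (π j) ^ (m + 1) =
        (D.s π * D.x j ^ m * D.s π⁻¹ - D.x (π j) ^ m) * (D.s π * D.x j * D.s π⁻¹) +
          D.x (π j) ^ m * (D.s π * D.x j * D.s π⁻¹ - D.x (π j)) := by
      have h2 : D.s π * D.x j ^ (m + 1) * D.s π⁻¹ =
          (D.s π * D.x j ^ m * D.s π⁻¹) * (D.s π * D.x j * D.s π⁻¹) := by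
        rw [pow_succ]
        calc _ = D.s π * D.x j ^ m * 1 * D.x j * D.s π⁻¹ := by simp only [mul_assoc, one_mul]
          _ = _ := by rw [← D.s_inv_mul_s π]; simp only [mul_assoc]
      rw [h2, sub_mul, mul_sub, pow_succ]
      abel
    rw [h]
    refine add_mem (D.mul_mem_filtLt_left ht ih (D.mul_mem_filt ht (D.mul_mem_filt ht
      (D.s_mem_filt π) (D.x_mem_filt j) rfl) (D.s_mem_filt π⁻¹) rfl) rfl) ?_
    refine D.mul_mem_filt ht (D.x_pow_mem_filt _ m) ?_ (add_zero m)
    rw [filt_zero]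
    exact D.conj_x_sub_mem ht π j

/-- A linear endomorphism which is unitriangular for the filtration is bijective. -/
theorem bijective_of_unitriangular (ht : IsTeleporter t) (φ : A →ₗ[k] A)
    (h : ∀ α g π, φ (D.mono α * D.f g * D.s π) - D.mono α * D.f g * D.s π ∈
      D.filtLt (∑ i, α i)) : Function.Bijective φ := by
  have h' : ∀ m, ∀ a ∈ D.filt m, φ a - a ∈ D.filtLt m := by
    intro m
    refine (D.filt_le_span m).trans (Submodule.span_le.2 ?_ :
      _ ≤ (D.filtLt m).comap (φ - LinearMap.id))
    rintro _ ⟨α, g, π, hα, rfl⟩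
    exact D.filtLt_mono hα (h α g π)
  constructor
  · rw [injective_iff_map_eq_zero]
    -- If φ a = 0 then a = -(φ a - a) lies one step lower; the descent ends at ⊥.
    have key : ∀ m, ∀ a ∈ D.filtLt m, φ a = 0 → a = 0 := by
      intro m
      induction m with
      | zero => intro a ha _; exact ha
      | succ m ih =>
        intro a ha h0
        have := h' m a ha
        rw [h0, zero_sub, neg_mem_iff] at this
        exact ih a this h0
    intro a h0
    obtain ⟨m, hm⟩ := D.exists_mem_filtLt ht a
    exact key m a hm h0
  · have key : ∀ m, D.filtLt m ≤ LinearMap.range φ := by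
      intro m
      induction m with
      | zero => exact bot_le
      | succ m ih =>
        intro a ha
        have := sub_mem (LinearMap.mem_range_self φ a) (ih (h' m a ha))
        rwa [sub_sub_cancel] at this
    intro a
    obtain ⟨m, hm⟩ := D.exists_mem_filtLt ht a
    exact key m hm

end AffineWreathData

end Filtration

end AffWr

namespace AffWr

open PiTensorProduct

/-! ### The ideal generated by `χ_C` -/

namespace AffineWreathData

variable {k F : Type*} [CommRing k] [Ring F] [Algebra k F] {n : ℕ} [NeZero n]
  {t : Fin n → Fin n → TensorPow k F n} {A : Type*} [Ring A] [Algebra k A]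
  (D : AffineWreathData t A) {d : ℕ} (c : Fin d → TensorPow k F n)

/-- The conjugate of `∏_j (x_1 - c_j)` by the transposition `(1, i)`. -/
def chi (i : Fin n) : A :=
  D.s (Equiv.swap 0 i) * (List.ofFn fun j => D.x 0 - D.f (c j)).prod * D.s (Equiv.swap 0 i)

theorem chi_zero : D.chi c 0 = (List.ofFn fun j => D.x 0 - D.f (c j)).prod := by
  rw [chi, Equiv.swap_self]
  change D.s 1 * _ * D.s 1 = _
  rw [map_one, one_mul, mul_one]

variable {c}

theorem commute_chi_zero (a : A) (hx : Commute a (D.x 0)) (hc : ∀ j, Commute a (D.f (c j))) :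
    Commute a (D.chi c 0) := by
  rw [chi_zero]
  exact commute_prod_ofFn _ _ fun j => hx.sub_right (hc j)

/-- Permutations fixing the first index commute with x_1 and with the c_j, hence with χ_1. The
permutation (1, π i) π (1, i) is of this kind. -/
theorem s_chi (ht : IsTeleporter t) (hc : ∀ j π, π 0 = 0 → permAct π (c j) = c j)
    (π : Equiv.Perm (Fin n)) (i : Fin n) : D.s π * D.chi c i = D.chi c (π i) * D.s π := by
  have h0 : ∀ σ : Equiv.Perm (Fin n), σ 0 = 0 → Commute (D.s σ) (D.chi c 0) := fun σ hσ =>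
    D.commute_chi_zero _ (D.s_x_zero ht σ hσ) fun j => by
      have := D.s_f σ (c j)
      rwa [hc j σ hσ] at this
  have h1 := h0 (Equiv.swap 0 (π i) * π * Equiv.swap 0 i) (by simp)
  have h2 : ∀ j : Fin n, D.s (Equiv.swap 0 j) * D.s (Equiv.swap 0 j) = 1 := fun j => by
    rw [← map_mul, Equiv.swap_mul_self, map_one]
  have h3 : ∀ j, D.chi c j = D.s (Equiv.swap 0 j) * D.chi c 0 * D.s (Equiv.swap 0 j) :=
    fun j => by rw [chi_zero, chi]
  rw [map_mul, map_mul, Commute, SemiconjBy] at h1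
  rw [h3 i, h3 (π i)]
  calc D.s π * (D.s (Equiv.swap 0 i) * D.chi c 0 * D.s (Equiv.swap 0 i))
      = (D.s (Equiv.swap 0 (π i)) * D.s (Equiv.swap 0 (π i))) * D.s π *
        (D.s (Equiv.swap 0 i) * D.chi c 0 * D.s (Equiv.swap 0 i)) := by rw [h2, one_mul]
    _ = D.s (Equiv.swap 0 (π i)) * (D.s (Equiv.swap 0 (π i)) * D.s π * D.s (Equiv.swap 0 i) *
        D.chi c 0) * D.s (Equiv.swap 0 i) := by simp only [mul_assoc]
    _ = D.s (Equiv.swap 0 (π i)) * D.chi c 0 * D.s (Equiv.swap 0 (π i)) * D.s π *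
        (D.s (Equiv.swap 0 i) * D.s (Equiv.swap 0 i)) := by rw [h1]; simp only [mul_assoc]
    _ = _ := by rw [h2, mul_one]

theorem f_chi (hf : ∀ j g, Commute (c j) g) (g : TensorPow k F n) (i : Fin n) :
    Commute (D.f g) (D.chi c i) := by
  have h0 : ∀ g, Commute (D.f g) (D.chi c 0) := fun g =>
    D.commute_chi_zero _ (D.f_x g 0) fun j => by
      rw [Commute, SemiconjBy, ← map_mul, ← map_mul, (hf j g).eq]
  have h1 := h0 (permAct (Equiv.swap 0 i) g)
  rw [Commute, SemiconjBy] at h1 ⊢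
  have hs : D.f g * D.s (Equiv.swap 0 i) =
      D.s (Equiv.swap 0 i) * D.f (permAct (Equiv.swap 0 i) g) := by
    rw [D.s_f, permAct_permAct, Equiv.swap_mul_self, one_permAct]
  rw [chi, ← chi_zero, ← mul_assoc, ← mul_assoc, hs, mul_assoc (D.s _), h1]
  simp only [mul_assoc]
  rw [D.s_f]

/-- The span of the elements `χ_i`. -/
def chiSpan (c : Fin d → TensorPow k F n) : Submodule k A :=
  Submodule.span k (Set.range (D.chi c))

theorem chi_mem (i : Fin n) : D.chi c i ∈ D.chiSpan c := Submodule.subset_span ⟨i, rfl⟩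

theorem wreath_mul_chiSpan (ht : IsTeleporter t) (hc : ∀ j π, π 0 = 0 → permAct π (c j) = c j)
    (hf : ∀ j g, Commute (c j) g) : D.wreath * D.chiSpan c ≤ D.chiSpan c * D.wreath := by
  conv_lhs => rw [wreath, chiSpan, Submodule.span_mul_span]
  rw [Submodule.span_le]
  rintro _ ⟨_, ⟨g, π, rfl⟩, _, ⟨i, rfl⟩, rfl⟩
  dsimp only
  rw [mul_assoc, D.s_chi ht hc, ← mul_assoc, (D.f_chi hf g _).eq, mul_assoc]
  exact Submodule.mul_mem_mul (D.chi_mem _) (D.f_mul_s_mem g π)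

/-- The polynomial generators commute with χ_1, so their conjugates by (1, i) commute exactly with
χ_i. Each x_j differs from such a conjugate by an element of `wreath`. -/
theorem x_mul_chi_sub_mem (ht : IsTeleporter t) (hc : ∀ j π, π 0 = 0 → permAct π (c j) = c j)
    (hf : ∀ j g, Commute (c j) g) (i j : Fin n) :
    D.x j * D.chi c i - D.chi c i * D.x j ∈ D.chiSpan c * D.wreath := by
  set π := Equiv.swap 0 i with hπ
  have h0 : Commute (D.x (π⁻¹ j)) (D.chi c 0) :=
    D.commute_chi_zero _ (D.x_comm _ _) fun l => (D.f_x _ _).symm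
  have hi : D.chi c i = D.s π * D.chi c 0 * D.s π⁻¹ := by
    rw [D.s_chi ht hc, mul_assoc, s_mul_s_inv, mul_one, hπ, Equiv.swap_apply_left]
  have h1 : (D.s π * D.x (π⁻¹ j) * D.s π⁻¹) * D.chi c i =
      D.chi c i * (D.s π * D.x (π⁻¹ j) * D.s π⁻¹) := by
    rw [hi]
    calc _ = D.s π * D.x (π⁻¹ j) * (D.s π⁻¹ * D.s π) * D.chi c 0 * D.s π⁻¹ := by
          simp only [mul_assoc]
      _ = D.s π * (D.x (π⁻¹ j) * D.chi c 0) * D.s π⁻¹ := by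
          rw [s_inv_mul_s]; simp only [mul_assoc, one_mul]
      _ = D.s π * D.chi c 0 * 1 * D.x (π⁻¹ j) * D.s π⁻¹ := by
          rw [h0.eq]; simp only [mul_assoc, one_mul]
      _ = _ := by rw [← D.s_inv_mul_s π]; simp only [mul_assoc]
  have h2 := D.conj_x_sub_mem ht π (π⁻¹ j)
  rw [← Equiv.Perm.mul_apply, mul_inv_cancel, Equiv.Perm.one_apply] at h2
  have h3 : D.x j * D.chi c i - D.chi c i * D.x j =
      D.chi c i * (D.s π * D.x (π⁻¹ j) * D.s π⁻¹ - D.x j) -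
        (D.s π * D.x (π⁻¹ j) * D.s π⁻¹ - D.x j) * D.chi c i := by
    rw [mul_sub, sub_mul, h1]; abel
  rw [h3]
  exact sub_mem (Submodule.mul_mem_mul (D.chi_mem i) h2)
    (D.wreath_mul_chiSpan ht hc hf (Submodule.mul_mem_mul h2 (D.chi_mem i)))

theorem linPart_mul_chiSpan (ht : IsTeleporter t)
    (hc : ∀ j π, π 0 = 0 → permAct π (c j) = c j) (hf : ∀ j g, Commute (c j) g) :
    D.linPart * D.chiSpan c ≤ D.chiSpan c * D.filt 1 := by
  conv_lhs => rw [linPart, chiSpan, Submodule.span_mul_span]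
  rw [Submodule.span_le]
  rintro _ ⟨b, rfl | ⟨j, rfl⟩, _, ⟨i, rfl⟩, rfl⟩
  · dsimp only
    rw [one_mul, ← mul_one (D.chi c i)]
    exact Submodule.mul_mem_mul (D.chi_mem i)
      (D.linPart_pow_le_filt 1 (by rw [pow_one]; exact D.one_mem_linPart))
  · dsimp only
    rw [← sub_add_cancel (D.x j * D.chi c i) (D.chi c i * D.x j)]
    refine add_mem (mul_le_mul_right (D.filt_mono (Nat.zero_le 1)) _ ?_)
      (Submodule.mul_mem_mul (D.chi_mem i)
        (D.linPart_pow_le_filt 1 (by rw [pow_one]; exact D.x_mem j)))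
    rw [filt_zero]
    exact D.x_mul_chi_sub_mem ht hc hf i j

/-- Left multiplication passes through the χ_i without raising degree. So Σ χ_i A is also a left
ideal, with degree control. -/
theorem filt_mul_chiSpan (ht : IsTeleporter t)
    (hc : ∀ j π, π 0 = 0 → permAct π (c j) = c j) (hf : ∀ j g, Commute (c j) g) (m : ℕ) :
    D.filt m * D.chiSpan c ≤ D.chiSpan c * D.filt m := by
  have key : D.linPart ^ m * D.chiSpan c ≤ D.chiSpan c * D.filt m := by
    induction m with
    | zero =>
      rw [pow_zero, one_mul, filt_zero]
      intro a ha
      rw [← mul_one a]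
      exact Submodule.mul_mem_mul ha D.one_mem_wreath
    | succ m ih =>
      rw [pow_succ', mul_assoc]
      refine (mul_le_mul_right ih _).trans ?_
      rw [← mul_assoc]
      refine (mul_le_mul_left (D.linPart_mul_chiSpan ht hc hf) _).trans ?_
      rw [mul_assoc, add_comm m]
      exact mul_le_mul_right (D.filt_mul_filt ht 1 m) _
  rw [filt, mul_assoc]
  refine (mul_le_mul_right (D.wreath_mul_chiSpan ht hc hf) _).trans ?_
  rw [← mul_assoc]
  refine (mul_le_mul_left key _).trans ?_
  rw [filt, mul_assoc, mul_assoc]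
  exact mul_le_mul_right (mul_le_mul_right D.wreath_mul_wreath _) _

theorem filtLt_mul_chiSpan (ht : IsTeleporter t)
    (hc : ∀ j π, π 0 = 0 → permAct π (c j) = c j) (hf : ∀ j g, Commute (c j) g) (m : ℕ) :
    D.filtLt m * D.chiSpan c ≤ D.chiSpan c * D.filtLt m := by
  cases m with
  | zero => rw [filtLt, Submodule.bot_mul]; exact bot_le
  | succ m => exact D.filt_mul_chiSpan ht hc hf m

/-- The c_j have filtration degree zero, so χ_1 has leading term x_1^d; conjugation transports this
to χ_i. -/
theorem chi_sub_mem (ht : IsTeleporter t) (c : Fin d → TensorPow k F n) (i : Fin n) :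
    D.chi c i - D.x i ^ d ∈ D.filtLt d := by
  have h0 : D.chi c 0 - D.x 0 ^ d ∈ D.filtLt d := by
    rw [chi_zero]
    induction d with
    | zero => simp
    | succ d ih =>
      rw [List.ofFn_succ, List.prod_cons]
      specialize ih fun j => c j.succ
      have hc : (List.ofFn fun j : Fin d => D.x 0 - D.f (c j.succ)).prod ∈ D.filt d := by
        rw [← sub_add_cancel (List.prod _) (D.x 0 ^ d)]
        exact add_mem (D.filtLt_le_filt d ih) (D.x_pow_mem_filt 0 d)
      generalize (List.ofFn fun j : Fin d => D.x 0 - D.f (c j.succ)).prod = p at ih hc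
      have h : (D.x 0 - D.f (c 0)) * p - D.x 0 ^ (d + 1) =
          D.x 0 * (p - D.x 0 ^ d) - D.f (c 0) * p := by
        rw [sub_mul, mul_sub, pow_succ']; abel
      rw [h]
      exact sub_mem (D.mul_mem_filtLt_right ht (D.x_mem_filt 0) ih (add_comm 1 d))
        (D.mul_mem_filt ht (D.f_mem_filt (c 0)) hc (zero_add d))
  have h1 := D.conj_x_pow_sub_mem ht (Equiv.swap 0 i) 0 d
  rw [Equiv.swap_apply_left, Equiv.swap_inv] at h1
  have h2 := D.mul_mem_filtLt_left ht (D.mul_mem_filtLt_right ht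
    (D.s_mem_filt (Equiv.swap 0 i)) h0 (zero_add d)) (D.s_mem_filt (Equiv.swap 0 i)) rfl
  rw [mul_sub, sub_mul, chi_zero, ← chi] at h2
  have := add_mem h2 h1
  rwa [sub_add_sub_cancel] at this

theorem chi_mul_mem {m : ℕ} {a : A} (i : Fin n) (ha : a ∈ D.filtLt m) :
    D.chi c i * a ∈ D.chiSpan c * D.filtLt m := Submodule.mul_mem_mul (D.chi_mem i) ha

theorem x_pow_mul_chi_sub_mem (ht : IsTeleporter t)
    (hc : ∀ j π, π 0 = 0 → permAct π (c j) = c j) (hf : ∀ j g, Commute (c j) g) (i j : Fin n)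
    (m : ℕ) : D.x j ^ m * D.chi c i - D.chi c i * D.x j ^ m ∈ D.chiSpan c * D.filtLt m := by
  induction m with
  | zero => rw [pow_zero, one_mul, mul_one, sub_self]; exact zero_mem _
  | succ m ih =>
    have h : D.x j ^ (m + 1) * D.chi c i - D.chi c i * D.x j ^ (m + 1) =
        D.x j ^ m * (D.x j * D.chi c i - D.chi c i * D.x j) +
          (D.x j ^ m * D.chi c i - D.chi c i * D.x j ^ m) * D.x j := by
      rw [mul_sub, sub_mul, pow_succ]
      simp only [mul_assoc]
      abel
    rw [h]
    refine add_mem ?_ ?_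
    · have h1 := Submodule.mul_mem_mul (D.x_pow_mem_filt j m) (D.x_mul_chi_sub_mem ht hc hf i j)
      rw [← filt_zero, ← mul_assoc] at h1
      have h2 := mul_le_mul_left (D.filt_mul_chiSpan ht hc hf m) _ h1
      rw [mul_assoc] at h2
      exact mul_le_mul_right (D.filt_mul_filt ht m 0) _ h2
    · have h1 := Submodule.mul_mem_mul ih (D.x_mem_filt j)
      rw [mul_assoc] at h1
      exact mul_le_mul_right (D.filtLt_mul_filt ht m 1) _ h1

/-- The S-polynomial of `χ_i` and `χ_j` has a representation of lower degree. -/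
theorem chi_mul_x_pow_sub_mem (ht : IsTeleporter t)
    (hc : ∀ j π, π 0 = 0 → permAct π (c j) = c j) (hf : ∀ j g, Commute (c j) g) (i j : Fin n) :
    D.chi c j * D.x i ^ d - D.chi c i * D.x j ^ d ∈ D.chiSpan c * D.filtLt d := by
  -- Inserting x_j^d χ_i and χ_j χ_i splits the difference into a commutator and two products with a
  -- factor χ - x^d. Each can be written as χ's times terms of degree below d.
  have h : D.chi c j * D.x i ^ d - D.chi c i * D.x j ^ d =
      (D.x j ^ d * D.chi c i - D.chi c i * D.x j ^ d) + (D.chi c j - D.x j ^ d) * D.chi c i -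
        D.chi c j * (D.chi c i - D.x i ^ d) := by
    rw [sub_mul, mul_sub]; abel
  rw [h]
  exact sub_mem (add_mem (D.x_pow_mul_chi_sub_mem ht hc hf i j d)
    (D.filtLt_mul_chiSpan ht hc hf d (Submodule.mul_mem_mul (D.chi_sub_mem ht c j) (D.chi_mem i))))
    (D.chi_mul_mem j (D.chi_sub_mem ht c i))

/-- `χ_i x^γ w` only depends on `x_i^d x^γ w`, up to terms of lower degree. -/
theorem chi_mul_mono_sub_mem (ht : IsTeleporter t)
    (hc : ∀ j π, π 0 = 0 → permAct π (c j) = c j) (hf : ∀ j g, Commute (c j) g) (i j : Fin n)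
    (γ γ' : Fin n → ℕ) (h : γ + Pi.single i d = γ' + Pi.single j d) {a : A} (ha : a ∈ D.wreath) :
    D.chi c i * (D.mono γ * a) - D.chi c j * (D.mono γ' * a) ∈
      D.chiSpan c * D.filtLt (∑ l, γ l) := by
  by_cases hij : i = j
  · subst hij
    rw [add_right_cancel h, sub_self]
    exact zero_mem _
  -- For i ≠ j the common exponent contains both x_i^d and x_j^d; ε is what remains.
  have h1 : ∃ ε : Fin n → ℕ, γ = Pi.single j d + ε ∧ γ' = Pi.single i d + ε := by
    refine ⟨γ - Pi.single j d, ?_, ?_⟩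
    · funext l
      have := congrFun h l
      by_cases hl : l = j
      · subst hl
        simp [Ne.symm hij] at this ⊢
        omega
      · simp [hl]
    · funext l
      have := congrFun h l
      by_cases hl : l = j
      · subst hl
        simp [Ne.symm hij] at this ⊢
        omega
      · simp only [Pi.add_apply, Pi.sub_apply, Pi.single_eq_of_ne hl] at this ⊢
        omega
  obtain ⟨ε, rfl, rfl⟩ := h1
  have h2 := Submodule.mul_mem_mul (D.chi_mul_x_pow_sub_mem ht hc hf j i)
    (D.mono_mul_mem_filt (α := ε) le_rfl ha)
  rw [mul_assoc] at h2
  have h3 := mul_le_mul_right (D.filtLt_mul_filt ht d (∑ i, ε i)) _ h2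
  have hsum : ∑ l, (Pi.single j d + ε : Fin n → ℕ) l = d + ∑ l, ε l := by
    simp [Finset.sum_add_distrib]
  rw [hsum, D.mono_add, D.mono_add, D.mono_single, D.mono_single]
  simpa only [sub_mul, mul_assoc] using h3

end AffineWreathData

end AffWr

namespace AffWr

open PiTensorProduct

/-! ### A basis of the cyclotomic quotient -/

namespace AffineWreathData

variable {k F : Type*} [CommRing k] [Ring F] [Algebra k F] {n : ℕ}
  {t : Fin n → Fin n → TensorPow k F n} {A : Type*} [Ring A] [Algebra k A]
  (D : AffineWreathData t A)

theorem exists_span (ht : IsTeleporter t) (a : A) : a ∈ Submodule.span k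
    {a | ∃ (α : Fin n → ℕ) (g : TensorPow k F n) (π : Equiv.Perm (Fin n)),
      a = D.mono α * D.f g * D.s π} := by
  obtain ⟨m, hm⟩ := D.exists_mem_filt ht a
  refine Submodule.span_mono ?_ (D.filt_le_span m hm)
  rintro _ ⟨α, g, π, -, rfl⟩
  exact ⟨α, g, π, rfl⟩

/-- The map with values `x^α w`. -/
def expand : ((Fin n → ℕ) →₀ WreathMod k F n) →ₗ[k] A :=
  Finsupp.lsum k fun α => LinearMap.mulLeft k (D.mono α) ∘ₗ D.emb

variable {d : ℕ}

/-- The elements `x^α f π` with `α_i ≥ d` for some `i`. -/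
def largeMonomials (d : ℕ) : Set A :=
  {a | ∃ (α : Fin n → ℕ) (g : TensorPow k F n) (π : Equiv.Perm (Fin n)),
    (∃ i, d ≤ α i) ∧ a = D.mono α * D.f g * D.s π}

theorem sub_single_add {α : Fin n → ℕ} {i : Fin n} (h : d ≤ α i) :
    α - Pi.single i d + Pi.single i d = α := by
  funext l
  by_cases hl : l = i
  · subst hl; simp [h]
  · simp [hl]

theorem expand_apply (Ψ : A →ₗ[k] ((Fin n → ℕ) →₀ WreathMod k F n))
    (hΨ : ∀ α g π, Ψ (D.mono α * D.f g * D.s π) = Finsupp.single α (Pi.single π g))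
    (ht : IsTeleporter t) (a : A) : D.expand (Ψ a) = a := by
  induction D.exists_span ht a using Submodule.span_induction with
  | mem a h =>
    obtain ⟨α, g, π, rfl⟩ := h
    rw [hΨ, expand, Finsupp.lsum_single, LinearMap.comp_apply, emb_single, LinearMap.mulLeft_apply,
      mul_assoc]
  | zero => rw [map_zero, map_zero]
  | add a b _ _ ha hb => rw [map_add, map_add, ha, hb]
  | smul r a _ ha => rw [map_smul, map_smul, ha]

variable [NeZero n] (c : Fin d → TensorPow k F n)

open Classical in
/-- The map with values `x^α w` if `α_i < d` for all `i`; otherwise one factor `x_i^d` is replaced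
by `χ_i`. -/
def chiExpand : ((Fin n → ℕ) →₀ WreathMod k F n) →ₗ[k] A :=
  Finsupp.lsum k fun α =>
    if h : ∃ i, d ≤ α i then
      LinearMap.mulLeft k (D.chi c h.choose * D.mono (α - Pi.single h.choose d)) ∘ₗ D.emb
    else LinearMap.mulLeft k (D.mono α) ∘ₗ D.emb

theorem chiExpand_single_of_lt {α : Fin n → ℕ} (h : ∀ i, α i < d) (g : TensorPow k F n)
    (π : Equiv.Perm (Fin n)) :
    D.chiExpand c (Finsupp.single α (Pi.single π g)) = D.mono α * D.f g * D.s π := by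
  have h' : ¬ ∃ i, d ≤ α i := by simpa using h
  rw [chiExpand, Finsupp.lsum_single, dif_neg h', LinearMap.comp_apply, emb_single,
    LinearMap.mulLeft_apply, mul_assoc]

theorem chiExpand_single_of_le {α : Fin n → ℕ} (h : ∃ i, d ≤ α i) : ∃ i,
    d ≤ α i ∧ ∀ (g : TensorPow k F n) (π : Equiv.Perm (Fin n)),
      D.chiExpand c (Finsupp.single α (Pi.single π g)) =
        D.chi c i * (D.mono (α - Pi.single i d) * (D.f g * D.s π)) := by
  refine ⟨h.choose, h.choose_spec, fun g π => ?_⟩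
  rw [chiExpand, Finsupp.lsum_single, dif_pos h, LinearMap.comp_apply, emb_single,
    LinearMap.mulLeft_apply, mul_assoc]

variable {c}
variable (Ψ : A →ₗ[k] ((Fin n → ℕ) →₀ WreathMod k F n))
  (hΨ : ∀ α g π, Ψ (D.mono α * D.f g * D.s π) = Finsupp.single α (Pi.single π g))
include hΨ

/-- Replacing x_i^d by χ_i changes a monomial only in lower degree. -/
theorem chiExpand_bijective (ht : IsTeleporter t) (c : Fin d → TensorPow k F n) :
    Function.Bijective (D.chiExpand c ∘ₗ Ψ) := by
  refine D.bijective_of_unitriangular ht _ fun α g π => ?_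
  rw [LinearMap.comp_apply, hΨ]
  by_cases h : ∃ i, d ≤ α i
  · obtain ⟨i, hi, hα⟩ := D.chiExpand_single_of_le c h
    rw [hα]
    have h1 : D.mono α = D.x i ^ d * D.mono (α - Pi.single i d) := by
      rw [← D.mono_single, ← D.mono_add, add_comm, sub_single_add hi]
    rw [h1, mul_assoc, mul_assoc, ← sub_mul]
    refine D.mul_mem_filtLt_left ht (D.chi_sub_mem ht c i)
      (D.mono_mul_mem_filt le_rfl (D.f_mul_s_mem g π)) ?_
    conv_rhs => rw [← sub_single_add hi]
    simp [Finset.sum_add_distrib, add_comm]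
  · rw [D.chiExpand_single_of_lt c (by simpa using h), sub_self]
    exact zero_mem _

/-- The index i in χ_i x^γ f π may differ from the one `chiExpand` chooses for the exponent. The
reduction of S-polynomials bounds the discrepancy by ideal elements of lower degree, and induction
on degree finishes. -/
theorem chiSpan_mul_top_eq (ht : IsTeleporter t)
    (hc : ∀ j π, π 0 = 0 → permAct π (c j) = c j) (hf : ∀ j g, Commute (c j) g) :
    D.chiSpan c * ⊤ = (Submodule.span k (D.largeMonomials d)).map (D.chiExpand c ∘ₗ Ψ) := by
  apply le_antisymm
  · have key : ∀ m, D.chiSpan c * D.filtLt m ≤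
        (Submodule.span k (D.largeMonomials d)).map (D.chiExpand c ∘ₗ Ψ) := by
      intro m
      induction m with
      | zero => rw [filtLt, Submodule.mul_bot]; exact bot_le
      | succ m ih =>
        refine (mul_le_mul_right (D.filt_le_span m) _).trans ?_
        rw [chiSpan, Submodule.span_mul_span, Submodule.span_le]
        rintro _ ⟨_, ⟨i, rfl⟩, _, ⟨γ, g, π, hγ, rfl⟩, rfl⟩
        dsimp only
        have hle : ∃ j, d ≤ (γ + Pi.single i d : Fin n → ℕ) j := ⟨i, by simp⟩
        obtain ⟨j, hj, hα⟩ := D.chiExpand_single_of_le c hle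
        have h1 := ih (mul_le_mul_right (D.filtLt_mono hγ) _ (D.chi_mul_mono_sub_mem ht hc hf i j γ
          (γ + Pi.single i d - Pi.single j d) (sub_single_add hj).symm (D.f_mul_s_mem g π)))
        have h0 : D.mono (γ + Pi.single i d) * D.f g * D.s π ∈ D.largeMonomials d :=
          ⟨_, g, π, hle, rfl⟩
        have h2 := Submodule.mem_map_of_mem (f := D.chiExpand c ∘ₗ Ψ)
          (Submodule.subset_span (R := k) h0)
        rw [LinearMap.comp_apply, hΨ, hα] at h2
        have h3 := add_mem h1 h2
        rw [sub_add_cancel, ← mul_assoc (D.mono γ)] at h3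
        exact h3
    rw [Submodule.mul_le]
    intro a ha b _
    obtain ⟨m, hm⟩ := D.exists_mem_filtLt ht b
    exact key m (Submodule.mul_mem_mul ha hm)
  · rw [Submodule.map_span, Submodule.span_le]
    rintro _ ⟨_, ⟨α, g, π, hle, rfl⟩, rfl⟩
    obtain ⟨i, -, hα⟩ := D.chiExpand_single_of_le c hle
    rw [LinearMap.comp_apply, hΨ, hα]
    exact Submodule.mul_mem_mul (D.chi_mem i) trivial

/-- The elements `x^α f π` with `α_i < d` form a basis modulo the ideal generated by the `χ_i`. -/
theorem exists_truncated_coord (ht : IsTeleporter t)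
    (hc : ∀ j π, π 0 = 0 → permAct π (c j) = c j) (hf : ∀ j g, Commute (c j) g) :
    ∃ E : A →ₗ[k] ((Fin n → Fin d) → WreathMod k F n),
      (∀ a, E a = 0 ↔ a ∈ D.chiSpan c * ⊤) ∧
      ∀ (β : Fin n → Fin d) (g : TensorPow k F n) (π : Equiv.Perm (Fin n)),
        E (D.mono (fun i => β i) * D.f g * D.s π) = Pi.single β (Pi.single π g) := by
  let φ := LinearEquiv.ofBijective _ (D.chiExpand_bijective Ψ hΨ ht c)
  have hφ : ∀ a, φ a = D.chiExpand c (Ψ a) := fun a => rfl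
  let R : ((Fin n → ℕ) →₀ WreathMod k F n) →ₗ[k] ((Fin n → Fin d) → WreathMod k F n) :=
    LinearMap.pi fun β => Finsupp.lapply (fun i => (β i : ℕ))
  have hR : ∀ v β, R v β = v (fun i => β i) := fun v β => rfl
  -- The inverse of φ carries the ideal to the span of the large monomials, so the PBW coordinates
  -- with exponents below d describe the quotient.
  refine ⟨R ∘ₗ Ψ ∘ₗ φ.symm.toLinearMap, fun a => ?_, fun β g π => ?_⟩
  · rw [D.chiSpan_mul_top_eq Ψ hΨ ht hc hf]
    constructor
    · intro h
      refine ⟨φ.symm a, ?_, φ.apply_symm_apply a⟩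
      rw [← D.expand_apply Ψ hΨ ht (φ.symm a), expand, Finsupp.lsum_apply]
      refine Submodule.sum_mem _ fun α hα => ?_
      have hle : ∃ i, d ≤ α i := by
        by_contra! hlt
        have := congrFun h (fun i => ⟨α i, hlt i⟩)
        exact Finsupp.mem_support_iff.1 hα this
      simp only [LinearMap.comp_apply, emb_apply, map_sum, LinearMap.mulLeft_apply]
      refine Submodule.sum_mem _ fun π _ => ?_
      rw [← mul_assoc]
      exact Submodule.subset_span ⟨α, _, π, hle, rfl⟩
    · rintro ⟨b, hb, rfl⟩
      have h1 : (D.chiExpand c ∘ₗ Ψ) b = φ b := rfl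
      rw [LinearMap.comp_apply, LinearMap.comp_apply, h1, LinearEquiv.coe_coe,
        LinearEquiv.symm_apply_apply]
      induction hb using Submodule.span_induction with
      | mem a h =>
        obtain ⟨α, g, π, ⟨i, hi⟩, rfl⟩ := h
        funext β
        rw [hΨ, hR, Finsupp.single_eq_of_ne]
        · rfl
        · intro h
          have := congrFun h i
          have := (β i).2
          omega
      | zero => rw [map_zero, map_zero]
      | add a b _ _ ha hb => rw [map_add, map_add, ha rfl, hb rfl, add_zero]
      | smul r a _ ha => rw [map_smul, map_smul, ha rfl, smul_zero]
  · have h1 : φ (D.mono (fun i => β i) * D.f g * D.s π) = D.mono (fun i => β i) * D.f g * D.s π := by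
      rw [hφ, hΨ, D.chiExpand_single_of_lt c fun i => (β i).2]
    rw [LinearMap.comp_apply, LinearMap.comp_apply, LinearEquiv.coe_coe,
      (LinearEquiv.symm_apply_eq φ).2 h1.symm, hΨ]
    funext γ
    rw [hR, Finsupp.single_apply, Pi.single_apply]
    refine if_congr ?_ rfl rfl
    constructor
    · intro h; funext i; exact Fin.ext (congrFun h i).symm
    · rintro rfl; rfl

end AffineWreathData

namespace AffineWreathData

variable {k F : Type*} [CommRing k] [Ring F] [Algebra k F] {n : ℕ} [NeZero n]
  {t : Fin n → Fin n → TensorPow k F n} {A : Type*} [Ring A] [Algebra k A]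
  (D : AffineWreathData t A) {d : ℕ} {c : Fin d → TensorPow k F n}

/-- The two-sided ideal generated by `∏_j (x_1 - c_j)` is the right ideal generated by its
conjugates. -/
theorem mem_span_chi_iff (ht : IsTeleporter t)
    (hc : ∀ j π, π 0 = 0 → permAct π (c j) = c j) (hf : ∀ j g, Commute (c j) g) (a : A) :
    a ∈ TwoSidedIdeal.span {D.chi c 0} ↔ a ∈ D.chiSpan c * ⊤ := by
  constructor
  · intro h
    induction h using TwoSidedIdeal.span_induction with
    | mem a ha =>
      rw [Set.mem_singleton_iff.1 ha, ← mul_one (D.chi c 0)]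
      exact Submodule.mul_mem_mul (D.chi_mem 0) trivial
    | zero => exact zero_mem _
    | add a b _ _ ha hb => exact add_mem ha hb
    | neg a _ ha => exact neg_mem ha
    | left_absorb b a _ ha =>
      obtain ⟨m, hm⟩ := D.exists_mem_filt ht b
      have h1 := Submodule.mul_mem_mul hm ha
      rw [← mul_assoc] at h1
      have h2 := mul_le_mul_left (D.filt_mul_chiSpan ht hc hf m) _ h1
      rw [mul_assoc] at h2
      exact (mul_le_mul_right le_top _ : _ ≤ D.chiSpan c * ⊤) h2
    | right_absorb b a _ ha =>
      have h1 := Submodule.mul_mem_mul ha (Submodule.mem_top (x := b))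
      rw [mul_assoc] at h1
      exact (mul_le_mul_right le_top _ : _ ≤ D.chiSpan c * ⊤) h1
  · intro h
    induction h using Submodule.mul_induction_on' with
    | mem_mul_mem a ha b _ =>
      apply TwoSidedIdeal.mul_mem_right
      induction ha using Submodule.span_induction with
      | mem a ha =>
        obtain ⟨i, rfl⟩ := ha
        have h1 := D.s_chi ht hc (Equiv.swap 0 i) 0
        have h2 : D.chi c i = D.s (Equiv.swap 0 i) * D.chi c 0 * D.s (Equiv.swap 0 i)⁻¹ := by
          rw [h1, Equiv.swap_apply_left, mul_assoc, s_mul_s_inv, mul_one]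
        rw [h2]
        exact TwoSidedIdeal.mul_mem_right _ _ _ (TwoSidedIdeal.mul_mem_left _ _ _
          (TwoSidedIdeal.subset_span rfl))
      | zero => exact zero_mem _
      | add a b _ _ ha hb => exact add_mem ha hb
      | smul r a _ ha =>
        rw [Algebra.smul_def]
        exact TwoSidedIdeal.mul_mem_left _ _ _ ha
    | add a _ b _ ha hb => exact add_mem ha hb

end AffineWreathData

/-! ### The generators of the affine wreath product algebra and of its cyclotomic quotients -/

section Concrete

variable {k F : Type*} [CommRing k] [Ring F] [Algebra k F] {n : ℕ} {κ : Type*} [Fintype κ]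
  {b b' : κ → F}

open AffineWreath

theorem mkAlgHom_rel {p q : FreeAlgebra k (Gen k F n)} (h : Rel b b' p q) :
    RingQuot.mkAlgHom k (Rel b b') p = RingQuot.mkAlgHom k (Rel b b') q :=
  RingQuot.mkAlgHom_rel k h

theorem adjoin_gen :
    Algebra.adjoin k (Set.range (gen (k := k) (n := n) b b')) = ⊤ := by
  have h := congrArg (Subalgebra.map (RingQuot.mkAlgHom k (Rel b b'))) (FreeAlgebra.adjoin_range_ι k
    (Gen k F n))
  rw [AlgHom.map_adjoin, ← Set.range_comp, Algebra.map_top,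
    (AlgHom.range_eq_top _).2 (RingQuot.mkAlgHom_surjective k _)] at h
  exact h

variable (b b') in
/-- The homomorphism `F^{⊗ n} → 𝒜_n(F)`. -/
def ofTensorHom : TensorPow k F n →ₐ[k] AffineWreath k n b b' :=
  AlgHom.ofLinearMap
    { toFun := ofTensor b b'
      map_add' := fun f g => (mkAlgHom_rel (.f_add f g)).trans (map_add _ _ _)
      map_smul' := fun r f => (mkAlgHom_rel (.f_smul r f)).trans (map_smul _ _ _) }
    ((mkAlgHom_rel .f_one).trans (map_one _))
    (fun f g => (mkAlgHom_rel (.f_mul f g)).trans (map_mul _ _ _))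

/-- The generators of `𝒜_n(F)`. -/
def affineData (ht : IsTeleporter (k := k) (n := n) (tElem b b')) :
    AffineWreathData (k := k) (n := n) (tElem b b') (AffineWreath k n b b') where
  x := X k b b'
  f := ofTensorHom b b'
  s :=
    { toFun := ofPerm k b b'
      map_one' := (mkAlgHom_rel .s_one).trans (map_one _)
      map_mul' := fun f g => (mkAlgHom_rel (.s_mul f g)).trans (map_mul _ _ _) }
  x_comm i j := ((map_mul _ _ _).symm.trans (mkAlgHom_rel (.x_comm i j))).trans (map_mul _ _ _)
  f_x g i := ((map_mul _ _ _).symm.trans (mkAlgHom_rel (.f_x g i))).trans (map_mul _ _ _)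
  s_f π g := ((map_mul _ _ _).symm.trans (mkAlgHom_rel (.s_f π g))).trans (map_mul _ _ _)
  adj_x i hi j := by
    have h1 : ofPerm k b b' (adjSwap i hi) * X k b b' ⟨i, Nat.lt_of_succ_lt hi⟩ =
        X k b b' ⟨i + 1, hi⟩ * ofPerm k b b' (adjSwap i hi) -
          ofTensor b b' (tElem b b' ⟨i, Nat.lt_of_succ_lt hi⟩ ⟨i + 1, hi⟩) := by
      have := mkAlgHom_rel (Rel.s_x (k := k) (b := b) (b' := b') i hi)
      rwa [map_mul, map_sub, map_mul] at this
    change ofPerm k b b' (adjSwap i hi) * X k b b' j = X k b b' (adjSwap i hi j) *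
      ofPerm k b b' (adjSwap i hi) + ofTensorHom b b' (adjElem (tElem b b') i hi j)
    by_cases h2 : (j : ℕ) = i
    · obtain rfl : j = ⟨i, Nat.lt_of_succ_lt hi⟩ := Fin.ext h2
      rw [adjElem_left, map_neg, Equiv.swap_apply_left, h1, sub_eq_add_neg]
      rfl
    by_cases h3 : (j : ℕ) = i + 1
    -- The rule for s_i x_{i+1} is not a defining relation. It follows by multiplying the rule for
    -- s_i x_i by s_i on both sides, since s_i² = 1 and s_i commutes with t_{i,i+1}.
    · obtain rfl : j = ⟨i + 1, hi⟩ := Fin.ext h3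
      rw [adjElem_right ht, Equiv.swap_apply_right]
      have hss : ofPerm k b b' (adjSwap i hi) * ofPerm k b b' (adjSwap i hi) = 1 := by
        have h4 := (mkAlgHom_rel (Rel.s_mul (k := k) (b := b) (b' := b') (adjSwap i hi)
          (adjSwap i hi))).trans (map_mul _ _ _)
        rw [Equiv.swap_mul_self] at h4
        exact h4.symm.trans ((mkAlgHom_rel .s_one).trans (map_one _))
      have hsf : ofPerm k b b' (adjSwap i hi) *
          ofTensor b b' (tElem b b' ⟨i, Nat.lt_of_succ_lt hi⟩ ⟨i + 1, hi⟩) =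
          ofTensor b b' (tElem b b' ⟨i, Nat.lt_of_succ_lt hi⟩ ⟨i + 1, hi⟩) *
          ofPerm k b b' (adjSwap i hi) := by
        have h4 := ((map_mul _ _ _).symm.trans (mkAlgHom_rel (Rel.s_f (k := k) (b := b) (b' := b')
          (adjSwap i hi) (tElem b b' ⟨i, Nat.lt_of_succ_lt hi⟩ ⟨i + 1, hi⟩)))).trans (map_mul _ _ _)
        rw [ht.perm, Equiv.swap_apply_left, Equiv.swap_apply_right,
          ht.symm ⟨i + 1, hi⟩ ⟨i, Nat.lt_of_succ_lt hi⟩ (by simp)] at h4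
        exact h4
      have h5 := congrArg (fun z => ofPerm k b b' (adjSwap i hi) * z *
        ofPerm k b b' (adjSwap i hi)) h1
      rw [← mul_assoc, hss, one_mul, mul_sub, sub_mul, hsf, mul_assoc (ofPerm k b b' _),
        mul_assoc (X k b b' _), hss, mul_one, mul_assoc (ofTensor b b' _), hss, mul_one] at h5
      exact eq_add_of_sub_eq h5.symm
    · rw [adjElem_of_ne i hi j h2 h3, map_zero, add_zero,
        Equiv.swap_apply_of_ne_of_ne (fun h => h2 (by rw [h])) (fun h => h3 (by rw [h]))]
      exact ((map_mul _ _ _).symm.trans (mkAlgHom_rel (.s_x_of_ne i hi j h2 h3))).trans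
        (map_mul _ _ _)
  adjoin := by
    rw [← top_le_iff, ← adjoin_gen]
    refine Algebra.adjoin_mono ?_
    rintro _ ⟨g | g | g, rfl⟩
    · exact Or.inl (Or.inl ⟨g, rfl⟩)
    · exact Or.inl (Or.inr ⟨g, rfl⟩)
    · exact Or.inr ⟨g, rfl⟩

end Concrete

end AffWr

namespace AffWr

open PiTensorProduct

/-! ### Truncated polynomial bases -/

section Truncated

variable {k F : Type*} [CommRing k] [Ring F] [Algebra k F] {n : ℕ}
  {t : Fin n → Fin n → TensorPow k F n} {A : Type*} [Ring A] [Algebra k A]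

/-- The elements `x^α f π` with `α_i < d` behave as in a cyclotomic quotient of level `d`. -/
structure TruncatedBasis (D : AffineWreathData t A) (d : ℕ) where
  coord : A ≃ₗ[k] ((Fin n → Fin d) → WreathMod k F n)
  coord_apply : ∀ (β : Fin n → Fin d) (g : TensorPow k F n) (π : Equiv.Perm (Fin n)),
    coord (D.mono (fun i => β i) * D.f g * D.s π) = Pi.single β (Pi.single π g)
  x_pow_mem : ∀ i, D.x i ^ d ∈ D.filtLt d

namespace AffineWreathData

variable (D : AffineWreathData t A) {A' : Type*} [Ring A'] [Algebra k A'] (q : A →ₐ[k] A')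
  (hq : Function.Surjective q)

theorem map_mono (α : Fin n → ℕ) : (D.map q hq).mono α = q (D.mono α) := by
  rw [mono, mono, map_list_prod, List.map_ofFn]
  congr 2
  funext i
  exact (map_pow q _ _).symm

theorem map_filt (m : ℕ) : (D.filt m).map q.toLinearMap = (D.map q hq).filt m := by
  have h1 : D.linPart.map q.toLinearMap = (D.map q hq).linPart := by
    rw [linPart, linPart, Submodule.map_span, Set.image_union, Set.image_singleton,
      ← Set.range_comp]
    congr 2
    exact congrArg _ (map_one q)
  have h2 : D.wreath.map q.toLinearMap = (D.map q hq).wreath := by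
    rw [wreath, wreath, Submodule.map_span]
    congr 1
    ext a
    constructor
    · rintro ⟨_, ⟨g, π, rfl⟩, rfl⟩
      exact ⟨g, π, map_mul q _ _⟩
    · rintro ⟨g, π, rfl⟩
      exact ⟨_, ⟨g, π, rfl⟩, map_mul q _ _⟩
  rw [filt, filt, Submodule.map_mul, Submodule.map_pow, h1, h2]

theorem map_mem_filtLt {m : ℕ} {a : A} (ha : a ∈ D.filtLt m) : q a ∈ (D.map q hq).filtLt m := by
  cases m with
  | zero =>
    rw [(Submodule.mem_bot k).1 ha, map_zero]
    exact zero_mem _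
  | succ m =>
    have : q a ∈ (D.filt m).map q.toLinearMap := ⟨a, ha, rfl⟩
    rwa [D.map_filt q hq] at this

variable {d : ℕ} [NeZero n] {c : Fin d → TensorPow k F n}

/-- A quotient by the ideal generated by `∏_j (x_1 - c_j)` has a truncated polynomial basis. -/
theorem exists_truncatedBasis (ht : IsTeleporter t) (Ψ : A →ₗ[k] ((Fin n → ℕ) →₀ WreathMod k F n))
    (hΨ : ∀ α g π, Ψ (D.mono α * D.f g * D.s π) = Finsupp.single α (Pi.single π g))
    (hc : ∀ j π, π 0 = 0 → permAct π (c j) = c j) (hf : ∀ j g, Commute (c j) g)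
    (hker : ∀ a, q a = 0 ↔ a ∈ TwoSidedIdeal.span {D.chi c 0}) :
    Nonempty (TruncatedBasis (D.map q hq) d) := by
  obtain ⟨E, hE, hEm⟩ := D.exists_truncated_coord Ψ hΨ ht hc hf
  have hker' : ∀ a, q a = 0 ↔ a ∈ D.chiSpan c * ⊤ := fun a =>
    (hker a).trans (D.mem_span_chi_iff ht hc hf a)
  have hkk : LinearMap.ker q.toLinearMap = LinearMap.ker E := by
    ext a
    exact (hker' a).trans (hE a).symm
  have hEs : Function.Surjective E := by
    intro v
    refine ⟨∑ β, ∑ π, D.mono (fun i => β i) * D.f (v β π) * D.s π, ?_⟩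
    simp only [map_sum, hEm]
    funext β π
    simp only [Finset.sum_apply]
    rw [Finset.sum_eq_single β, Finset.sum_eq_single π]
    · simp
    · intro σ _ h; simp [h.symm]
    · simp
    · intro γ _ h; simp [h.symm]
    · simp
  let e : A' ≃ₗ[k] ((Fin n → Fin d) → WreathMod k F n) :=
    (q.toLinearMap.quotKerEquivOfSurjective hq).symm ≪≫ₗ
      Submodule.quotEquivOfEq _ _ hkk ≪≫ₗ E.quotKerEquivOfSurjective hEs
  have he : ∀ a, e (q a) = E a := fun a => by
    have : (q.toLinearMap.quotKerEquivOfSurjective hq).symm (q a) = Submodule.Quotient.mk a := by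
      rw [LinearEquiv.symm_apply_eq]; rfl
    simp only [e, LinearEquiv.trans_apply, this]
    rfl
  refine ⟨⟨e, fun β g π => ?_, fun i => ?_⟩⟩
  · rw [← hEm, ← he, map_mul q, map_mul q, map_mono]
    rfl
  · have h1 := D.map_mem_filtLt q hq (D.chi_sub_mem ht c i)
    have h2 : q (D.chi c i) = 0 := by
      rw [hker', ← mul_one (D.chi c i)]
      exact Submodule.mul_mem_mul (D.chi_mem i) trivial
    rw [map_sub, h2, zero_sub, neg_mem_iff, map_pow] at h1
    exact h1

end AffineWreathData

end Truncated

/-! ### The basis of the cyclotomic quotient -/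

section Concrete

variable {k F : Type*} [CommRing k] [Ring F] [Algebra k F] {n : ℕ} [NeZero n] {κ : Type*}
  [Fintype κ] {b b' : κ → F} {d : ℕ} (c : Fin d → TensorPow k F n)

variable (b b') in
/-- The projection `𝒜_n(F) → 𝒜_n^C(F)` as a homomorphism of algebras. -/
def projHom : AffineWreath k n b b' →ₐ[k] Cyclotomic b b' c :=
  AlgHom.ofLinearMap (Cyclotomic.proj b b' c) rfl fun _ _ => rfl

theorem projHom_surjective : Function.Surjective (projHom b b' c) :=
  Quotient.mk_surjective

/-- The generators of `𝒜_n^C(F)`. -/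
def cycData (ht : IsTeleporter (k := k) (n := n) (tElem b b')) :
    AffineWreathData (k := k) (n := n) (tElem b b') (Cyclotomic b b' c) :=
  (affineData ht).map (projHom b b' c) (projHom_surjective c)

theorem projHom_eq_zero_iff (a : AffineWreath k n b b') :
    projHom b b' c a = 0 ↔ a ∈ AffineWreath.cycIdeal b b' c := by
  rw [TwoSidedIdeal.mem_iff]
  exact RingCon.eq _

theorem chi_eq (ht : IsTeleporter (k := k) (n := n) (tElem b b')) :
    (affineData ht).chi c 0 = AffineWreath.chi b b' c := AffineWreathData.chi_zero _ _

theorem exists_cyc_truncatedBasis (ht : IsTeleporter (k := k) (n := n) (tElem b b'))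
    (hc : ∀ j π, π 0 = 0 → permAct π (c j) = c j) (hf : ∀ j g, Commute (c j) g) :
    Nonempty (TruncatedBasis (cycData c ht) d) := by
  refine (affineData ht).exists_truncatedBasis (c := c) _ _ ht (pbwCoord ht) (pbwCoord_apply ht)
    hc hf fun a => ?_
  rw [projHom_eq_zero_iff, AffineWreath.cycIdeal, chi_eq]

end Concrete

end AffWr

namespace AffWr

open PiTensorProduct

/-! ### The symmetrizing form -/

namespace AffineWreathData

variable {k F : Type*} [CommRing k] [Ring F] [Algebra k F] {n : ℕ}
  {t : Fin n → Fin n → TensorPow k F n} {A : Type*} [Ring A] [Algebra k A]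
  (D : AffineWreathData t A)

theorem mono_const (m : ℕ) : D.mono (fun _ => m) = D.mono (fun _ => 1) ^ m := by
  induction m with
  | zero => rw [pow_zero]; exact D.mono_zero
  | succ m ih => rw [pow_succ, ← ih, ← D.mono_add]; rfl

theorem commute_s_mono_const (ht : IsTeleporter t) (π : Equiv.Perm (Fin n)) (m : ℕ) :
    Commute (D.s π) (D.mono fun _ => m) := by
  rw [mono_const]
  refine Commute.pow_right ?_ m
  induction π using perm_induction with
  | one => rw [map_one]; exact Commute.one_left _
  | mul i hi π ih =>
    rw [map_mul]
    refine Commute.mul_left ?_ ih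
    set a : Fin n := ⟨i, Nat.lt_of_succ_lt hi⟩ with ha
    set b : Fin n := ⟨i + 1, hi⟩ with hb
    have hab : a ≠ b := by simp [ha, hb]
    have hsplit : (fun _ => 1 : Fin n → ℕ) =
        Pi.single a 1 + (Pi.single b 1 + fun j => if j = a ∨ j = b then 0 else 1) := by
      funext j
      by_cases h1 : j = a
      · subst h1; simp [hab]
      · by_cases h2 : j = b
        · subst h2; simp [h1]
        · simp [h1, h2]
    rw [hsplit, D.mono_add, D.mono_add, D.mono_single, D.mono_single, pow_one, pow_one, ← mul_assoc]
    refine Commute.mul_right ?_ ?_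
    -- The two corrections -t x_{i+1} and x_{i+1} t cancel.
    · have h1 := D.adj_x i hi a
      have h2 := D.adj_x i hi b
      rw [adjElem_left, Equiv.swap_apply_left, map_neg] at h1
      rw [adjElem_right ht, Equiv.swap_apply_right] at h2
      rw [Commute, SemiconjBy, ← mul_assoc, h1, add_mul, mul_assoc, h2, mul_add, neg_mul, D.f_x,
        ← mul_assoc, D.x_comm, mul_assoc]
      abel
    · refine commute_prod_ofFn _ _ fun j => ?_
      dsimp only
      by_cases h : j = a ∨ j = b
      · rw [if_pos h, pow_zero]; exact Commute.one_right _
      · rw [if_neg h, pow_one]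
        push Not at h
        have h1 := D.adj_x i hi j
        rwa [adjElem_of_ne i hi j (fun h' => h.1 (Fin.ext h')) (fun h' => h.2 (Fin.ext h')),
          map_zero, add_zero, Equiv.swap_apply_of_ne_of_ne h.1 h.2] at h1

/-- The monomials with all exponents equal are central. -/
theorem commute_mono_const (ht : IsTeleporter t) (a : A) (m : ℕ) :
    Commute a (D.mono fun _ => m) := by
  induction a using D.alg_induction with
  | x i => exact D.commute_x_mono i _
  | f g => exact D.commute_f_mono g _
  | s π => exact D.commute_s_mono_const ht π m
  | add a b ha hb => exact ha.add_left hb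
  | mul a b ha hb => exact ha.mul_left hb

theorem s_mul_mono_mul (g h : TensorPow k F n) (π σ : Equiv.Perm (Fin n)) :
    D.f g * D.s π * (D.f h * D.s σ) = D.f (g * permAct π h) * D.s (π * σ) := by
  rw [mul_assoc, ← mul_assoc (D.s π), D.s_f, mul_assoc, ← map_mul, ← mul_assoc, ← map_mul]

end AffineWreathData

namespace TruncatedBasis

variable {k F : Type*} [CommRing k] [Ring F] [Algebra k F] {n : ℕ}
  {t : Fin n → Fin n → TensorPow k F n} {A : Type*} [Ring A] [Algebra k A]
  {D : AffineWreathData t A} {d : ℕ} (T : TruncatedBasis D d)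

include T in
theorem mono_mem_filtLt (ht : IsTeleporter t) {α : Fin n → ℕ} (h : ∃ i, d ≤ α i) {m : ℕ}
    (hm : ∑ i, α i ≤ m) : D.mono α ∈ D.filtLt m := by
  obtain ⟨i, hi⟩ := h
  rw [← AffineWreathData.sub_single_add hi, add_comm, D.mono_add, D.mono_single]
  refine D.filtLt_mono hm (D.mul_mem_filtLt_left ht (T.x_pow_mem i)
    (D.linPart_pow_le_filt _ (D.mono_mem_linPart_pow _ le_rfl)) ?_)
  conv_rhs => rw [← AffineWreathData.sub_single_add hi]
  simp [Finset.sum_add_distrib, add_comm]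

include T in
theorem mono_mul_mem_filtLt (ht : IsTeleporter t) {α : Fin n → ℕ} (h : ∃ i, d ≤ α i) {m : ℕ}
    (hm : ∑ i, α i ≤ m) (g : TensorPow k F n) (π : Equiv.Perm (Fin n)) :
    D.mono α * D.f g * D.s π ∈ D.filtLt m := by
  rw [mul_assoc]
  refine D.mul_mem_filtLt_left ht (T.mono_mem_filtLt ht h hm) ?_ (add_zero m)
  rw [D.filt_zero]
  exact D.f_mul_s_mem g π

-- A monomial with an exponent ≥ d drops in filtration because x_i^d does; induction on degree
-- removes all of them.
include T in
theorem filt_le_span_lt (ht : IsTeleporter t) (m : ℕ) :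
    D.filt m ≤ Submodule.span k
      {a | ∃ (α : Fin n → ℕ) (g : TensorPow k F n) (π : Equiv.Perm (Fin n)),
        (∀ i, α i < d) ∧ ∑ i, α i ≤ m ∧ a = D.mono α * D.f g * D.s π} := by
  induction m with
  | zero =>
    refine (D.filt_le_span 0).trans (Submodule.span_le.2 ?_)
    rintro _ ⟨α, g, π, hα, rfl⟩
    -- In degree zero this forces d = 0, and the monomial then lies in `filtLt 0`, which is ⊥.
    by_cases h : ∃ i, d ≤ α i
    · have := T.mono_mul_mem_filtLt ht h hα g π
      rw [(Submodule.mem_bot k).1 this]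
      exact zero_mem _
    · push Not at h
      exact Submodule.subset_span ⟨α, g, π, h, hα, rfl⟩
  | succ m ih =>
    refine (D.filt_le_span (m + 1)).trans (Submodule.span_le.2 ?_)
    rintro _ ⟨α, g, π, hα, rfl⟩
    by_cases h : ∃ i, d ≤ α i
    · refine Submodule.span_mono ?_ (ih (T.mono_mul_mem_filtLt ht h hα g π))
      rintro _ ⟨α, g, π, hlt, hα, rfl⟩
      exact ⟨α, g, π, hlt, by omega, rfl⟩
    · push Not at h
      exact Submodule.subset_span ⟨α, g, π, h, hα, rfl⟩

theorem coord_symm_single (β : Fin n → Fin d) (g : TensorPow k F n) (π : Equiv.Perm (Fin n)) :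
    T.coord.symm (Pi.single β (Pi.single π g)) = D.mono (fun i => β i) * D.f g * D.s π := by
  rw [LinearEquiv.symm_apply_eq, T.coord_apply]

theorem coord_symm_apply (w : (Fin n → Fin d) → WreathMod k F n) :
    T.coord.symm w = ∑ β, ∑ π, D.mono (fun i => β i) * D.f (w β π) * D.s π := by
  simp only [← T.coord_symm_single, ← map_sum]
  congr 1
  funext β π
  simp only [Finset.sum_apply]
  rw [Finset.sum_eq_single β, Finset.sum_eq_single π]
  · simp
  · intro σ _ h; simp [h.symm]
  · simp
  · intro γ _ h; simp [h.symm]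
  · simp

theorem coord_symm_mem_filtLt (w : (Fin n → Fin d) → WreathMod k F n) (m : ℕ)
    (hw : ∀ β π, m ≤ ∑ i, (β i : ℕ) → w β π = 0) : T.coord.symm w ∈ D.filtLt m := by
  rw [coord_symm_apply]
  refine Submodule.sum_mem _ fun β _ => Submodule.sum_mem _ fun π _ => ?_
  by_cases h : m ≤ ∑ i, (β i : ℕ)
  · rw [hw β π h, map_zero, mul_zero, zero_mul]
    exact zero_mem _
  · rw [mul_assoc]
    exact D.filt_le_filtLt (not_le.1 h) (D.mono_mul_mem_filt le_rfl (D.f_mul_s_mem _ _))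

theorem sum_lt_top {α : Fin n → ℕ} (h : ∀ i, α i < d) (hne : α ≠ fun _ => d - 1) :
    ∑ i, α i < n * (d - 1) := by
  have h1 : ∑ i : Fin n, α i < ∑ _i : Fin n, (d - 1) := by
    obtain ⟨j, hj⟩ := Function.ne_iff.1 hne
    exact Finset.sum_lt_sum (fun i _ => by have := h i; omega)
      ⟨j, Finset.mem_univ j, by have := h j; omega⟩
  simpa using h1

/-- The form with value `tr^{⊗ n}(f)` on `x_1^{d-1} ⋯ x_n^{d-1} f` and zero on the other basis
elements. -/
def form (hd : 0 < d) (tr : F →ₗ[k] k) : A →ₗ[k] k :=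
  trTensor n tr ∘ₗ LinearMap.proj 1 ∘ₗ LinearMap.proj (fun _ => ⟨d - 1, Nat.sub_one_lt_of_lt hd⟩) ∘ₗ
    T.coord.toLinearMap

variable (hd : 0 < d) (tr : F →ₗ[k] k)

theorem form_apply_of_lt {α : Fin n → ℕ} (h : ∀ i, α i < d) (g : TensorPow k F n)
    (π : Equiv.Perm (Fin n)) : T.form hd tr (D.mono α * D.f g * D.s π) =
      if (∀ i, α i = d - 1) ∧ π = 1 then trTensor n tr g else 0 := by
  have h1 := T.coord_apply (fun i => ⟨α i, h i⟩) g π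
  dsimp only at h1
  rw [form, LinearMap.comp_apply, LinearMap.comp_apply, LinearMap.comp_apply, LinearEquiv.coe_coe,
    h1, LinearMap.proj_apply, LinearMap.proj_apply]
  by_cases h2 : ∀ i, α i = d - 1
  · have h3 : (fun i => ⟨α i, h i⟩ : Fin n → Fin d) =
        fun _ => ⟨d - 1, Nat.sub_one_lt_of_lt hd⟩ := funext fun i => Fin.ext (h2 i)
    rw [h3, Pi.single_eq_same]
    by_cases h4 : π = 1
    · subst h4
      rw [Pi.single_eq_same, if_pos ⟨h2, rfl⟩]
    · rw [Pi.single_eq_of_ne (Ne.symm h4), if_neg fun h => h4 h.2, map_zero]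
  · rw [if_neg fun h => h2 h.1, Pi.single_eq_of_ne]
    · exact map_zero _
    · intro h3
      exact h2 fun i => (congrArg Fin.val (congrFun h3 i)).symm

/-- Among reduced monomials the exponent (d-1, …, d-1) has degree exactly n(d-1). This permits
discarding lower-order corrections throughout. -/
theorem form_eq_zero (ht : IsTeleporter t) {a : A} (ha : a ∈ D.filtLt (n * (d - 1))) :
    T.form hd tr a = 0 := by
  cases hN : n * (d - 1) with
  | zero =>
    rw [hN] at ha
    rw [(Submodule.mem_bot k).1 ha, map_zero]
  | succ m =>
    rw [hN] at ha
    have hle := T.filt_le_span_lt ht m ha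
    clear ha
    induction hle using Submodule.span_induction with
    | mem a h =>
      obtain ⟨α, g, π, hlt, hα, rfl⟩ := h
      rw [form_apply_of_lt T hd tr hlt, if_neg]
      rintro ⟨h, -⟩
      rw [Finset.sum_congr rfl fun i _ => h i] at hα
      simp at hα
      omega
    | zero => exact map_zero _
    | add a b _ _ ha hb => rw [map_add, ha, hb, add_zero]
    | smul r a _ ha => rw [map_smul, ha, smul_zero]

/-- The formula persists for exponents ≥ d as long as the degree is at most n(d-1), since such
monomials fall into lower filtration. -/
theorem form_apply (ht : IsTeleporter t) {α : Fin n → ℕ} (h : ∑ i, α i ≤ n * (d - 1))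
    (g : TensorPow k F n) (π : Equiv.Perm (Fin n)) : T.form hd tr (D.mono α * D.f g * D.s π) =
      if (∀ i, α i = d - 1) ∧ π = 1 then trTensor n tr g else 0 := by
  by_cases h1 : ∃ i, d ≤ α i
  · rw [T.form_eq_zero hd tr ht (T.mono_mul_mem_filtLt ht h1 h g π), if_neg]
    rintro ⟨h2, -⟩
    obtain ⟨i, hi⟩ := h1
    have := h2 i
    omega
  · push Not at h1
    exact T.form_apply_of_lt hd tr h1 g π

include T in
theorem mem_span_lt (ht : IsTeleporter t) (a : A) : a ∈ Submodule.span k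
      {a | ∃ (α : Fin n → ℕ) (g : TensorPow k F n) (π : Equiv.Perm (Fin n)),
        (∀ i, α i < d) ∧ a = D.mono α * D.f g * D.s π} := by
  obtain ⟨m, hm⟩ := D.exists_mem_filt ht a
  refine Submodule.span_mono ?_ (T.filt_le_span_lt ht m hm)
  rintro _ ⟨α, g, π, h, -, rfl⟩
  exact ⟨α, g, π, h, rfl⟩

include T in
/-- Linear maps agree if they agree on the monomial basis. -/
theorem hom_ext (ht : IsTeleporter t) {M : Type*} [AddCommGroup M] [Module k M] {φ ψ : A →ₗ[k] M}
    (h : ∀ (α : Fin n → ℕ) (g : TensorPow k F n) (π : Equiv.Perm (Fin n)), (∀ i, α i < d) →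
      φ (D.mono α * D.f g * D.s π) = ψ (D.mono α * D.f g * D.s π)) : φ = ψ := by
  ext a
  induction T.mem_span_lt ht a using Submodule.span_induction with
  | mem a ha =>
    obtain ⟨α, g, π, hlt, rfl⟩ := ha
    exact h α g π hlt
  | zero => rw [map_zero, map_zero]
  | add a b _ _ ha hb => rw [map_add, map_add, ha, hb]
  | smul r a _ ha => rw [map_smul, map_smul, ha]

/-! #### Symmetry -/

variable {tr}

/-- On F^{⊗n} ⋊ S_n the form f π ↦ δ_{π,1} tr^{⊗n}(f) is symmetric, because tr^{⊗n} is symmetric and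
S_n-invariant. -/
theorem form_mono_mul_emb_comm (ht : IsTeleporter t)
    (htr : ∀ f g : TensorPow k F n, trTensor n tr (f * g) = trTensor n tr (g * f)) {u v : A}
    (hu : u ∈ D.wreath) (hv : v ∈ D.wreath) :
    T.form hd tr (D.mono (fun _ => d - 1) * (u * v)) =
      T.form hd tr (D.mono (fun _ => d - 1) * (v * u)) := by
  induction hu using Submodule.span_induction with
  | mem u hu =>
    induction hv using Submodule.span_induction with
    | mem v hv =>
      obtain ⟨g, π, rfl⟩ := hu
      obtain ⟨h, σ, rfl⟩ := hv
      rw [D.s_mul_mono_mul, D.s_mul_mono_mul, ← mul_assoc, ← mul_assoc,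
        T.form_apply hd tr ht (by simp), T.form_apply hd tr ht (by simp)]
      by_cases hπ : π * σ = 1
      · obtain rfl : σ = π⁻¹ := eq_inv_of_mul_eq_one_right hπ
        rw [if_pos ⟨fun _ => rfl, hπ⟩, if_pos ⟨fun _ => rfl, inv_mul_cancel π⟩,
          ← trTensor_permAct π⁻¹, permAct_mul, permAct_permAct, inv_mul_cancel, one_permAct, htr]
      · rw [if_neg fun h => hπ h.2, if_neg fun h => hπ (mul_eq_one_comm.1 h.2)]
    | zero => rw [mul_zero, zero_mul]
    | add a b _ _ ha hb => simp only [mul_add, add_mul, map_add, ha, hb]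
    | smul r a _ ha => simp only [mul_smul_comm, smul_mul_assoc, map_smul, ha]
  | zero => rw [mul_zero, zero_mul]
  | add a b _ _ ha hb => simp only [mul_add, add_mul, map_add, ha, hb]
  | smul r a _ ha => simp only [mul_smul_comm, smul_mul_assoc, map_smul, ha]

include T in
theorem exists_top_add (ht : IsTeleporter t) (a : A) :
    ∃ u ∈ D.wreath, a - D.mono (fun _ => d - 1) * u ∈ D.filtLt (n * (d - 1)) := by
  induction T.mem_span_lt ht a using Submodule.span_induction with
  | mem a ha =>
    obtain ⟨α, g, π, hlt, rfl⟩ := ha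
    by_cases h : α = fun _ => d - 1
    · refine ⟨D.f g * D.s π, D.f_mul_s_mem g π, ?_⟩
      rw [h, mul_assoc, sub_self]
      exact zero_mem _
    · refine ⟨0, zero_mem _, ?_⟩
      rw [mul_zero, sub_zero, mul_assoc]
      exact D.filt_le_filtLt (sum_lt_top hlt h) (D.mono_mul_mem_filt le_rfl (D.f_mul_s_mem g π))
  | zero => exact ⟨0, zero_mem _, by rw [mul_zero, sub_zero]; exact zero_mem _⟩
  | add a b _ _ ha hb =>
    obtain ⟨u, hu, hu'⟩ := ha
    obtain ⟨v, hv, hv'⟩ := hb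
    refine ⟨u + v, add_mem hu hv, ?_⟩
    rw [mul_add, add_sub_add_comm]
    exact add_mem hu' hv'
  | smul r a _ ha =>
    obtain ⟨u, hu, hu'⟩ := ha
    refine ⟨r • u, Submodule.smul_mem _ r hu, ?_⟩
    rw [mul_smul_comm, ← smul_sub]
    exact Submodule.smul_mem _ r hu'

/-- Modulo terms the form kills, a is (x_1⋯x_n)^{d-1} v with v in `wreath`, and the power is
central. -/
theorem form_mul_wreath_comm (ht : IsTeleporter t)
    (htr : ∀ f g : TensorPow k F n, trTensor n tr (f * g) = trTensor n tr (g * f)) (a : A) {u : A}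
    (hu : u ∈ D.wreath) : T.form hd tr (a * u) = T.form hd tr (u * a) := by
  obtain ⟨v, hv, h⟩ := T.exists_top_add ht a
  have hu0 : u ∈ D.filt 0 := by rwa [D.filt_zero]
  have h1 := T.form_eq_zero hd tr ht (D.mul_mem_filtLt_left ht h hu0 (add_zero _))
  have h2 := T.form_eq_zero hd tr ht (D.mul_mem_filtLt_right ht hu0 h (zero_add _))
  rw [sub_mul, map_sub, sub_eq_zero] at h1
  rw [mul_sub, map_sub, sub_eq_zero] at h2
  rw [h1, h2, mul_assoc, ← mul_assoc u, (D.commute_mono_const ht u (d - 1)).eq, mul_assoc]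
  exact T.form_mono_mul_emb_comm hd ht htr hv hu

theorem form_mul_x_comm (ht : IsTeleporter t)
    (htr : ∀ f g : TensorPow k F n, trTensor n tr (f * g) = trTensor n tr (g * f)) (a : A)
    (j : Fin n) : T.form hd tr (a * D.x j) = T.form hd tr (D.x j * a) := by
  have key : T.form hd tr ∘ₗ LinearMap.mulRight k (D.x j) =
      T.form hd tr ∘ₗ LinearMap.mulLeft k (D.x j) := by
    refine T.hom_ext ht fun α g π hlt => ?_
    rw [LinearMap.comp_apply, LinearMap.comp_apply, LinearMap.mulRight_apply,
      LinearMap.mulLeft_apply]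
    have hw0 : D.f g * D.s π ∈ D.filt 0 := by
      rw [D.filt_zero]; exact D.f_mul_s_mem g π
    by_cases htop : α = fun _ => d - 1
    · subst htop
      -- At the top exponent, multiplication by x_j is modulo lower degree multiplication by some u
      -- in `wreath`. The claim becomes symmetry on F^{⊗n} ⋊ S_n.
      obtain ⟨u, hu, hr⟩ := T.exists_top_add ht (D.mono (fun _ => d - 1) * D.x j)
      have h1 := T.form_eq_zero hd tr ht (D.mul_mem_filtLt_left ht hr hw0 (add_zero _))
      have h2 := T.form_eq_zero hd tr ht (D.mul_mem_filtLt_right ht hw0 hr (zero_add _))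
      rw [sub_mul, map_sub, sub_eq_zero] at h1
      rw [mul_sub, map_sub, sub_eq_zero] at h2
      have h3 : D.mono (fun _ => d - 1) * D.f g * D.s π * D.x j =
          D.f g * D.s π * (D.mono (fun _ => d - 1) * D.x j) := by
        rw [← mul_assoc, (D.commute_mono_const ht (D.f g * D.s π) (d - 1)).eq]
        simp only [mul_assoc]
      have h4 : D.x j * (D.mono (fun _ => d - 1) * D.f g * D.s π) =
          D.mono (fun _ => d - 1) * D.x j * (D.f g * D.s π) := by
        rw [← (D.commute_x_mono j _).eq]
        simp only [mul_assoc]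
      rw [h3, h4, h1, h2, ← mul_assoc (D.f g * D.s π),
        (D.commute_mono_const ht (D.f g * D.s π) (d - 1)).eq, mul_assoc, mul_assoc _ u]
      exact T.form_mono_mul_emb_comm hd ht htr (D.f_mul_s_mem g π) hu
    -- Below the top, the correction from moving x_j past π is killed. Both sides are then values at
    -- monomials of degree at most n(d-1), which vanish unless π = 1 and coincide in that case.
    · have hlt' := sum_lt_top hlt htop
      have hα : D.mono α * D.f g * D.s π ∈ D.filt (∑ i, α i) := by
        rw [mul_assoc]
        exact D.mono_mul_mem_filt le_rfl (D.f_mul_s_mem g π)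
      have hsum : ∀ l, ∑ i, (α + Pi.single l 1 : Fin n → ℕ) i = ∑ i, α i + 1 := fun l => by
        simp [Finset.sum_add_distrib]
      have hx : D.x j * (D.mono α * D.f g * D.s π) =
          D.mono (α + Pi.single j 1) * D.f g * D.s π := by
        rw [D.mono_add, D.mono_single, pow_one, ← (D.commute_x_mono j α).eq]
        simp only [mul_assoc]
      have hx' : D.mono α * D.f g * D.s π * D.x j =
          D.mono (α + Pi.single (π j) 1) * D.f g * D.s π + D.mono α * (D.f g *
            (D.s π * D.x j - D.x (π j) * D.s π)) := by
        rw [D.mono_add, D.mono_single, pow_one, mul_sub, mul_sub, mul_assoc (D.mono α) (D.x _),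
          ← D.f_x]
        simp only [mul_assoc]
        abel
      have hu : T.form hd tr (D.mono α * (D.f g * (D.s π * D.x j - D.x (π j) * D.s π))) = 0 := by
        refine T.form_eq_zero hd tr ht (D.filt_le_filtLt hlt' (D.mono_mul_mem_filt le_rfl ?_))
        exact D.wreath_mul_wreath (Submodule.mul_mem_mul (D.f_mem g) (D.s_mul_x_sub_mem ht π j))
      rw [hx, hx', map_add, hu, add_zero,
        T.form_apply hd tr ht (by rw [hsum]; exact hlt'),
        T.form_apply hd tr ht (by rw [hsum]; exact hlt')]
      by_cases hπ : π = 1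
      · rw [hπ, Equiv.Perm.one_apply]
      · rw [if_neg fun h => hπ h.2, if_neg fun h => hπ h.2]
  exact LinearMap.congr_fun key a

/-- The b for which this holds for every a form a subalgebra, so generators suffice. -/
theorem form_comm (ht : IsTeleporter t)
    (htr : ∀ f g : TensorPow k F n, trTensor n tr (f * g) = trTensor n tr (g * f)) (a b : A) :
    T.form hd tr (a * b) = T.form hd tr (b * a) := by
  induction b using D.alg_induction generalizing a with
  | x j => exact T.form_mul_x_comm hd ht htr a j
  | f g => exact T.form_mul_wreath_comm hd ht htr a (D.f_mem g)
  | s π => exact T.form_mul_wreath_comm hd ht htr a (D.s_mem π)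
  | add b c hb hc => rw [mul_add, add_mul, map_add, map_add, hb, hc]
  | mul b c hb hc => rw [← mul_assoc, hc, ← mul_assoc, hb, mul_assoc]

/-! #### Non-degeneracy -/

/-- By symmetry the factor f σ⁻¹ can be moved to the right. The remaining exponent d-1-α+β has
degree at most n(d-1), so only β = α can contribute. -/
theorem form_dual (ht : IsTeleporter t)
    (htr : ∀ f g : TensorPow k F n, trTensor n tr (f * g) = trTensor n tr (g * f))
    (α : Fin n → Fin d) (β : Fin n → ℕ) (h : ∑ i, β i ≤ ∑ i, (α i : ℕ)) (f g : TensorPow k F n)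
    (σ π : Equiv.Perm (Fin n)) :
    T.form hd tr (D.f f * (D.s σ⁻¹ * D.mono (fun i => d - 1 - α i)) * (D.mono β * D.f g * D.s π)) =
      if (∀ i, β i = α i) ∧ π = σ then trTensor n tr (f * permAct σ⁻¹ g) else 0 := by
  have h1 : D.f f * (D.s σ⁻¹ * D.mono (fun i => d - 1 - α i)) * (D.mono β * D.f g * D.s π) =
      D.f f * D.s σ⁻¹ * (D.mono ((fun i => d - 1 - α i) + β) * (D.f g * D.s π)) := by
    rw [D.mono_add]; simp only [mul_assoc]
  rw [h1, T.form_comm hd ht htr, mul_assoc, D.s_mul_mono_mul, ← mul_assoc,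
    T.form_apply hd tr ht]
  · have h2 : (∀ i, ((fun i => d - 1 - α i) + β : Fin n → ℕ) i = d - 1) ↔ ∀ i, β i = α i := by
      refine forall_congr' fun i => ?_
      have := (α i).2
      simp only [Pi.add_apply]
      omega
    by_cases h3 : (∀ i, β i = α i) ∧ π = σ
    · rw [if_pos h3, if_pos ⟨h2.2 h3.1, mul_inv_eq_one.2 h3.2⟩, h3.2,
        ← trTensor_permAct σ⁻¹, permAct_mul, permAct_permAct, inv_mul_cancel, one_permAct, htr]
    · rw [if_neg h3, if_neg fun h => h3 ⟨h2.1 h.1, mul_inv_eq_one.1 h.2⟩]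
  · have h2 : ∑ i, (d - 1 - (α i : ℕ)) + ∑ i, (α i : ℕ) = n * (d - 1) := by
      rw [← Finset.sum_add_distrib, Finset.sum_congr rfl fun i _ => Nat.sub_add_cancel
        (Nat.le_sub_one_of_lt (α i).2)]
      simp
    simp only [Pi.add_apply, Finset.sum_add_distrib]
    omega

-- The elements f σ x^α with α_i < d and the x_i on the right also span.
include T in
theorem eq_zero_of_forall (ht : IsTeleporter t) (ξ : A →ₗ[k] k)
    (h : ∀ (f : TensorPow k F n) (σ : Equiv.Perm (Fin n)) (α : Fin n → ℕ), (∀ i, α i < d) →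
      ξ (D.f f * (D.s σ * D.mono α)) = 0) : ξ = 0 := by
  have key : ∀ m, D.filtLt m ≤ LinearMap.ker ξ := by
    intro m
    induction m with
    | zero => exact bot_le
    | succ m ih =>
      refine (D.linPart_pow_mul_wreath ht m).trans
        ((mul_le_mul_right (D.linPart_pow_le_span m) _).trans ?_)
      rw [AffineWreathData.wreath, Submodule.span_mul_span, Submodule.span_le]
      rintro _ ⟨_, ⟨g, π, rfl⟩, _, ⟨α, hα, rfl⟩, rfl⟩
      by_cases hlt : ∃ i, d ≤ α i
      · refine ih (D.mul_mem_filtLt_right ht ?_ (T.mono_mem_filtLt ht hlt hα) (zero_add m))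
        rw [D.filt_zero]
        exact D.f_mul_s_mem g π
      · dsimp only
        rw [mul_assoc]
        exact h g π α (by simpa using hlt)
  ext a
  obtain ⟨m, hm⟩ := D.exists_mem_filtLt ht a
  exact key m hm

variable (k F n) in
/-- The bilinear form `(f, g) ↦ tr^{⊗ n}(g f)`. -/
def tensorForm (tr : F →ₗ[k] k) : TensorPow k F n →ₗ[k] TensorPow k F n →ₗ[k] k :=
  (LinearMap.mul k (TensorPow k F n)).flip.compr₂ (trTensor n tr)

/-- A one-sided inverse, up to terms of lower degree, to `a ↦ (b ↦ form (b a))`. -/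
def dualMap (hb : Function.Bijective (tensorForm k F n tr)) : (A →ₗ[k] k) →ₗ[k] A :=
  T.coord.symm.toLinearMap ∘ₗ LinearMap.pi fun α => LinearMap.pi fun σ =>
    permLin σ ∘ₗ (LinearEquiv.ofBijective _ hb).symm.toLinearMap ∘ₗ
      LinearMap.lcomp k k
        (LinearMap.mulRight k (D.s σ⁻¹ * D.mono fun i => d - 1 - α i) ∘ₗ D.f.toLinearMap)

theorem coord_dualMap (hb : Function.Bijective (tensorForm k F n tr)) (ξ : A →ₗ[k] k)
    (α : Fin n → Fin d) (σ : Equiv.Perm (Fin n)) (g : TensorPow k F n)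
    (h : ∀ f, ξ (D.f f * (D.s σ⁻¹ * D.mono fun i => d - 1 - α i)) =
      trTensor n tr (f * permAct σ⁻¹ g)) : T.coord (T.dualMap hb ξ) α σ = g := by
  rw [dualMap, LinearMap.comp_apply, LinearEquiv.coe_coe, LinearEquiv.apply_symm_apply]
  change permAct σ ((LinearEquiv.ofBijective _ hb).symm _) = g
  rw [(LinearEquiv.symm_apply_eq _).2 (LinearMap.ext h :
    _ = LinearEquiv.ofBijective _ hb (permAct σ⁻¹ g)), permAct_permAct, mul_inv_cancel,
    one_permAct]

/-- `dualMap` records the values of a functional on the spanning set of `eq_zero_of_forall`.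
Complementing exponents and inverting permutations matches the two indexings. -/
theorem dualMap_injective (ht : IsTeleporter t)
    (hb : Function.Bijective (tensorForm k F n tr)) : Function.Injective (T.dualMap hb) := by
  rw [injective_iff_map_eq_zero]
  intro ξ hξ
  refine T.eq_zero_of_forall ht ξ fun f σ α hlt => ?_
  have h1 := congrFun (congrFun (congrArg T.coord hξ) fun i =>
    ⟨d - 1 - α i, by have := hlt i; omega⟩) σ⁻¹
  rw [map_zero, dualMap, LinearMap.comp_apply, LinearEquiv.coe_coe,
    LinearEquiv.apply_symm_apply] at h1
  have h2 := congrArg (permAct σ) h1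
  change permAct σ (permAct σ⁻¹ ((LinearEquiv.ofBijective _ hb).symm _)) = permAct σ 0 at h2
  rw [permAct_permAct, mul_inv_cancel, one_permAct, permAct_zero, LinearEquiv.symm_apply_eq,
    map_zero] at h2
  have h3 := LinearMap.congr_fun h2 f
  change ξ (D.f f * (D.s σ⁻¹⁻¹ * D.mono fun i => d - 1 - (d - 1 - α i))) = 0 at h3
  have h4 : (fun i => d - 1 - (d - 1 - α i)) = α := by
    funext i
    have := hlt i
    omega
  rwa [h4, inv_inv] at h3

/-- By `form_dual`, the composite of `dualMap` with a ↦ (b ↦ form (b a)) is unitriangular, hence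
bijective. So `dualMap` is surjective as well as injective, and the other factor is bijective too.
-/
theorem form_bijective (ht : IsTeleporter t)
    (htr : ∀ f g : TensorPow k F n, trTensor n tr (f * g) = trTensor n tr (g * f))
    (hb : Function.Bijective (tensorForm k F n tr)) :
    Function.Bijective (fun a : A => T.form hd tr ∘ₗ LinearMap.mulRight k a) := by
  let Λ : A →ₗ[k] (A →ₗ[k] k) := (LinearMap.mul k A).flip.compr₂ (T.form hd tr)
  have hΛ : ∀ a b, Λ a b = T.form hd tr (b * a) := fun a b => rfl
  have key : Function.Bijective (T.dualMap hb ∘ₗ Λ) := by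
    refine D.bijective_of_unitriangular ht _ fun β g π => ?_
    rw [LinearMap.comp_apply]
    have hcoord : ∀ (α : Fin n → Fin d) σ, ∑ i, β i ≤ ∑ i, (α i : ℕ) →
        T.coord (T.dualMap hb (Λ (D.mono β * D.f g * D.s π))) α σ =
          if (∀ i, β i = α i) ∧ π = σ then g else 0 := by
      intro α σ hle
      refine T.coord_dualMap hb _ _ _ _ fun f => ?_
      rw [hΛ, T.form_dual hd ht htr α β hle]
      split_ifs
      · rfl
      · rw [permAct_zero, mul_zero, map_zero]
    by_cases hlt : ∃ i, d ≤ β i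
    · refine sub_mem ?_ (T.mono_mul_mem_filtLt ht hlt le_rfl g π)
      rw [← T.coord.symm_apply_apply (T.dualMap hb _)]
      refine T.coord_symm_mem_filtLt _ _ fun α σ hle => ?_
      rw [hcoord α σ hle, if_neg]
      rintro ⟨h, -⟩
      obtain ⟨i, hi⟩ := hlt
      have := h i
      have := (α i).2
      omega
    · push Not at hlt
      rw [← T.coord.symm_apply_apply (_ - _)]
      refine T.coord_symm_mem_filtLt _ _ fun α σ hle => ?_
      have h1 := T.coord_apply (fun i => ⟨β i, hlt i⟩) g π
      dsimp only at h1
      rw [map_sub, h1, Pi.sub_apply, Pi.sub_apply, hcoord α σ hle, sub_eq_zero]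
      by_cases h2 : ∀ i, β i = α i
      · obtain rfl : α = fun i => ⟨β i, hlt i⟩ := funext fun i => Fin.ext (h2 i).symm
        rw [Pi.single_eq_same, Pi.single_apply]
        simp [eq_comm]
      · rw [if_neg fun h => h2 h.1, Pi.single_eq_of_ne]
        · rfl
        · rintro rfl
          exact h2 fun i => rfl
  have hcomp : ⇑(T.dualMap hb ∘ₗ Λ) = T.dualMap hb ∘ Λ := rfl
  rw [hcomp] at key
  exact (Function.Bijective.of_comp_iff' ⟨T.dualMap_injective ht hb,
    Function.Surjective.of_comp key.2⟩ Λ).1 key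

end TruncatedBasis

end AffWr

namespace AffWr

open PiTensorProduct

/-! ### The grading of `F^{⊗ n}` -/

theorem mul_mem_iSup {k A : Type*} [CommRing k] [Ring A] [Algebra k A] (𝒢 : ℕ → Submodule k A)
    [SetLike.GradedMonoid 𝒢] {a b : A} (ha : a ∈ ⨆ m, 𝒢 m) (hb : b ∈ ⨆ m, 𝒢 m) :
    a * b ∈ ⨆ m, 𝒢 m := by
  induction ha using Submodule.iSup_induction' with
  | mem p a ha =>
    induction hb using Submodule.iSup_induction' with
    | mem q b hb => exact Submodule.mem_iSup_of_mem (p + q) (SetLike.mul_mem_graded ha hb)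
    | zero => rw [mul_zero]; exact zero_mem _
    | add b c _ _ hb hc => rw [mul_add]; exact add_mem hb hc
  | zero => rw [zero_mul]; exact zero_mem _
  | add b c _ _ hb hc => rw [add_mul]; exact add_mem hb hc

section TensorGrading

variable {k F : Type*} [CommRing k] [Ring F] [Algebra k F] {n : ℕ}
  (𝒜 : ℕ → Submodule k F) [GradedAlgebra 𝒜]

instance tensorGrading_gradedMonoid : SetLike.GradedMonoid (tensorGrading 𝒜 n) where
  one_mem := Submodule.subset_span ⟨0, 1, by simp, fun _ => SetLike.one_mem_graded 𝒜, rfl⟩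
  mul_mem p q f g hf hg := by
    have h := Submodule.mul_mem_mul hf hg
    rw [tensorGrading, tensorGrading, Submodule.span_mul_span] at h
    refine Submodule.span_mono ?_ h
    rintro _ ⟨_, ⟨d, f, hd, hf, rfl⟩, _, ⟨e, g, he, hg, rfl⟩, rfl⟩
    refine ⟨d + e, f * g, ?_, fun i => SetLike.mul_mem_graded (hf i) (hg i), tprod_mul_tprod f g⟩
    simp only [Pi.add_apply, Finset.sum_add_distrib, hd, he]

variable {𝒜}

theorem single_mem_tensorGrading {p : ℕ} {a : F} (ha : a ∈ 𝒜 p) (i : Fin n) :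
    singleAlgHom (R := k) (A := fun _ => F) i a ∈ tensorGrading 𝒜 n p := by
  refine Submodule.subset_span ⟨Pi.single i p, Pi.mulSingle i a, by simp, fun j => ?_, ?_⟩
  · by_cases h : j = i
    · subst h; simpa using ha
    · simpa [h] using SetLike.one_mem_graded 𝒜
  · rw [singleAlgHom_apply]; rfl

variable (𝒜) in
/-- Every element of `F^{⊗ n}` is a sum of homogeneous elements. -/
theorem tensorPow_homogeneous_induction {p : TensorPow k F n → Prop} (f : TensorPow k F n)
    (hom : ∀ m, ∀ f ∈ tensorGrading 𝒜 n m, p f) (add : ∀ f g, p f → p g → p (f + g)) : p f := by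
  have h : f ∈ ⨆ m, tensorGrading 𝒜 n m := by
    induction f using tensorPow_alg_induction with
    | one => exact Submodule.mem_iSup_of_mem 0 SetLike.GradedOne.one_mem
    | single i a =>
      induction a using DirectSum.Decomposition.inductionOn 𝒜 with
      | zero => rw [map_zero]; exact zero_mem _
      | homogeneous a => exact Submodule.mem_iSup_of_mem _ (single_mem_tensorGrading a.2 i)
      | add a b ha hb => rw [map_add]; exact add_mem ha hb
    | mul f g hf hg => exact mul_mem_iSup _ hf hg
    | add f g hf hg => exact add_mem hf hg
    | smul r f hf => exact Submodule.smul_mem _ r hf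
  induction h using Submodule.iSup_induction' with
  | mem m f hf => exact hom m f hf
  | zero => exact hom 0 0 (zero_mem _)
  | add f g _ _ hf hg => exact add f g hf hg

omit [GradedAlgebra 𝒜] in
theorem permAct_mem_tensorGrading {m : ℕ} {f : TensorPow k F n} (hf : f ∈ tensorGrading 𝒜 n m)
    (π : Equiv.Perm (Fin n)) : permAct π f ∈ tensorGrading 𝒜 n m := by
  have : tensorGrading 𝒜 n m ≤ (tensorGrading 𝒜 n m).comap (permLin π) := by
    refine Submodule.span_le.2 ?_
    rintro _ ⟨d, f, hd, hf, rfl⟩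
    refine Submodule.subset_span ⟨fun i => d (π⁻¹ i), fun i => f (π⁻¹ i), ?_, fun i => hf _, ?_⟩
    · rw [Equiv.sum_comp π⁻¹ d, hd]
    · exact permAct_tprod π f
  exact this hf

section Trace

variable {δ : ℕ} {tr : F →ₗ[k] k} (htr : IsGradedSymmetrizingForm 𝒜 δ tr)
include htr

omit [GradedAlgebra 𝒜] in
theorem trTensor_eq_zero {m : ℕ} (hm : m ≠ n * δ) {f : TensorPow k F n}
    (hf : f ∈ tensorGrading 𝒜 n m) : trTensor n tr f = 0 := by
  have : tensorGrading 𝒜 n m ≤ LinearMap.ker (trTensor n tr) := by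
    refine Submodule.span_le.2 ?_
    rintro _ ⟨d, f, hd, hf, rfl⟩
    have h : ∃ i, d i ≠ δ := by
      by_contra! h
      apply hm
      rw [← hd, Finset.sum_congr rfl fun i _ => h i]
      simp
    obtain ⟨i, hi⟩ := h
    change trTensor n tr _ = 0
    rw [trTensor_tprod]
    exact Finset.prod_eq_zero (Finset.mem_univ i) (htr.degree _ hi _ (hf i))
  exact this hf

/-- As tr lives in degree δ, the adjoint of the projection to degree p is the projection to degree δ
- p. The case split guards against truncated subtraction. -/
theorem tr_mul_proj (p : ℕ) (u v : F) : tr (u * GradedAlgebra.proj 𝒜 p v) =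
    tr ((if p ≤ δ then GradedAlgebra.proj 𝒜 (δ - p) else 0) u * v) := by
  induction u using DirectSum.Decomposition.inductionOn 𝒜 with
  | zero => simp
  | add a b ha hb => rw [add_mul, map_add, ha, hb, map_add, add_mul, map_add]
  | @homogeneous q u =>
    induction v using DirectSum.Decomposition.inductionOn 𝒜 with
    | zero => simp
    | add a b ha hb => rw [map_add, mul_add, map_add, ha, hb, mul_add, map_add]
    | @homogeneous r v =>
      have huv : q + r ≠ δ → tr ((u : F) * v) = 0 := fun h =>
        htr.degree _ h _ (SetLike.mul_mem_graded u.2 v.2)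
      have hv : GradedAlgebra.proj 𝒜 p (v : F) = if r = p then (v : F) else 0 := by
        rw [GradedAlgebra.proj_apply]
        split_ifs with h
        · subst h; exact DirectSum.decompose_of_mem_same 𝒜 v.2
        · exact DirectSum.decompose_of_mem_ne 𝒜 v.2 h
      have hu : ∀ l, GradedAlgebra.proj 𝒜 l (u : F) = if q = l then (u : F) else 0 := fun l => by
        rw [GradedAlgebra.proj_apply]
        split_ifs with h
        · subst h; exact DirectSum.decompose_of_mem_same 𝒜 u.2
        · exact DirectSum.decompose_of_mem_ne 𝒜 u.2 h
      rw [hv]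
      by_cases hp : p ≤ δ
      · rw [if_pos hp, hu]
        by_cases h1 : r = p <;> by_cases h2 : q = δ - p
        · rw [if_pos h1, if_pos h2]
        · rw [if_pos h1, if_neg h2, zero_mul, map_zero, huv (by omega)]
        · rw [if_neg h1, if_pos h2, mul_zero, map_zero, huv (by omega)]
        · rw [if_neg h1, if_neg h2, mul_zero, zero_mul]
      · rw [if_neg hp, LinearMap.zero_apply, zero_mul, map_zero]
        split_ifs with h1
        · exact huv (by omega)
        · rw [mul_zero, map_zero]

-- An operator on one leg of the Casimir element may be moved to the other leg as its adjoint for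
-- tr.
omit [GradedAlgebra 𝒜] in
theorem sum_map_basis {κ : Type*} [Fintype κ] (B : Module.Basis κ k F) {P : Type*}
    [AddCommGroup P] [Module k P] (β : F →ₗ[k] F →ₗ[k] P) (φ ψ : F →ₗ[k] F)
    (h : ∀ u v, tr (u * φ v) = tr (ψ u * v)) :
    ∑ a, β (φ (B a)) (dualBasis htr B a) = ∑ a, β (B a) (ψ (dualBasis htr B a)) := by
  have h1 : ∀ a, β (φ (B a)) (dualBasis htr B a) =
      ∑ c, tr (dualBasis htr B c * φ (B a)) • β (B c) (dualBasis htr B a) := fun a => by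
    conv_lhs => rw [← sum_tr_dualBasis htr B (φ (B a))]
    simp
  have h2 : ∀ a, β (B a) (ψ (dualBasis htr B a)) =
      ∑ c, tr (ψ (dualBasis htr B a) * B c) • β (B a) (dualBasis htr B c) := fun a => by
    conv_lhs => rw [← sum_tr_basis htr B (ψ (dualBasis htr B a))]
    simp
  simp only [h1, h2, h]
  rw [Finset.sum_comm]

/-- The basis need not be homogeneous. Split the first leg into its components of degree p; since
the projection is idempotent, one copy can be moved to the second leg, where it becomes the
projection to degree δ - p. -/
theorem tElem_mem_tensorGrading {κ : Type*} [Fintype κ] (B : Module.Basis κ k F) (i j : Fin n) :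
    tElem B (dualBasis htr B) i j ∈ tensorGrading 𝒜 n δ := by
  classical
  let S : Finset ℕ := Finset.univ.biUnion fun a => (DirectSum.decompose 𝒜 (B a)).support
  have hS : ∀ a, B a = ∑ p ∈ S, GradedAlgebra.proj 𝒜 p (B a) := fun a => by
    conv_lhs => rw [← DirectSum.sum_support_decompose 𝒜 (B a)]
    refine Finset.sum_subset (Finset.subset_biUnion_of_mem
      (fun a => (DirectSum.decompose 𝒜 (B a)).support) (Finset.mem_univ a)) fun p _ hp => ?_
    rw [DFinsupp.notMem_support_iff.1 hp]
    rfl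
  have h1 : tElem B (dualBasis htr B) i j = ∑ p ∈ S, ∑ a, pairLin (k := k) i j
      (GradedAlgebra.proj 𝒜 p (B a)) (dualBasis htr B a) := by
    rw [tElem_eq_sum_pairLin, Finset.sum_comm]
    refine Finset.sum_congr rfl fun a _ => ?_
    conv_lhs => rw [hS a]
    rw [map_sum, LinearMap.sum_apply]
  rw [h1]
  refine Submodule.sum_mem _ fun p _ => ?_
  have hidem : ∀ v, GradedAlgebra.proj 𝒜 p (GradedAlgebra.proj 𝒜 p v) =
      GradedAlgebra.proj 𝒜 p v := fun v =>
    DirectSum.decompose_of_mem_same 𝒜 (SetLike.coe_mem (DirectSum.decompose 𝒜 v p))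
  have h2 := sum_map_basis htr B ((pairLin (k := k) i j).comp (GradedAlgebra.proj 𝒜 p)) _ _
    (tr_mul_proj htr p)
  simp only [LinearMap.comp_apply, hidem] at h2
  rw [h2]
  refine Submodule.sum_mem _ fun a _ => ?_
  by_cases hp : p ≤ δ
  · rw [if_pos hp, pairLin_apply]
    have := SetLike.mul_mem_graded (A := tensorGrading 𝒜 n)
      (single_mem_tensorGrading (SetLike.coe_mem (DirectSum.decompose 𝒜 (B a) p)) i)
      (single_mem_tensorGrading
        (SetLike.coe_mem (DirectSum.decompose 𝒜 (dualBasis htr B a) (δ - p))) j)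
    rwa [Nat.add_sub_cancel' hp] at this
  · rw [if_neg hp, LinearMap.zero_apply, map_zero]
    exact zero_mem _

end Trace

theorem tprod_eq_prod_single (f : Fin n → F) :
    tprod k f = (List.ofFn fun i => singleAlgHom (R := k) (A := fun _ => F) i (f i)).prod := by
  have h1 : (List.ofFn fun i => (Pi.mulSingle i (f i) : Fin n → F)).prod = f := by
    funext j
    have := map_list_prod (Pi.evalMonoidHom (fun _ : Fin n => F) j)
      (List.ofFn fun i => (Pi.mulSingle i (f i) : Fin n → F))
    rw [Pi.evalMonoidHom_apply, List.map_ofFn] at this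
    rw [this, prod_ofFn_eq_single _ j fun i hi => ?_]
    · simp
    · simp [hi.symm]
  conv_lhs => rw [← h1]
  have h2 := map_list_prod (tprodMonoidHom (A := fun _ : Fin n => F) k)
    (List.ofFn fun i => (Pi.mulSingle i (f i) : Fin n → F))
  rw [List.map_ofFn] at h2
  exact h2

end TensorGrading

/-! ### Degrees recorded as exponents in a polynomial ring -/

section GradedHom

open Polynomial

variable {k F : Type*} [CommRing k] [Ring F] [Algebra k F] {n : ℕ} {A : Type*} [Ring A]
  [Algebra k A]

theorem prod_ofFn_monomial (d : Fin n → ℕ) (a : Fin n → A) :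
    (List.ofFn fun i => monomial (d i) (a i)).prod = monomial (∑ i, d i) (List.ofFn a).prod := by
  induction n with
  | zero => simp
  | succ n ih =>
    rw [List.ofFn_succ, List.ofFn_succ, List.prod_cons, List.prod_cons, ih, monomial_mul_monomial,
      Fin.sum_univ_succ]

variable (𝒜 : ℕ → Submodule k F) [GradedAlgebra 𝒜]

/-- A homomorphism on `F^{⊗ n}` with the grading recorded by the exponent of an indeterminate. -/
theorem exists_gradedMap (φ : TensorPow k F n →ₐ[k] A) :
    ∃ γ : TensorPow k F n →ₗ[k] A[X],
      ∀ m, ∀ f ∈ tensorGrading 𝒜 n m, γ f = monomial m (φ f) := by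
  let η : Fin n → F →ₗ[k] A[X] := fun i =>
    DirectSum.toModule k ℕ A[X] (fun p =>
      ((monomial p).restrictScalars k ∘ₗ φ.toLinearMap ∘ₗ
        (singleAlgHom (R := k) (A := fun _ => F) i).toLinearMap) ∘ₗ (𝒜 p).subtype) ∘ₗ
      (DirectSum.decomposeLinearEquiv 𝒜).toLinearMap
  have hη : ∀ i p, ∀ a ∈ 𝒜 p, η i a = monomial p (φ (singleAlgHom i a)) := by
    intro i p a ha
    simp only [η, LinearMap.comp_apply, LinearEquiv.coe_coe,
      DirectSum.decomposeLinearEquiv_apply]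
    rw [DirectSum.decompose_of_mem 𝒜 ha]
    exact DirectSum.toModule_lof k p _
  refine ⟨lift ((MultilinearMap.mkPiAlgebraFin k n A[X]).compLinearMap η), fun m => ?_⟩
  let γ := lift ((MultilinearMap.mkPiAlgebraFin k n A[X]).compLinearMap η)
  have : tensorGrading 𝒜 n m ≤
      LinearMap.ker (γ - (monomial m).restrictScalars k ∘ₗ φ.toLinearMap) := by
    refine Submodule.span_le.2 ?_
    rintro _ ⟨d, f, rfl, hf, rfl⟩
    change γ _ - monomial _ (φ _) = 0
    rw [sub_eq_zero, lift.tprod, MultilinearMap.compLinearMap_apply,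
      MultilinearMap.mkPiAlgebraFin_apply]
    have h1 : (fun i => η i (f i)) = fun i => monomial (d i) (φ (singleAlgHom i (f i))) :=
      funext fun i => hη i _ _ (hf i)
    rw [h1, prod_ofFn_monomial, tprod_eq_prod_single, map_list_prod φ, List.map_ofFn]
    rfl
  intro f hf
  exact sub_eq_zero.1 (this hf)

variable {κ : Type*} [Fintype κ] {b b' : κ → F} (δ : ℕ)

/-- The grading of `𝒜_n(F)`, recorded by the exponent of an indeterminate. -/
theorem exists_gradingHom (D : AffineWreathData (k := k) (n := n) (tElem b b') A)
    (hD : ∀ i j : Fin n, tElem (k := k) b b' i j ∈ tensorGrading 𝒜 n δ) :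
    ∃ R : AffineWreath k n b b' →ₐ[k] A[X],
      (∀ i, R (AffineWreath.X k b b' i) = monomial δ (D.x i)) ∧
      (∀ m, ∀ f ∈ tensorGrading 𝒜 n m, R (AffineWreath.ofTensor b b' f) = monomial m (D.f f)) ∧
      ∀ π, R (AffineWreath.ofPerm k b b' π) = monomial 0 (D.s π) := by
  obtain ⟨γ, hγ⟩ := exists_gradedMap 𝒜 D.f
  let G : Gen k F n → A[X] := fun g => match g with
    | .x i => monomial δ (D.x i)
    | .f f => γ f
    | .s π => monomial 0 (D.s π)
  have hG : ∀ p q : FreeAlgebra k (Gen k F n), Rel b b' p q →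
      FreeAlgebra.lift k G p = FreeAlgebra.lift k G q := by
    intro p q h
    induction h with
    | x_comm i j =>
      simp only [map_mul, FreeAlgebra.lift_ι_apply, G, monomial_mul_monomial, D.x_comm i j]
    | f_add f g => simp only [map_add, FreeAlgebra.lift_ι_apply, G]
    | f_smul r f => simp only [map_smul, FreeAlgebra.lift_ι_apply, G]
    -- γ is given only as a linear map, so multiplicativity is checked on homogeneous elements,
    -- which span.
    | f_mul f g =>
      simp only [map_mul, FreeAlgebra.lift_ι_apply, G]
      induction f using tensorPow_homogeneous_induction 𝒜 with
      | hom p f hf =>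
        induction g using tensorPow_homogeneous_induction 𝒜 with
        | hom q g hg =>
          rw [hγ p f hf, hγ q g hg, hγ (p + q) _ (SetLike.mul_mem_graded hf hg),
            monomial_mul_monomial, map_mul]
        | add g h hg hh => rw [mul_add, map_add, hg, hh, map_add, mul_add]
      | add f h hf hh => rw [add_mul, map_add, hf, hh, map_add, add_mul]
    | f_one =>
      simp only [map_one, FreeAlgebra.lift_ι_apply, G]
      rw [hγ 0 1 SetLike.GradedOne.one_mem, map_one]
      rfl
    | s_mul π σ =>
      simp only [map_mul, FreeAlgebra.lift_ι_apply, G, monomial_mul_monomial, add_zero]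
    | s_one =>
      simp only [map_one, FreeAlgebra.lift_ι_apply, G]
      rfl
    | f_x f i =>
      simp only [map_mul, FreeAlgebra.lift_ι_apply, G]
      induction f using tensorPow_homogeneous_induction 𝒜 with
      | hom p f hf =>
        rw [hγ p f hf, monomial_mul_monomial, monomial_mul_monomial, D.f_x, add_comm]
      | add f h hf hh => rw [map_add, add_mul, hf, hh, mul_add]
    | s_x_of_ne i hi j hj hj' =>
      simp only [map_mul, FreeAlgebra.lift_ι_apply, G, monomial_mul_monomial]
      rw [D.adj_x, adjElem_of_ne i hi j hj hj', map_zero, add_zero, add_comm,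
        Equiv.swap_apply_of_ne_of_ne (fun h => hj (by rw [h])) (fun h => hj' (by rw [h]))]
    | s_x i hi =>
      simp only [map_mul, map_sub, FreeAlgebra.lift_ι_apply, G, monomial_mul_monomial]
      rw [D.adj_x, adjElem_left, Equiv.swap_apply_left, map_neg, hγ δ _ (hD _ _), add_comm 0 δ,
        ← sub_eq_add_neg, add_zero, map_sub]
    | s_f π f =>
      simp only [map_mul, FreeAlgebra.lift_ι_apply, G]
      induction f using tensorPow_homogeneous_induction 𝒜 with
      | hom p f hf =>
        rw [hγ p f hf, hγ p _ (permAct_mem_tensorGrading hf π), monomial_mul_monomial,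
          monomial_mul_monomial, D.s_f, add_comm]
      | add f h hf hh => rw [map_add, mul_add, hf, hh, permAct_add, map_add, add_mul]
  let R : AffineWreath k n b b' →ₐ[k] A[X] :=
    RingQuot.liftAlgHom k ⟨FreeAlgebra.lift k G, fun p q h => hG p q h⟩
  have hR : ∀ g, R (AffineWreath.gen b b' g) = G g := fun g => by
    rw [AffineWreath.gen, RingQuot.liftAlgHom_mkAlgHom_apply, FreeAlgebra.lift_ι_apply]
  exact ⟨R, fun i => hR _, fun m f hf => (hR _).trans (hγ m f hf), fun π => hR _⟩

end GradedHom

/-! ### The gradings of `𝒜_n(F)` and its cyclotomic quotients -/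

section Gradings

variable {k F : Type*} [CommRing k] [Ring F] [Algebra k F] {n : ℕ}
  {κ : Type*} [Fintype κ] {b b' : κ → F} (𝒜 : ℕ → Submodule k F) (δ : ℕ)

open AffineWreath

theorem IsWord.mul {p q : ℕ} {a a' : AffineWreath k n b b'} (ha : IsWord b b' 𝒜 δ p a)
    (ha' : IsWord b b' 𝒜 δ q a') : IsWord b b' 𝒜 δ (p + q) (a * a') := by
  induction ha with
  | one => rwa [zero_add, one_mul]
  | x_mul i m a _ ih => rw [add_assoc, mul_assoc]; exact .x_mul i _ _ ih
  | f_mul p f m a hf _ ih => rw [add_assoc, mul_assoc]; exact .f_mul p f _ _ hf ih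
  | s_mul π m a _ ih => rw [mul_assoc]; exact .s_mul π _ _ ih

instance grading_gradedMonoid : SetLike.GradedMonoid (AffineWreath.grading n b b' 𝒜 δ) where
  one_mem := Submodule.subset_span .one
  mul_mem p q f g hf hg := by
    have h := Submodule.mul_mem_mul hf hg
    rw [AffineWreath.grading, AffineWreath.grading, Submodule.span_mul_span] at h
    refine Submodule.span_mono ?_ h
    rintro _ ⟨_, hf, _, hg, rfl⟩
    exact IsWord.mul 𝒜 δ hf hg

variable {𝒜 δ}

theorem X_mem_grading (i : Fin n) : X k b b' i ∈ AffineWreath.grading n b b' 𝒜 δ δ := by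
  have := IsWord.x_mul (𝒜 := 𝒜) (δ := δ) i 0 (1 : AffineWreath k n b b') .one
  rw [add_zero, mul_one] at this
  exact Submodule.subset_span this

theorem ofTensor_mem_grading {m : ℕ} {f : TensorPow k F n} (hf : f ∈ tensorGrading 𝒜 n m) :
    ofTensor b b' f ∈ AffineWreath.grading n b b' 𝒜 δ m := by
  have := IsWord.f_mul (δ := δ) m f 0 (1 : AffineWreath k n b b') hf .one
  rw [add_zero, mul_one] at this
  exact Submodule.subset_span this

theorem ofPerm_mem_grading (π : Equiv.Perm (Fin n)) :
    ofPerm k b b' π ∈ AffineWreath.grading n b b' 𝒜 δ 0 := by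
  have := IsWord.s_mul (𝒜 := 𝒜) (δ := δ) π 0 (1 : AffineWreath k n b b') .one
  rw [mul_one] at this
  exact Submodule.subset_span this

theorem prod_ofFn_mem_graded {R : Type*} [Ring R] [Algebra k R] (𝒢 : ℕ → Submodule k R)
    [SetLike.GradedMonoid 𝒢] {d : ℕ} (a : Fin d → R) (m : Fin d → ℕ) (h : ∀ j, a j ∈ 𝒢 (m j)) :
    (List.ofFn a).prod ∈ 𝒢 (∑ j, m j) := by
  have := SetLike.list_prod_ofFn_mem_graded m a h
  rwa [List.sum_ofFn] at this

theorem xPow_mem_grading (α : Fin n → ℕ) :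
    xPow k b b' α ∈ AffineWreath.grading n b b' 𝒜 δ (∑ i, α i * δ) :=
  prod_ofFn_mem_graded _ _ _ fun i => SetLike.pow_mem_graded (α i) (X_mem_grading i)

theorem chi_mem_grading [NeZero n] {d : ℕ} (c : Fin d → TensorPow k F n)
    (hc : ∀ j, c j ∈ tensorGrading 𝒜 n δ) :
    chi b b' c ∈ AffineWreath.grading n b b' 𝒜 δ (∑ _j : Fin d, δ) :=
  prod_ofFn_mem_graded _ _ _ fun j => sub_mem (X_mem_grading 0) (ofTensor_mem_grading (hc j))

variable (𝒜 δ) in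
theorem iSup_grading [GradedAlgebra 𝒜] (ht : IsTeleporter (k := k) (n := n) (tElem b b')) :
    ⨆ m, AffineWreath.grading n b b' 𝒜 δ m = ⊤ := by
  rw [eq_top_iff]
  intro a _
  induction a using (affineData ht).alg_induction with
  | x i => exact Submodule.mem_iSup_of_mem _ (X_mem_grading i)
  | f f =>
    induction f using tensorPow_homogeneous_induction 𝒜 with
    | hom m f hf => exact Submodule.mem_iSup_of_mem m (ofTensor_mem_grading hf)
    | add f g hf hg => rw [map_add]; exact add_mem (hf trivial) (hg trivial)
  | s π => exact Submodule.mem_iSup_of_mem _ (ofPerm_mem_grading π)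
  | add a b ha hb => exact add_mem (ha trivial) (hb trivial)
  | mul a b ha hb => exact mul_mem_iSup _ (ha trivial) (hb trivial)

/-- A homomorphism which is homogeneous on generators is homogeneous. -/
theorem gradingHom_apply [GradedAlgebra 𝒜] {A : Type*} [Ring A] [Algebra k A]
    (R : AffineWreath k n b b' →ₐ[k] Polynomial A) (q : AffineWreath k n b b' →ₐ[k] A)
    (hx : ∀ i, R (X k b b' i) = Polynomial.monomial δ (q (X k b b' i)))
    (hf : ∀ m, ∀ f ∈ tensorGrading 𝒜 n m,
      R (ofTensor b b' f) = Polynomial.monomial m (q (ofTensor b b' f)))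
    (hs : ∀ π, R (ofPerm k b b' π) = Polynomial.monomial 0 (q (ofPerm k b b' π))) {m : ℕ}
    {a : AffineWreath k n b b'} (ha : a ∈ AffineWreath.grading n b b' 𝒜 δ m) :
    R a = Polynomial.monomial m (q a) := by
  induction ha using Submodule.span_induction with
  | mem a ha =>
    induction ha with
    | one => rw [map_one, map_one]; rfl
    | x_mul i m a _ ih => rw [map_mul, hx, ih, Polynomial.monomial_mul_monomial, map_mul q]
    | f_mul p f m a h _ ih => rw [map_mul, hf p f h, ih, Polynomial.monomial_mul_monomial, map_mul q]
    | s_mul π m a _ ih => rw [map_mul, hs, ih, Polynomial.monomial_mul_monomial, map_mul q, zero_add]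
  | zero => rw [map_zero, map_zero, map_zero]
  | add a b _ _ ha hb => rw [map_add, map_add, map_add, ha, hb]
  | smul r a _ ha => rw [map_smul, map_smul, ha, Polynomial.smul_monomial]

end Gradings

end AffWr

namespace AffWr

open PiTensorProduct

/-! ### Cyclotomic quotients are graded symmetric algebras -/

section Internal

variable {k A : Type*} [CommRing k] [Ring A] [Algebra k A] (𝒢 : ℕ → Submodule k A)
  (R : A →ₗ[k] Polynomial A) (hR : ∀ m, ∀ a ∈ 𝒢 m, R a = Polynomial.monomial m a)

include hR in
/-- A family of submodules is a grading if the degree can be recorded by a linear map. -/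
theorem isInternal_of_monomial (htop : ⨆ m, 𝒢 m = ⊤) : DirectSum.IsInternal 𝒢 := by
  constructor
  · rw [injective_iff_map_eq_zero]
    intro v hv
    -- The coefficient of X^m under `R` recovers the component of degree m.
    have key : ∀ v : DirectSum ℕ fun m => 𝒢 m, ∀ m,
        (R (DirectSum.coeAddMonoidHom 𝒢 v)).coeff m = v m := by
      intro v m
      induction v using DirectSum.induction_on with
      | zero => simp
      | of p a =>
        rw [DirectSum.coeAddMonoidHom_of, hR p a a.2, Polynomial.coeff_monomial,
          DirectSum.coe_of_apply]
        split_ifs <;> rfl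
      | add v w hv hw =>
        rw [map_add, map_add, Polynomial.coeff_add, hv, hw]
        rfl
    ext m
    rw [← key, hv, map_zero]
    rfl
  · have h : ∀ a ∈ ⨆ m, 𝒢 m, ∃ v, DirectSum.coeAddMonoidHom 𝒢 v = a := by
      intro a ha
      induction ha using Submodule.iSup_induction' with
      | mem p a ha =>
        exact ⟨DirectSum.of (fun m => 𝒢 m) p ⟨a, ha⟩, DirectSum.coeAddMonoidHom_of 𝒢 p ⟨a, ha⟩⟩
      | zero => exact ⟨0, map_zero _⟩
      | add a b _ _ ha hb =>
        obtain ⟨v, rfl⟩ := ha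
        obtain ⟨w, rfl⟩ := hb
        exact ⟨v + w, map_add _ _ _⟩
    exact fun a => h a (htop ▸ Submodule.mem_top)

end Internal

section Quotient

variable {k F : Type*} [CommRing k] [Ring F] [Algebra k F] {n : ℕ} [NeZero n] {κ : Type*}
  [Fintype κ] {b b' : κ → F} {d : ℕ} {c : Fin d → TensorPow k F n} (𝒜 : ℕ → Submodule k F) (δ : ℕ)

instance cycGrading_gradedMonoid : SetLike.GradedMonoid (Cyclotomic.grading b b' 𝒜 δ c) where
  one_mem := ⟨1, SetLike.GradedOne.one_mem, rfl⟩
  mul_mem := by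
    rintro p q _ _ ⟨a, ha, rfl⟩ ⟨a', ha', rfl⟩
    exact ⟨a * a', SetLike.mul_mem_graded ha ha', rfl⟩

theorem proj_monomial (ht : IsTeleporter (k := k) (n := n) (tElem b b')) (α : Fin n → ℕ)
    (f : TensorPow k F n) (π : Equiv.Perm (Fin n)) :
    Cyclotomic.proj b b' c (AffineWreath.xPow k b b' α * AffineWreath.ofTensor b b' f *
      AffineWreath.ofPerm k b b' π) =
      (cycData c ht).mono α * (cycData c ht).f f * (cycData c ht).s π := by
  rw [cycData, AffineWreathData.map_mono]
  rfl

variable [GradedAlgebra 𝒜]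

theorem iSup_cycGrading (ht : IsTeleporter (k := k) (n := n) (tElem b b')) :
    ⨆ m, Cyclotomic.grading b b' 𝒜 δ c m = ⊤ := by
  unfold Cyclotomic.grading
  rw [← Submodule.map_iSup, iSup_grading 𝒜 δ ht, Submodule.map_top]
  exact LinearMap.range_eq_top.2 (projHom_surjective c)

/-- χ_C is homogeneous and vanishes in the quotient, so the degree-recording homomorphism kills it
and factors through the quotient. -/
theorem exists_cycGradingMap (ht : IsTeleporter (k := k) (n := n) (tElem b b'))
    (htδ : ∀ i j : Fin n, tElem (k := k) b b' i j ∈ tensorGrading 𝒜 n δ)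
    (hc : ∀ j, c j ∈ tensorGrading 𝒜 n δ) :
    ∃ R : Cyclotomic b b' c →ₗ[k] Polynomial (Cyclotomic b b' c),
      ∀ m, ∀ a ∈ Cyclotomic.grading b b' 𝒜 δ c m, R a = Polynomial.monomial m a := by
  obtain ⟨R, hx, hf, hs⟩ := exists_gradingHom 𝒜 δ (cycData c ht) htδ
  have hR : ∀ m, ∀ a ∈ AffineWreath.grading n b b' 𝒜 δ m,
      R a = Polynomial.monomial m (projHom b b' c a) := fun m a ha =>
    gradingHom_apply R (projHom b b' c) hx hf hs ha
  have hchi : R (AffineWreath.chi b b' c) = 0 := by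
    rw [hR _ _ (chi_mem_grading c hc), (projHom_eq_zero_iff c _).2 (TwoSidedIdeal.subset_span rfl),
      map_zero]
  have hle : LinearMap.ker (projHom b b' c).toLinearMap ≤ LinearMap.ker R.toLinearMap := by
    intro a ha
    have h := (projHom_eq_zero_iff c a).1 ha
    have h2 : AffineWreath.cycIdeal b b' c ≤ TwoSidedIdeal.ker R :=
      TwoSidedIdeal.span_le.2 (Set.singleton_subset_iff.2 ((TwoSidedIdeal.mem_ker R).2 hchi))
    exact (TwoSidedIdeal.mem_ker R).1 (h2 h)
  let e := (projHom b b' c).toLinearMap.quotKerEquivOfSurjective (projHom_surjective c)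
  refine ⟨(LinearMap.ker (projHom b b' c).toLinearMap).liftQ R.toLinearMap hle ∘ₗ
    e.symm.toLinearMap, ?_⟩
  rintro m _ ⟨a, ha, rfl⟩
  have he : e.symm (Cyclotomic.proj b b' c a) = Submodule.Quotient.mk a := by
    rw [LinearEquiv.symm_apply_eq]; rfl
  rw [LinearMap.comp_apply, LinearEquiv.coe_coe, he]
  exact hR m a ha

variable {𝒜 δ} {tr : F →ₗ[k] k} (htr : IsGradedSymmetrizingForm 𝒜 δ tr)
include htr

/-- Composing the form with extraction of the degree-m part gives zero on the basis: a nonzero value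
requires degree n(d-1)δ from the x_i and nδ from F^{⊗n}, which total ndδ. -/
theorem form_eq_zero_of_mem (ht : IsTeleporter (k := k) (n := n) (tElem b b'))
    (htδ : ∀ i j : Fin n, tElem (k := k) b b' i j ∈ tensorGrading 𝒜 n δ)
    (hc : ∀ j, c j ∈ tensorGrading 𝒜 n δ) (T : TruncatedBasis (cycData c ht) d) (hd : 0 < d)
    {m : ℕ} (hm : m ≠ n * d * δ) {a : Cyclotomic b b' c}
    (ha : a ∈ Cyclotomic.grading b b' 𝒜 δ c m) : T.form hd tr a = 0 := by
  obtain ⟨R, hR⟩ := exists_cycGradingMap 𝒜 δ ht htδ hc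
  have key : T.form hd tr ∘ₗ (Polynomial.lcoeff (Cyclotomic b b' c) m).restrictScalars k ∘ₗ R =
      0 := by
    refine T.hom_ext ht fun α g π hlt => ?_
    rw [LinearMap.zero_apply]
    induction g using tensorPow_homogeneous_induction 𝒜 with
    | add f g hf hg => rw [map_add, mul_add, add_mul, map_add, hf, hg, add_zero]
    | hom p g hg =>
      have hmem : (cycData c ht).mono α * (cycData c ht).f g * (cycData c ht).s π ∈
          Cyclotomic.grading b b' 𝒜 δ c (∑ i, α i * δ + p + 0) := by
        refine ⟨AffineWreath.xPow k b b' α * AffineWreath.ofTensor b b' g *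
          AffineWreath.ofPerm k b b' π, SetLike.mul_mem_graded (SetLike.mul_mem_graded
            (xPow_mem_grading α) (ofTensor_mem_grading hg)) (ofPerm_mem_grading π),
            proj_monomial ht α g π⟩
      rw [LinearMap.comp_apply, LinearMap.comp_apply, hR _ _ hmem]
      change T.form hd tr ((Polynomial.monomial _ _).coeff m) = 0
      rw [Polynomial.coeff_monomial]
      split_ifs with h
      · rw [T.form_apply_of_lt hd tr hlt]
        split_ifs with h2
        · refine trTensor_eq_zero htr (fun hp => hm ?_) hg
          rw [← h, hp, ← Finset.sum_mul, Finset.sum_congr rfl fun i _ => h2.1 i]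
          obtain ⟨d, rfl⟩ := Nat.exists_eq_succ_of_ne_zero hd.ne'
          simp
          ring
        · rfl
      · exact map_zero _
  have h := LinearMap.congr_fun key a
  rw [LinearMap.comp_apply, LinearMap.comp_apply, hR m a ha] at h
  change T.form hd tr ((Polynomial.monomial m a).coeff m) = 0 at h
  rwa [Polynomial.coeff_monomial_same] at h

end Quotient

end AffWr

end

/-! ### The main theorem -/

open AffWr in
theorem mainTheorem11 {k : Type*} [CommRing k] {F : Type*} [Ring F] [Algebra k F]
    (𝒜 : ℕ → Submodule k F) [GradedAlgebra 𝒜] (δ : ℕ) (tr : F →ₗ[k] k)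
    (htr : IsGradedSymmetrizingForm 𝒜 δ tr)
    {κ : Type*} [Fintype κ] (B : Module.Basis κ k F)
    (n : ℕ) [NeZero n] (d : ℕ) (c : Fin d → TensorPow k F n)
    (hc : ∀ j, IsCycParam 𝒜 δ (c j)) :
    Module.Free k (Cyclotomic B (dualBasis htr B) c) ∧
    Module.Finite k (Cyclotomic B (dualBasis htr B) c) ∧
    SetLike.GradedMonoid (Cyclotomic.grading B (dualBasis htr B) 𝒜 δ c) ∧
    DirectSum.IsInternal (Cyclotomic.grading B (dualBasis htr B) 𝒜 δ c) ∧
    ∃ τ : Cyclotomic B (dualBasis htr B) c →ₗ[k] k,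
      (∀ (α : Fin n → ℕ) (f : TensorPow k F n) (π : Equiv.Perm (Fin n)), (∀ i, α i < d) →
        τ (Cyclotomic.proj B (dualBasis htr B) c
            (AffineWreath.xPow k B (dualBasis htr B) α *
              AffineWreath.ofTensor B (dualBasis htr B) f *
              AffineWreath.ofPerm k B (dualBasis htr B) π)) =
          if (∀ i, α i = d - 1) ∧ π = 1 then trTensor n tr f else 0) ∧
      IsGradedSymmetrizingForm (Cyclotomic.grading B (dualBasis htr B) 𝒜 δ c) (n * d * δ) τ := by
  have ht : IsTeleporter (k := k) (n := n) (tElem B (dualBasis htr B)) := isTeleporter_tElem htr B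
  have htδ : ∀ i j : Fin n, tElem (k := k) B (dualBasis htr B) i j ∈ tensorGrading 𝒜 n δ :=
    tElem_mem_tensorGrading htr B
  obtain ⟨T⟩ := exists_cyc_truncatedBasis c ht (fun j => (hc j).invariant)
    fun j => commute_of_mem_centerTensor (hc j).mem_center
  obtain ⟨R, hR⟩ := exists_cycGradingMap 𝒜 δ ht htδ fun j => (hc j).mem_degree
  let Bn := Basis.piTensorProduct (fun _ : Fin n => B)
  have hfree : Module.Free k (TensorPow k F n) := Module.Free.of_basis Bn
  have hfin : Module.Finite k (TensorPow k F n) := Module.Finite.of_basis Bn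
  refine ⟨Module.Free.of_equiv T.coord.symm, Module.Finite.equiv T.coord.symm, inferInstance,
    isInternal_of_monomial _ R hR (iSup_cycGrading 𝒜 δ ht), ?_⟩
  rcases Nat.eq_zero_or_pos d with rfl | hd
  -- For d = 0 the index set `Fin n → Fin 0` is empty because n ≥ 1, so the quotient is zero and the
  -- zero form works.
  · have hV : Subsingleton (Cyclotomic B (dualBasis htr B) c) := T.coord.injective.subsingleton
    refine ⟨0, fun α f π h => absurd (h 0) (Nat.not_lt_zero _), fun a b => rfl,
      ⟨fun a b _ => Subsingleton.elim a b, fun φ => ⟨0, LinearMap.ext fun a => ?_⟩⟩,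
      fun _ _ _ _ => rfl⟩
    rw [Subsingleton.elim a 0, map_zero, map_zero]
  · have hcomm := trTensor_comm (n := n) htr
    refine ⟨T.form hd tr, fun α f π h => ?_, T.form_comm hd ht hcomm,
      T.form_bijective hd ht hcomm (trTensor_bijective htr B), fun m hm a ha =>
        form_eq_zero_of_mem htr ht htδ (fun j => (hc j).mem_degree) T hd hm ha⟩
    rw [proj_monomial ht, T.form_apply_of_lt hd tr h f π]
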